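/- Let $M$ be a smooth (Hausdorff) manifold of dimension $n>1$. A projective class on a manifold is a class of smooth torsion-free linear connections having the same geodesics up to reparametrisation; on an $m$-dimensional manifold its coefficients in a chart are $\Pi^k_{ij}=\Gamma^k_{ij}-\frac1{m+1}(\delta^k_i\Gamma^s_{sj}+\delta^k_j\Gamma^s_{is})$, where $\Gamma^k_{ij}$ are the coefficients of any connection of the class. For a symmetric tensor field $S^{ij}$ on it, the projective Laplacian is the operator on smooth functions given in every chart by $$S^{ij}\partial_i\partial_j+\Big(\tfrac{2}{m+3}\,\partial_jS^{ij}-\tfrac{m+1}{m+3}\,S^{jk}\Pi^i_{jk}\Big)\partial_i .$$ Let $\mathfrak V(M)=\bigoplus_{\mu\in\mathbb R}\mathfrak V_\mu(M)$ be the algebra of densities $\phi(x)|Dx|^\mu$. Let $\tilde M\to M$ be the bundle having, over every chart $x^1,\dots,x^n$ of $M$, coordinates $x^0,x^1,\dots,x^n$ with $\bar x^0=x^0+\log J$, where $J$ is the absolute value of the Jacobian determinant of $x\mapsto\bar x$; a density $\phi(x)|Dx|^\mu$ is identified with the function $\phi(x)e^{\mu x^0}$, so that $\mathfrak V(M)\subset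 C^\infty(\tilde M)$ and $\partial_0$ acts on $\mathfrak V_\mu(M)$ as multiplication by $\mu$. A projective class $\Pi$ on $M$ induces on $\tilde M$ the projective class of the connection $$\tilde\Gamma^k_{ij}=\Pi^k_{ij},\quad \tilde\Gamma^{a}_{0b}=\tilde\Gamma^a_{b0}=-\tfrac{\delta^a_b}{n+1}\ (0\le a,b\le n),\quad \tilde\Gamma^0_{ij}=\tfrac{n+1}{n-1}\big(\partial_s\Pi^s_{ij}-\Pi^p_{qi}\Pi^q_{pj}\big).$$ Let $M$ be endowed with a projective class $\Pi$ and with a bracket $\{\cdot,\cdot\}$ of weight $\lambda\in\mathbb R$ on $\mathfrak V(M)$, that is, a symmetric biderivation with $\{\mathfrak V_\mu,\mathfrak V_\nu\}\subset\mathfrak V_{\mu+\nu+\lambda}$ which obeys the power rule $\{|Dx|^s,a\}=s|Dx|^{s-1}\{|Dx|,a\}$ for all real $s$ and all $a\in\mathfrak V(M)$ in local coordinates. Then: 1. In every chart the bracket has smooth components $S^{ij},\gamma^i,\theta$ defined by $\{x^i,x^j\}=S^{ij}|Dx|^\lambda$, $\{x^i,|Dx|\}=\gamma^i|Dx|^{\lambda+1}$,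 $\{|Dx|,|Dx|\}=\theta|Dx|^{\lambda+2}$. There is exactly one projective class on $\tilde M$ induced by $\Pi$ as above, and exactly one symmetric tensor field $\tilde S$ on $\tilde M$ with $\{a,b\}=\tilde S(da,db)$ for all $a,b\in\mathfrak V(M)\subset C^\infty(\tilde M)$; its components are $\tilde S^{ij}=e^{\lambda x^0}S^{ij}$, $\tilde S^{0i}=\tilde S^{i0}=e^{\lambda x^0}\gamma^i$, $\tilde S^{00}=e^{\lambda x^0}\theta$. 2. The projective Laplacian on $\tilde M$ of the tensor field $\tilde S$ and the induced projective class maps $\mathfrak V(M)$ to itself. Its restriction $\tilde\Delta:\mathfrak V(M)\to\mathfrak V(M)$ is uniquely determined by the projective class and the bracket, is a differential operator of order at most two, and generates the bracket in the normalisation $$2\{a,b\}=\tilde\Delta(ab)-a\,\tilde\Delta(b)-\tilde\Delta(a)\,b+ab\,\tilde\Delta(1).$$ In every chart $$\begin{aligned}\tilde\Delta=e^{\lambda x^0}\Big(&S^{ij}\partial_i\partial_j+2\gamma^i\partial_i\partial_0+\theta\,\partial_0^2+\Big(\tfrac{2}{n+4}\partial_jS^{ij}+\tfrac{2(\lambda+n\lambda+1)}{(n+1)(n+4)}\gamma^i-\tfrac{n+2}{n+4}S^{jk}\Pi^i_{jk}\Big)\partial_i\\&+\Big(\tfrac{2}{n+4}\partial_k\gamma^k+\tfrac{2\lambda+2\lambda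 n-n}{(n+1)(n+4)}\theta-\tfrac{(n+1)(n+2)}{(n-1)(n+4)}S^{ij}\big(\partial_s\Pi^s_{ij}-\Pi^p_{qi}\Pi^q_{pj}\big)\Big)\partial_0\Big).\end{aligned}$$ -/

import Mathlib

open Set Filter Topology Bundle
open scoped Manifold ContDiff

noncomputable section

namespace ProjDens

abbrev E (m : ℕ) : Type := EuclideanSpace ℝ (Fin m)

/-- The partial derivative `∂_i f` of a function on coordinate space. -/
def pd {m : ℕ} (i : Fin m) (f : E m → ℝ) (x : E m) : ℝ :=
  fderiv ℝ f x (EuclideanSpace.single i 1)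

/-- The charts (local coordinate systems) of an `m`-dimensional smooth manifold `N`: all members of
the maximal smooth atlas. -/
abbrev Chart (m : ℕ) (N : Type*) [TopologicalSpace N] [ChartedSpace (E m) N] : Type _ :=
  {e : OpenPartialHomeomorph N (E m) // e ∈ IsManifold.maximalAtlas 𝓘(ℝ, E m) ∞ N}

section Manifold

variable {m : ℕ} {N : Type*} [TopologicalSpace N] [ChartedSpace (E m) N]

/-- The change of coordinates from the chart `e` to the chart `e'`. -/
def coordTrans (e e' : Chart m N) (x : E m) : E m := e'.1 (e.1.symm x)

/-- The coordinate domain on which the change of coordinates from `e` to `e'` is defined. -/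
def overlap (e e' : Chart m N) : Set (E m) := (e.1.symm ≫ₕ e'.1).source

/-- The absolute value `J` of the Jacobian determinant of the change of coordinates. -/
def jac (e e' : Chart m N) (x : E m) : ℝ := |(fderiv ℝ (coordTrans e e') x).det|

lemma mem_overlap {e e' : Chart m N} {x : E m} :
    x ∈ overlap e e' ↔ x ∈ e.1.target ∧ e.1.symm x ∈ e'.1.source := by
  simp [overlap]

lemma isOpen_overlap (e e' : Chart m N) : IsOpen (overlap e e') :=
  (e.1.symm ≫ₕ e'.1).open_source

lemma contDiffOn_trans (e e' : Chart m N) : ContDiffOn ℝ ∞ (coordTrans e e') (overlap e e') := by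
  have h := StructureGroupoid.compatible_of_mem_maximalAtlas e.2 e'.2
  rw [contDiffGroupoid, mem_groupoid_of_pregroupoid] at h
  have h1 := h.1
  simp only [contDiffPregroupoid, mfld_simps] at h1
  exact h1.congr_mono (fun _ _ => rfl) (by simp [overlap])

lemma trans_mem {e e' : Chart m N} {x : E m} (hx : x ∈ overlap e e') :
    coordTrans e e' x ∈ overlap e' e := by
  rw [mem_overlap] at hx ⊢
  refine ⟨e'.1.map_source hx.2, ?_⟩
  rw [coordTrans, e'.1.left_inv hx.2]
  exact e.1.map_target hx.1

lemma differentiableAt_trans {e e' : Chart m N} {x : E m} (hx : x ∈ overlap e e') :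
    DifferentiableAt ℝ (coordTrans e e') x :=
  ((contDiffOn_trans e e').contDiffAt ((isOpen_overlap e e').mem_nhds hx)).differentiableAt
    (by simp)

lemma fderiv_trans_comp {e e' e'' : Chart m N} {x : E m} (hx : x ∈ overlap e e')
    (hx' : x ∈ overlap e e'') :
    fderiv ℝ (coordTrans e e'') x =
      (fderiv ℝ (coordTrans e' e'') (coordTrans e e' x)).comp (fderiv ℝ (coordTrans e e') x) := by
  have h1 := mem_overlap.1 hx
  have h2 := mem_overlap.1 hx'
  have h3 : coordTrans e e' x ∈ overlap e' e'' := by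
    rw [mem_overlap, coordTrans, e'.1.left_inv h1.2]
    exact ⟨e'.1.map_source h1.2, h2.2⟩
  rw [← fderiv_comp x (differentiableAt_trans h3) (differentiableAt_trans hx)]
  apply Filter.EventuallyEq.fderiv_eq
  filter_upwards [(isOpen_overlap e e').mem_nhds hx] with y hy
  simp [coordTrans, e'.1.left_inv (mem_overlap.1 hy).2]

lemma jac_comp {e e' e'' : Chart m N} {x : E m} (hx : x ∈ overlap e e')
    (hx' : x ∈ overlap e e'') :
    jac e e'' x = jac e' e'' (coordTrans e e' x) * jac e e' x := by
  rw [jac, fderiv_trans_comp hx hx', ContinuousLinearMap.det, ContinuousLinearMap.toLinearMap_comp,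
    LinearMap.det_comp, abs_mul]
  rfl

lemma jac_self {e : Chart m N} {x : E m} (hx : x ∈ e.1.target) : jac e e x = 1 := by
  have : fderiv ℝ (coordTrans e e) x = ContinuousLinearMap.id ℝ (E m) := by
    rw [← fderiv_id (𝕜 := ℝ) (x := x)]
    apply Filter.EventuallyEq.fderiv_eq
    filter_upwards [e.1.open_target.mem_nhds hx] with y hy
    simp [coordTrans, e.1.right_inv hy]
  simp [jac, this, ContinuousLinearMap.det]

lemma jac_pos {e e' : Chart m N} {x : E m} (hx : x ∈ overlap e e') : 0 < jac e e' x := by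
  have h := jac_comp (e'' := e) hx
    (mem_overlap.2 ⟨(mem_overlap.1 hx).1, e.1.map_target (mem_overlap.1 hx).1⟩)
  rw [jac_self (mem_overlap.1 hx).1] at h
  refine lt_of_le_of_ne (abs_nonneg _) fun h0 => ?_
  change 0 = jac e e' x at h0
  rw [← h0, mul_zero] at h
  exact one_ne_zero h

lemma contDiffOn_log_jac (e e' : Chart m N) :
    ContDiffOn ℝ ∞ (fun x => Real.log (jac e e' x)) (overlap e e') := by
  simp only [jac, Real.log_abs]
  have h1 : ContDiffOn ℝ ∞ (fderiv ℝ (coordTrans e e')) (overlap e e') :=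
    (contDiffOn_trans e e').fderiv_of_isOpen (isOpen_overlap e e') (by simp)
  have h2 : ContDiff ℝ ∞ (fun A : E m →L[ℝ] E m => A.det) := by
    have : (fun A : E m →L[ℝ] E m => A.det) = fun A => (Matrix.of fun i j =>
        A (EuclideanSpace.single j 1) i).det := by
      funext A
      rw [ContinuousLinearMap.det, ← LinearMap.det_toMatrix (EuclideanSpace.basisFun (Fin m) ℝ).toBasis]
      congr 1
    rw [this]
    simp only [Matrix.det_apply]
    refine ContDiff.sum fun σ _ => ContDiff.const_smul _ (contDiff_prod fun i _ => ?_)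
    simp only [Matrix.of_apply]
    exact ((EuclideanSpace.proj (𝕜 := ℝ) (σ i)).comp
      (ContinuousLinearMap.apply ℝ (E m) (EuclideanSpace.single i (1:ℝ)))).contDiff
  refine ContDiffOn.log (h2.comp_contDiffOn h1) fun x hx h0 => ?_
  have := jac_pos hx
  simp [jac, h0] at this

end Manifold

/-- The point `(x⁰, x¹, …, xⁿ)` of `ℝⁿ⁺¹`, for `x⁰ = t` and `x = (x¹, …, xⁿ)`. -/
def ext0 {n : ℕ} (t : ℝ) (x : E n) : E (n + 1) := WithLp.toLp 2 (Fin.cons t fun i => x i)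

/-- The linear isomorphism `(x, t) ↦ (x⁰ = t, x¹, …, xⁿ)`. -/
def consL (n : ℕ) : (E n × ℝ) ≃L[ℝ] E (n + 1) :=
  (((EuclideanSpace.equiv (Fin n) ℝ).prodCongr (ContinuousLinearEquiv.refl ℝ ℝ)).trans
    ((ContinuousLinearEquiv.prodComm ℝ (Fin n → ℝ) ℝ).trans (Fin.consEquivL ℝ fun _ => ℝ))).trans
    (EuclideanSpace.equiv (Fin (n + 1)) ℝ).symm

lemma consL_apply {n : ℕ} (t : ℝ) (x : E n) : consL n (x, t) = ext0 t x := rfl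

section Thomas

variable (n : ℕ) (M : Type*) [TopologicalSpace M] [ChartedSpace (E n) M] [IsManifold 𝓘(ℝ, E n) ∞ M]

/-- The chart of the given atlas around a point. -/
def chartOf {n : ℕ} {M : Type*} [TopologicalSpace M] [ChartedSpace (E n) M]
    [IsManifold 𝓘(ℝ, E n) ∞ M] (p : M) : Chart n M :=
  ⟨chartAt (E n) p, IsManifold.chart_mem_maximalAtlas p⟩

/-- The principal `ℝ`-bundle over `M` obtained by attaching to every chart `x¹, …, xⁿ` of `M` an
additional fibre coordinate `x⁰`, with the coordinate change `x̄⁰ = x⁰ + log J`. -/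
def thomasCore : FiberBundleCore (Chart n M) M ℝ where
  baseSet e := e.1.source
  isOpen_baseSet e := e.1.open_source
  indexAt := chartOf
  mem_baseSet_at p := mem_chart_source (E n) p
  coordChange e e' p t := t + Real.log (jac e e' (e.1 p))
  coordChange_self e p hp t := by simp [jac_self (e.1.map_source hp)]
  continuousOn_coordChange e e' := by
    refine continuous_snd.continuousOn.add ?_
    refine (contDiffOn_log_jac e e').continuousOn.comp
      (e.1.continuousOn.comp continuous_fst.continuousOn fun r hr => hr.1.1) fun q hq => ?_
    exact mem_overlap.2 ⟨e.1.map_source hq.1.1, by simpa [e.1.left_inv hq.1.1] using hq.1.2⟩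
  coordChange_comp e e' e'' p hp t := by
    have h1 : e.1 p ∈ overlap e e' :=
      mem_overlap.2 ⟨e.1.map_source hp.1.1, by simpa [e.1.left_inv hp.1.1] using hp.1.2⟩
    have h2 : e.1 p ∈ overlap e e'' :=
      mem_overlap.2 ⟨e.1.map_source hp.1.1, by simpa [e.1.left_inv hp.1.1] using hp.2⟩
    have h3 : e'.1 p ∈ overlap e' e'' :=
      mem_overlap.2 ⟨e'.1.map_source hp.1.2, by simpa [e'.1.left_inv hp.1.2] using hp.2⟩
    have h4 : coordTrans e e' (e.1 p) = e'.1 p := by rw [coordTrans, e.1.left_inv hp.1.1]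
    rw [jac_comp h1 h2, h4, Real.log_mul (jac_pos h3).ne' (jac_pos h1).ne']
    ring

/-- The Thomas manifold `M̃` of `M`: the total space of the bundle above. -/
def Thomas : Type _ := (thomasCore n M).TotalSpace

instance : TopologicalSpace (Thomas n M) := inferInstanceAs (TopologicalSpace (thomasCore n M).TotalSpace)

variable {n M}

/-- The point of `M` under a point of `M̃`. -/
def Thomas.proj (q : Thomas n M) : M := (thomasCore n M).proj q

/-- The chart `(x⁰, x¹, …, xⁿ)` of `M̃` adapted to the chart `(x¹, …, xⁿ)` of `M`. -/
def thomasChart (e : Chart n M) : OpenPartialHomeomorph (Thomas n M) (E (n + 1)) :=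
  (((thomasCore n M).localTriv e).toOpenPartialHomeomorph ≫ₕ
    (e.1.prod (OpenPartialHomeomorph.refl ℝ))) ≫ₕ
    (consL n).toHomeomorph.toOpenPartialHomeomorph

lemma thomasChart_source (e : Chart n M) :
    (thomasChart e).source = {q : Thomas n M | q.proj ∈ e.1.source} := by
  ext q
  constructor
  · intro h
    exact ((thomasCore n M).mem_localTriv_source e q).1 h.1.1
  · intro h
    exact ⟨⟨((thomasCore n M).mem_localTriv_source e q).2 h, h, trivial⟩, trivial⟩

lemma thomasChart_apply (e : Chart n M) (q : Thomas n M) :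
    thomasChart e q =
      ext0 ((thomasCore n M).coordChange (chartOf q.proj) e q.proj q.2) (e.1 q.proj) := rfl

lemma ext0_mem_target {e : Chart n M} {t : ℝ} {x : E n} :
    ext0 t x ∈ (thomasChart e).target ↔ x ∈ e.1.target := by
  constructor
  · intro h
    exact h.2.1.1
  · intro h
    exact ⟨trivial, ⟨h, trivial⟩,
      ((thomasCore n M).mem_localTriv_target e (e.1.symm x, t)).2 (e.1.map_target h)⟩

lemma thomasChart_symm_proj {e : Chart n M} {t : ℝ} {x : E n} :
    Thomas.proj ((thomasChart e).symm (ext0 t x)) = e.1.symm x := rfl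

/-- The change of adapted coordinates on `M̃`. -/
lemma thomas_trans {e e' : Chart n M} {t : ℝ} {x : E n} (hx : x ∈ overlap e e') :
    thomasChart e' ((thomasChart e).symm (ext0 t x)) =
      ext0 (t + Real.log (jac e e' x)) (coordTrans e e' x) := by
  have h := mem_overlap.1 hx
  have h1 : (thomasChart e).symm (ext0 t x) ∈ (thomasChart e).source :=
    (thomasChart e).map_target (ext0_mem_target.2 h.1)
  have h2 := (thomasChart e).right_inv (ext0_mem_target (t := t).2 h.1)
  set q := (thomasChart e).symm (ext0 t x) with hq
  have h3 : q.proj = e.1.symm x := thomasChart_symm_proj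
  rw [thomasChart_apply] at h2 ⊢
  rw [← consL_apply, ← consL_apply, (consL n).injective.eq_iff, Prod.mk.injEq] at h2
  rw [← h2.2, h3]
  congr 1
  have := (thomasCore n M).coordChange_comp (chartOf q.proj) e e' q.proj
    ⟨⟨mem_chart_source (E n) _, h3 ▸ e.1.map_target h.1⟩, h3 ▸ h.2⟩ q.2
  rw [h3] at this
  rw [← this]
  simp [thomasCore, e.1.right_inv h.1]

instance : ChartedSpace (E (n + 1)) (Thomas n M) where
  atlas := Set.range thomasChart
  chartAt q := thomasChart (chartOf q.proj)
  mem_chart_source q := by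
    rw [thomasChart_source]
    exact mem_chart_source (E n) q.proj
  chart_mem_atlas q := ⟨_, rfl⟩

instance : IsManifold 𝓘(ℝ, E (n + 1)) ∞ (Thomas n M) := by
  apply isManifold_of_contDiffOn
  rintro _ _ ⟨e, rfl⟩ ⟨e', rfl⟩
  have hc : ∀ z : E (n + 1), z = ext0 ((consL n).symm z).2 ((consL n).symm z).1 := fun z => by
    rw [← consL_apply]; simp
  have hmem : ∀ z : E (n + 1), z ∈ ((thomasChart e).symm ≫ₕ thomasChart e').source →
      ((consL n).symm z).1 ∈ overlap e e' := fun z hz => by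
    rw [hc z] at hz
    simp only [OpenPartialHomeomorph.trans_source, OpenPartialHomeomorph.symm_source,
      mem_inter_iff, mem_preimage, thomasChart_source, mem_ofPred_eq, ext0_mem_target] at hz
    rw [thomasChart_symm_proj] at hz
    exact mem_overlap.2 hz
  have hs : ContDiff ℝ ∞ (fun z => ((consL n).symm z).1) :=
    contDiff_fst.comp (consL n).symm.contDiff
  have ht : ContDiff ℝ ∞ (fun z => ((consL n).symm z).2) :=
    contDiff_snd.comp (consL n).symm.contDiff
  have key : ContDiffOn ℝ ∞ (fun z => consL n (coordTrans e e' ((consL n).symm z).1,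
      ((consL n).symm z).2 + Real.log (jac e e' ((consL n).symm z).1)))
      ((thomasChart e).symm ≫ₕ thomasChart e').source :=
    (consL n).contDiff.comp_contDiffOn
      (((contDiffOn_trans e e').comp hs.contDiffOn hmem).prodMk
        (ht.contDiffOn.add ((contDiffOn_log_jac e e').comp hs.contDiffOn hmem)))
  refine key.congr_mono (fun z hz => ?_) (fun z hz => hz.1)
  have hz' := hmem z hz.1
  conv_lhs => rw [hc z]
  simpa [consL_apply] using thomas_trans hz'

/-- The adapted charts of `M̃` as members of its maximal atlas. -/
def adapted (e : Chart n M) : Chart (n + 1) (Thomas n M) :=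
  ⟨thomasChart e, IsManifold.subset_maximalAtlas ⟨e, rfl⟩⟩

end Thomas

section Densities

variable {n : ℕ} {M : Type*} [TopologicalSpace M] [ChartedSpace (E n) M]

variable (n M) in
/-- Families of coefficient functions `φ(x)`, one on the coordinate domain of every chart, with no
condition on how they are related. -/
abbrev Coeff : Type _ := (e : Chart n M) → e.1.target → ℝ

/-- The coefficient function `φ(x)` in the chart `e`, extended by `0` off the coordinate domain. -/
def crep (φ : Coeff n M) (e : Chart n M) : E n → ℝ := Function.extend Subtype.val (φ e) 0

lemma crep_of_mem (φ : Coeff n M) {e : Chart n M} {x : E n} (hx : x ∈ e.1.target) :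
    crep φ e x = φ e ⟨x, hx⟩ :=
  Subtype.val_injective.extend_apply (φ e) 0 ⟨x, hx⟩

/-- The expressions `φ(x)|Dx|^μ` define a density of weight `μ`: `φ` is smooth in every chart, and
`φ(x)|Dx|^μ = φ̄(x̄)|Dx̄|^μ` on overlaps, where `|Dx̄| = J|Dx|`. -/
def IsDensity (μ : ℝ) (φ : Coeff n M) : Prop :=
  (∀ e, ContDiffOn ℝ ∞ (crep φ e) e.1.target) ∧
    ∀ e e', ∀ x ∈ overlap e e', crep φ e x = jac e e' x ^ μ * crep φ e' (coordTrans e e' x)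

lemma isDensity_zero (μ : ℝ) : IsDensity μ (0 : Coeff n M) := by
  have h : ∀ e, crep (0 : Coeff n M) e = 0 := fun e => by
    funext x
    by_cases hx : ∃ a : e.1.target, (a : E n) = x
    · obtain ⟨a, rfl⟩ := hx
      rw [crep_of_mem _ a.2]; rfl
    · exact Function.extend_apply' _ _ _ hx
  refine ⟨fun e => ?_, fun e e' x _ => by simp [h]⟩
  rw [h]
  exact contDiffOn_const

lemma IsDensity.add {μ : ℝ} {φ ψ : Coeff n M} (hφ : IsDensity μ φ) (hψ : IsDensity μ ψ) :
    IsDensity μ (φ + ψ) := by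
  have h : ∀ e, ∀ x ∈ e.1.target, crep (φ + ψ) e x = crep φ e x + crep ψ e x := fun e x hx => by
    simp [crep_of_mem _ hx]
  refine ⟨fun e => ((hφ.1 e).add (hψ.1 e)).congr (h e), fun e e' x hx => ?_⟩
  rw [h e x (mem_overlap.1 hx).1, h e' _ (mem_overlap.1 (trans_mem hx)).1, hφ.2 e e' x hx,
    hψ.2 e e' x hx]
  ring

lemma IsDensity.mul {μ ν : ℝ} {φ ψ : Coeff n M} (hφ : IsDensity μ φ) (hψ : IsDensity ν ψ) :
    IsDensity (μ + ν) (φ * ψ) := by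
  have h : ∀ e, ∀ x ∈ e.1.target, crep (φ * ψ) e x = crep φ e x * crep ψ e x := fun e x hx => by
    simp [crep_of_mem _ hx]
  refine ⟨fun e => ((hφ.1 e).mul (hψ.1 e)).congr (h e), fun e e' x hx => ?_⟩
  rw [h e x (mem_overlap.1 hx).1, h e' _ (mem_overlap.1 (trans_mem hx)).1, hφ.2 e e' x hx,
    hψ.2 e e' x hx, Real.rpow_add (jac_pos hx)]
  ring

lemma isDensity_algebraMap (r : ℝ) : IsDensity 0 (algebraMap ℝ (Coeff n M) r) := by
  have h : ∀ e, ∀ x ∈ e.1.target, crep (algebraMap ℝ (Coeff n M) r) e x = r := fun e x hx => by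
    rw [crep_of_mem _ hx]; rfl
  refine ⟨fun e => contDiffOn_const.congr (h e), fun e e' x hx => ?_⟩
  rw [h e x (mem_overlap.1 hx).1, h e' _ (mem_overlap.1 (trans_mem hx)).1]
  simp

lemma isDensity_single {μ : ℝ} {φ : Coeff n M} (hφ : IsDensity μ φ) (ν : ℝ) :
    IsDensity ν ((AddMonoidAlgebra.single μ φ).coeff ν) := by
  classical
  rw [AddMonoidAlgebra.coeff_single, Finsupp.single_apply]
  split_ifs with h
  · exact h ▸ hφ
  · exact isDensity_zero ν

lemma isDensity_sum {ι : Type*} (s : Finset ι) (f : ι → AddMonoidAlgebra (Coeff n M) ℝ) (ν : ℝ)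
    (hf : ∀ i ∈ s, IsDensity ν ((f i).coeff ν)) : IsDensity ν ((∑ i ∈ s, f i).coeff ν) := by
  classical
  induction s using Finset.induction_on with
  | empty => exact isDensity_zero ν
  | insert a s ha ih =>
    rw [Finset.sum_insert ha]
    exact (hf a (by simp)).add (ih fun i hi => hf i (by simp [hi]))

variable (n M) in
/-- The algebra of densities `𝔙(M) = ⨁_μ 𝔙_μ(M)`: finite formal sums `∑_μ φ_μ(x)|Dx|^μ` of densities
of real weights, multiplied by `φ|Dx|^μ · ψ|Dx|^ν = φψ|Dx|^(μ+ν)`. -/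
def Densities : Subalgebra ℝ (AddMonoidAlgebra (Coeff n M) ℝ) where
  carrier := {a | ∀ μ, IsDensity μ (a.coeff μ)}
  add_mem' ha hb μ := (ha μ).add (hb μ)
  mul_mem' {a b} ha hb ν := by
    rw [AddMonoidAlgebra.mul_def]
    refine isDensity_sum _ _ _ fun μ₁ _ => isDensity_sum _ _ _ fun μ₂ _ => ?_
    exact isDensity_single ((ha μ₁).mul (hb μ₂)) ν
  algebraMap_mem' r := isDensity_single (isDensity_algebraMap r)

/-- The coefficient `φ_μ` of `|Dx|^μ` in the chart `e` of an element of `𝔙(M)`. -/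
def dcoeff (a : Densities n M) (μ : ℝ) (e : Chart n M) : E n → ℝ := crep (a.1.coeff μ) e

/-- `a` lies in `𝔙_μ(M)`. -/
def HomogeneousOfWeight (a : Densities n M) (μ : ℝ) : Prop := ∀ ν, ν ≠ μ → a.1.coeff ν = 0

variable [IsManifold 𝓘(ℝ, E n) ∞ M]

/-- The function `∑_μ φ_μ(x) e^{μ x⁰}` on `M̃` given by `∑_μ φ_μ(x)|Dx|^μ`, in the adapted coordinates
of the atlas chart of `M` around the base point. -/
def densityFun (a : Densities n M) (q : Thomas n M) : ℝ :=
  a.1.coeff.sum fun μ φ => crep φ (chartOf q.proj) ((chartOf q.proj).1 q.proj) *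
    Real.exp (μ * (thomasChart (chartOf q.proj) q) 0)

/-- The function of a density has the same expression in all adapted coordinates. -/
lemma densityFun_ext0 (a : Densities n M) (e : Chart n M) {x : E n} (hx : x ∈ e.1.target) (t : ℝ) :
    densityFun a ((thomasChart e).symm (ext0 t x)) =
      a.1.coeff.sum fun μ φ => crep φ e x * Real.exp (μ * t) := by
  rw [densityFun, thomasChart_symm_proj]
  set p := e.1.symm x with hp
  have h : x ∈ overlap e (chartOf p) := mem_overlap.2 ⟨hx, mem_chart_source (E n) p⟩
  refine Finsupp.sum_congr fun μ _ => ?_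
  rw [thomas_trans h]
  change crep _ (chartOf p) (coordTrans e (chartOf p) x) *
    Real.exp (μ * (t + Real.log (jac e (chartOf p) x))) = _
  rw [(a.2 μ).2 e (chartOf p) x h, mul_add, Real.exp_add, mul_comm μ (Real.log _),
    Real.rpow_def_of_pos (jac_pos h)]
  ring

lemma exists_ext0 {e : Chart n M} {q : Thomas n M} (hq : q ∈ (thomasChart e).source) :
    ∃ t x, x ∈ e.1.target ∧ thomasChart e q = ext0 t x := by
  refine ⟨_, _, ?_, thomasChart_apply e q⟩
  rw [thomasChart_source] at hq
  exact e.1.map_source hq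

lemma contMDiff_densityFun (a : Densities n M) :
    ContMDiff 𝓘(ℝ, E (n + 1)) 𝓘(ℝ, ℝ) ∞ (densityFun a) := by
  intro q
  set e : Chart n M := chartOf q.proj
  set g : E (n + 1) → ℝ := fun z => a.1.coeff.sum fun μ φ =>
    crep φ e ((consL n).symm z).1 * Real.exp (μ * ((consL n).symm z).2) with hg
  have hq : q ∈ (thomasChart e).source := by
    rw [thomasChart_source]
    exact mem_chart_source (E n) q.proj
  have hs : ContDiff ℝ ∞ (fun z => ((consL n).symm z).1) :=
    contDiff_fst.comp (consL n).symm.contDiff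
  have ht : ContDiff ℝ ∞ (fun z => ((consL n).symm z).2) :=
    contDiff_snd.comp (consL n).symm.contDiff
  have h1 : ContDiffOn ℝ ∞ g (thomasChart e).target := by
    refine ContDiffOn.sum fun μ _ => ContDiffOn.mul ?_ ?_
    · refine ((a.2 μ).1 e).comp hs.contDiffOn fun z hz => ?_
      have : z = ext0 ((consL n).symm z).2 ((consL n).symm z).1 := by rw [← consL_apply]; simp
      rw [this] at hz
      exact ext0_mem_target.1 hz
    · exact (Real.contDiff_exp.comp (contDiff_const.mul ht)).contDiffOn
  have h2 : ContMDiffOn 𝓘(ℝ, E (n + 1)) 𝓘(ℝ, E (n + 1)) ∞ (thomasChart e) (thomasChart e).source :=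
    contMDiffOn_of_mem_maximalAtlas (adapted e).2
  have h3 := h1.contMDiffOn.comp h2 fun z hz => (thomasChart e).map_source hz
  refine (h3.congr fun r hr => ?_).contMDiffAt ((thomasChart e).open_source.mem_nhds hq)
  obtain ⟨t, x, hx, h⟩ := exists_ext0 hr
  have h4 := densityFun_ext0 a e hx t
  rw [← h, (thomasChart e).left_inv hr] at h4
  simp only [Function.comp_apply, hg]
  rw [h4, h, ← consL_apply]
  simp

/-- The smooth function on `M̃` corresponding to an element of `𝔙(M)`. -/
def toSmooth (a : Densities n M) : C^∞⟮𝓘(ℝ, E (n + 1)), Thomas n M; ℝ⟯ :=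
  ⟨densityFun a, contMDiff_densityFun a⟩

end Densities

section Geometry

variable (m : ℕ) (N : Type*) [TopologicalSpace N] [ChartedSpace (E m) N]
  [IsManifold 𝓘(ℝ, E m) ∞ N]

/-- A smooth torsion-free linear connection on `N`. -/
structure Connection where
  /-- the covariant derivative -/
  cov : CovariantDerivative 𝓘(ℝ, E m) (E m) (TangentSpace 𝓘(ℝ, E m) : N → Type _)
  smooth : cov.ContMDiffCovariantDerivative ∞
  torsion_free : ∀ p, cov.torsion p = 0

/-- A symmetric smooth tensor field with two upper indices on `N`: a symmetric bilinear form on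
each cotangent space, with smooth components. -/
structure SymTensor where
  /-- the bilinear form on the cotangent space at a point -/
  form : ∀ p : N, (TangentSpace 𝓘(ℝ, E m) p →L[ℝ] ℝ) →ₗ[ℝ]
    (TangentSpace 𝓘(ℝ, E m) p →L[ℝ] ℝ) →ₗ[ℝ] ℝ
  symm : ∀ p α β, form p α β = form p β α
  smooth : ∀ (e : Chart m N) (i j : Fin m), ContDiffOn ℝ ∞
    (fun x => form (e.1.symm x)
      ((EuclideanSpace.proj i).comp (mfderiv 𝓘(ℝ, E m) 𝓘(ℝ, E m) e.1 (e.1.symm x)))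
      ((EuclideanSpace.proj j).comp (mfderiv 𝓘(ℝ, E m) 𝓘(ℝ, E m) e.1 (e.1.symm x)))) e.1.target

variable {m N}

/-- The coordinate vector field `∂_j` of the chart `e` (meaningful on the domain of `e`). -/
def coordField (e : Chart m N) (j : Fin m) (p : N) : TangentSpace 𝓘(ℝ, E m) p :=
  (mfderiv 𝓘(ℝ, E m) 𝓘(ℝ, E m) e.1.symm (e.1 p) (EuclideanSpace.single j (1 : ℝ)) : E m)

/-- The connection coefficients in the chart `e`: `Γ^k_{ij}` is the `k`-th component of
`∇_{∂_i} ∂_j`. -/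
def Connection.coeff (D : Connection m N) (e : Chart m N) (k i j : Fin m) (x : E m) : ℝ :=
  let v : E m := mfderiv 𝓘(ℝ, E m) 𝓘(ℝ, E m) e.1 (e.1.symm x)
    (D.cov (coordField e j) (e.1.symm x) (coordField e i (e.1.symm x)))
  v k

/-- The curve `c` is an affinely parametrised geodesic on the interval `J`. -/
def IsGeodesicOn (D : Connection m N) (c : ℝ → N) (J : Set ℝ) : Prop :=
  ContMDiffOn 𝓘(ℝ, ℝ) 𝓘(ℝ, E m) ∞ c J ∧
    ∀ e : Chart m N, ∀ t ∈ J, c t ∈ e.1.source → ∀ k,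
      deriv (deriv fun s => e.1 (c s) k) t + ∑ i, ∑ j, D.coeff e k i j (e.1 (c t)) *
        deriv (fun s => e.1 (c s) i) t * deriv (fun s => e.1 (c s) j) t = 0

/-- Every geodesic of `D` is, up to a smooth reparametrisation, a geodesic of `D'`. -/
def GeodesicsReparam (D D' : Connection m N) : Prop :=
  ∀ (c : ℝ → N) (J : Set ℝ), IsOpen J → J.OrdConnected → IsGeodesicOn D c J →
    ∃ (J' : Set ℝ) (φ ψ : ℝ → ℝ), IsOpen J' ∧ J'.OrdConnected ∧
      ContDiffOn ℝ ∞ φ J' ∧ ContDiffOn ℝ ∞ ψ J ∧ MapsTo φ J' J ∧ MapsTo ψ J J' ∧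
      InvOn ψ φ J' J ∧ IsGeodesicOn D' (c ∘ φ) J'

lemma GeodesicsReparam.refl (D : Connection m N) : GeodesicsReparam D D :=
  fun _ J hJ hJ' hc => ⟨J, id, id, hJ, hJ', contDiffOn_id, contDiffOn_id, mapsTo_id J, mapsTo_id J,
    ⟨fun _ _ => rfl, fun _ _ => rfl⟩, hc⟩

lemma GeodesicsReparam.comp {D D' D'' : Connection m N} (h : GeodesicsReparam D D')
    (h' : GeodesicsReparam D' D'') : GeodesicsReparam D D'' := by
  intro c J hJ hJc hc
  obtain ⟨J₁, φ, ψ, hJ₁, hJ₁c, hφ, hψ, mφ, mψ, inv, hc₁⟩ := h c J hJ hJc hc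
  obtain ⟨J₂, φ', ψ', hJ₂, hJ₂c, hφ', hψ', mφ', mψ', inv', hc₂⟩ := h' _ J₁ hJ₁ hJ₁c hc₁
  exact ⟨J₂, φ ∘ φ', ψ' ∘ ψ, hJ₂, hJ₂c, hφ.comp hφ' mφ', hψ'.comp hψ mψ, mφ.comp mφ',
    mψ'.comp mψ, inv'.comp inv mφ' mψ, hc₂⟩

variable (m N) in
/-- Two torsion-free connections are projectively equivalent if they have the same geodesics up to
reparametrisation. -/
def projSetoid : Setoid (Connection m N) where
  r D D' := GeodesicsReparam D D' ∧ GeodesicsReparam D' D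
  iseqv :=
    { refl := fun D => ⟨.refl D, .refl D⟩
      symm := fun h => ⟨h.2, h.1⟩
      trans := fun h h' => ⟨h.1.comp h'.1, h'.2.comp h.2⟩ }

variable (m N) in
/-- A projective class on `N`: an equivalence class of torsion-free linear connections. -/
abbrev ProjectiveClass : Type _ := Quotient (projSetoid m N)

/-- The connection `D` belongs to the projective class `P`. -/
def Connection.Mem (D : Connection m N) (P : ProjectiveClass m N) : Prop :=
  Quotient.mk (projSetoid m N) D = P

/-- The coefficients `Π^k_{ij} = Γ^k_{ij} - (δ^k_i Γ^s_{sj} + δ^k_j Γ^s_{is}) / (m + 1)` of the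
projective class of a connection on an `m`-dimensional manifold. -/
def Connection.projCoeff (D : Connection m N) (e : Chart m N) (k i j : Fin m) (x : E m) : ℝ :=
  D.coeff e k i j x - 1 / ((m : ℝ) + 1) *
    ((if k = i then ∑ s, D.coeff e s s j x else 0) + if k = j then ∑ s, D.coeff e s i s x else 0)

/-- The components `S^{ij} = S(dx^i, dx^j)` of a tensor field in the chart `e`. -/
def SymTensor.comp (S : SymTensor m N) (e : Chart m N) (i j : Fin m) (x : E m) : ℝ :=
  S.form (e.1.symm x)
    ((EuclideanSpace.proj i).comp (mfderiv 𝓘(ℝ, E m) 𝓘(ℝ, E m) e.1 (e.1.symm x)))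
    ((EuclideanSpace.proj j).comp (mfderiv 𝓘(ℝ, E m) 𝓘(ℝ, E m) e.1 (e.1.symm x)))

/-- `L` is the projective Laplacian of the tensor field `S` on the `m`-dimensional manifold `N` with
projective class `P`: in every chart, with the coefficients `Π` computed from any connection in `P`,
`L = S^{ij}∂_i∂_j + (2/(m+3) ∂_j S^{ij} - (m+1)/(m+3) S^{jk} Π^i_{jk}) ∂_i`. -/
def IsProjectiveLaplacian (P : ProjectiveClass m N) (S : SymTensor m N)
    (L : C^∞⟮𝓘(ℝ, E m), N; ℝ⟯ →ₗ[ℝ] C^∞⟮𝓘(ℝ, E m), N; ℝ⟯) : Prop :=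
  ∀ D : Connection m N, D.Mem P → ∀ (e : Chart m N) (f : C^∞⟮𝓘(ℝ, E m), N; ℝ⟯),
    ∀ x ∈ e.1.target, L f (e.1.symm x) =
      ∑ i, ∑ j, S.comp e i j x * pd i (pd j (f ∘ e.1.symm)) x +
      ∑ i, (2 / ((m : ℝ) + 3) * ∑ j, pd j (S.comp e i j) x -
        ((m : ℝ) + 1) / ((m : ℝ) + 3) * ∑ j, ∑ k, S.comp e j k x * D.projCoeff e i j k x) *
        pd i (f ∘ e.1.symm) x

end Geometry

section Algebra

variable {A : Type*} [CommRing A] [Algebra ℝ A]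

variable (A) in
/-- A bracket on a commutative algebra: a symmetric biderivation. -/
structure AlgBracket where
  /-- `{a, b}`, a derivation in `b` and linear in `a` -/
  der : A →ₗ[ℝ] Derivation ℝ A A
  symm : ∀ a b, der a b = der b a

/-- The linear operator `T` generates the bracket `B`. -/
def Generates (T : A →ₗ[ℝ] A) (B : AlgBracket A) : Prop :=
  ∀ a b, B.der a b = T (a * b) - a * T b - T a * b + a * b * T 1

/-- `T` is a differential operator of order at most `k`, in the algebraic sense: a `0`-th order
operator is `A`-linear, and `T` is of order at most `k + 1` if all commutators of `T` with
multiplication by elements of `A` are of order at most `k`. -/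
def OrderLE : ℕ → (A →ₗ[ℝ] A) → Prop
  | 0, T => ∀ a b, T (a * b) = a * T b
  | k + 1, T => ∀ a, OrderLE k (T ∘ₗ LinearMap.mulLeft ℝ a - LinearMap.mulLeft ℝ a ∘ₗ T)

end Algebra

section DensityBracket

variable {n : ℕ} {M : Type*} [TopologicalSpace M] [ChartedSpace (E n) M]

/-- The bracket `B` on `𝔙(M)` is homogeneous of weight `w`. -/
def HasWeight (B : AlgBracket (Densities n M)) (w : ℝ) : Prop :=
  ∀ a b μ ν, HomogeneousOfWeight a μ → HomogeneousOfWeight b ν →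
    HomogeneousOfWeight (B.der a b) (μ + ν + w)

/-- In the chart `e`, near the point with coordinates `x`, the element `a` of `𝔙(M)` is equal to
`φ|Dx|^μ`. -/
def LocallyEq (a : Densities n M) (e : Chart n M) (x : E n) (φ : E n → ℝ) (μ : ℝ) : Prop :=
  ∀ᶠ y in 𝓝 x, ∀ ν, dcoeff a ν e y = if ν = μ then φ y else 0

/-- At the point with coordinates `x` in the chart `e`, the value of `a` is `c|Dx|^μ`. -/
def EqAt (a : Densities n M) (e : Chart n M) (x : E n) (c : ℝ) (μ : ℝ) : Prop :=
  ∀ ν, dcoeff a ν e x = if ν = μ then c else 0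

/-- The bracket obeys the power rule `{|Dx|^s, a} = s |Dx|^(s-1) {|Dx|, a}` for all real `s`, in
every chart; the local sections `|Dx|` and `|Dx|^s` are represented near each point by elements
`r` and `u` of `𝔙(M)`. -/
def PowerRule (B : AlgBracket (Densities n M)) : Prop :=
  ∀ (e : Chart n M), ∀ x ∈ e.1.target, ∀ (s : ℝ) (r u a : Densities n M),
    LocallyEq r e x (fun _ => 1) 1 → LocallyEq u e x (fun _ => 1) s →
      ∀ ν, dcoeff (B.der u a) (ν + s - 1) e x = s * dcoeff (B.der r a) ν e x

/-- The bracket `B` of weight `w` has, in the chart `e`, the components `S^{ij}`, `γ^i`, `θ`: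
`{x^i, x^j} = S^{ij}|Dx|^w`, `{x^i, |Dx|} = γ^i|Dx|^(w+1)`, `{|Dx|, |Dx|} = θ|Dx|^(w+2)`. The local
objects `x^i` and `|Dx|` are represented near each point by elements of `𝔙(M)`. -/
def HasComponents (B : AlgBracket (Densities n M)) (w : ℝ) (e : Chart n M)
    (S : Fin n → Fin n → E n → ℝ) (γ : Fin n → E n → ℝ) (θ : E n → ℝ) : Prop :=
  ∀ x ∈ e.1.target,
    (∀ i j a b, LocallyEq a e x (fun y => y i) 0 → LocallyEq b e x (fun y => y j) 0 →
      EqAt (B.der a b) e x (S i j x) w) ∧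
    (∀ i a b, LocallyEq a e x (fun y => y i) 0 → LocallyEq b e x (fun _ => 1) 1 →
      EqAt (B.der a b) e x (γ i x) (w + 1)) ∧
    (∀ a b, LocallyEq a e x (fun _ => 1) 1 → LocallyEq b e x (fun _ => 1) 1 →
      EqAt (B.der a b) e x (θ x) (w + 2))

variable [IsManifold 𝓘(ℝ, E n) ∞ M]

/-- The quantity `∂_s Π^s_{ij} - Π^p_{qi} Π^q_{pj}`. -/
def Connection.projRicci (D : Connection n M) (e : Chart n M) (i j : Fin n) (x : E n) : ℝ :=
  ∑ s, pd s (D.projCoeff e s i j) x -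
    ∑ p, ∑ q, D.projCoeff e p q i x * D.projCoeff e q p j x

/-- `D'` is the linear connection on `M̃` assigned by the Thomas construction to the projective class
of `D`, in the adapted charts. -/
def IsThomasConnection (D : Connection n M) (D' : Connection (n + 1) (Thomas n M)) : Prop :=
  ∀ (e : Chart n M), ∀ x ∈ e.1.target, ∀ t : ℝ,
    (∀ k i j : Fin n, D'.coeff (adapted e) k.succ i.succ j.succ (ext0 t x) = D.projCoeff e k i j x) ∧
    (∀ a b : Fin (n + 1), D'.coeff (adapted e) a 0 b (ext0 t x) =
      if a = b then -1 / ((n : ℝ) + 1) else 0) ∧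
    (∀ a b : Fin (n + 1), D'.coeff (adapted e) a b 0 (ext0 t x) =
      if a = b then -1 / ((n : ℝ) + 1) else 0) ∧
    (∀ i j : Fin n, D'.coeff (adapted e) 0 i.succ j.succ (ext0 t x) =
      ((n : ℝ) + 1) / ((n : ℝ) - 1) * D.projRicci e i j x)

/-- `P'` is the projective class on `M̃` induced by the projective class `P` on `M`: the class of the
connection that the Thomas construction assigns to `P`. -/
def IsInducedClass (P : ProjectiveClass n M) (P' : ProjectiveClass (n + 1) (Thomas n M)) : Prop :=
  ∃ D' : Connection (n + 1) (Thomas n M), D'.Mem P' ∧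
    ∀ D : Connection n M, D.Mem P → IsThomasConnection D D'

/-- `S'` is the tensor field on `M̃` induced by the bracket `B` on `𝔙(M)`: it gives the bracket of
those functions on `M̃` that come from `𝔙(M)`. -/
def IsInducedTensor (B : AlgBracket (Densities n M)) (S' : SymTensor (n + 1) (Thomas n M)) : Prop :=
  ∀ (a b : Densities n M) (q : Thomas n M),
    S'.form q (mfderiv 𝓘(ℝ, E (n + 1)) 𝓘(ℝ, ℝ) (toSmooth a) q)
      (mfderiv 𝓘(ℝ, E (n + 1)) 𝓘(ℝ, ℝ) (toSmooth b) q) = toSmooth (B.der a b) q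

/-- `T` is the restriction to `𝔙(M) ⊂ C^∞(M̃)` of the projective Laplacian on `M̃` for the projective
class induced by `P` and the tensor field induced by `B`. -/
def IsDensityLaplacian (P : ProjectiveClass n M) (B : AlgBracket (Densities n M))
    (T : Densities n M →ₗ[ℝ] Densities n M) : Prop :=
  ∃ (P' : ProjectiveClass (n + 1) (Thomas n M)) (S' : SymTensor (n + 1) (Thomas n M))
    (L : C^∞⟮𝓘(ℝ, E (n + 1)), Thomas n M; ℝ⟯ →ₗ[ℝ] C^∞⟮𝓘(ℝ, E (n + 1)), Thomas n M; ℝ⟯),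
    IsInducedClass P P' ∧ IsInducedTensor B S' ∧ IsProjectiveLaplacian P' S' L ∧
      ∀ a, L (toSmooth a) = toSmooth (T a)

end DensityBracket

end ProjDens

end

open ProjDens

/-! The argument has three ingredients: a connection on M̃ glued from the charts, a tensor field
read off from the bracket, and an invariant form of the projective Laplacian.

Connection. Let a change of coordinates on M be F, with L = log J. In adapted coordinates it becomes
(x⁰, x) ↦ (x⁰ + L(x), F(x)), whose second derivative is (∂²L, ∂²F). The coefficients Π obey the
transformation law of a connection up to a correction 1/(n+1) (∂L ⊗ ∂F + ∂F ⊗ ∂L)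
(`Connection.pgam_trans`), and the mixed coefficients -1/(n+1) on M̃ absorb exactly this term. What
is left is the x⁰-component, which asks for a formula for ∂²L in terms of Π, of ∂_sΠ^s_{ij} -
Π^p_{qi}Π^q_{pj} in both charts, and of ∂L ∂L. It is `Connection.ricci_trans`: Jacobi's formula
gives ∂L = tr(F'⁻¹ F''), and the law for Π is differentiated once and traced (`projRicci_law_aux`).
The factor 1 - 2/(n+1) = (n-1)/(n+1) in front of ∂²L has to be inverted; this is where n > 1 enters
and where (n+1)/(n-1) comes from. `exists_connection` then glues the local coefficients.

Independence of the representative. If two connections have the same geodesics up to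
reparametrisation, comparing the geodesic equations along a geodesic with arbitrary initial velocity
v shows that their difference sends (v, v) to a multiple of v. By polarisation its trace-free part
vanishes, so Π depends on the class only (`GeodesicsReparam.projCoeff_eq`).

Tensor field. Derivations of the algebra of densities are local (`derivation_local`). Hadamard's
lemma treats functions, the power rule treats powers of |Dx|, and together they show that {a, b} at
a point of M̃ depends on the first derivatives of b only (`brk_formula`); by symmetry the same holds
for a. The differentials of the xⁱ and of e^{-t}|Dx|, with t the value of x⁰ at the point, are there
the coordinate covectors (`genFactor_smul_fderiv`). So the tensor field exists, is unique, and has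
the stated components.

Laplacian. On an m-dimensional manifold, and for any connection of the class, the operator equals
2/(m+3) times the divergence of S(dh, ·) plus (m+1)/(m+3) times the contraction of S with the
Hessian of h (`lapIn_eq`). Both are invariant, so the local formula defines an operator. On M̃ every
component of the tensor field is e^{λx⁰} times a function of x and the coefficients of the
connection do not involve x⁰; hence a term φ(x)e^{μx⁰} goes to a term of exponent μ + λ. Comparing
such expansions in two charts, by linear independence of exponentials, shows that the result is
again a density (`exists_density_of_expansion`). The bracket is the cross term of the product rule,
and order at most two follows formally, because {a, ·} is a derivation (`Generates.orderLE`). -/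

noncomputable section

set_option linter.unusedSectionVars false

namespace ProjDens

/-! ### Traces on coordinate space and the pointwise algebra behind the Thomas construction -/

section LinearAlgebra

variable {m : ℕ}

/-- The standard basis vector `e_i`. -/
abbrev sgl {m : ℕ} (i : Fin m) : E m := EuclideanSpace.single i (1 : ℝ)

lemma sum_coord_smul (v : E m) : ∑ i, v i • sgl i = v := by
  ext k
  simp [Finset.sum_apply, Pi.single_apply]

lemma map_eq_sum {W : Type*} [AddCommGroup W] [Module ℝ W] {F : Type*} [FunLike F (E m) W]
    [LinearMapClass F ℝ (E m) W] (A : F) (v : E m) : A v = ∑ i, v i • A (sgl i) := by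
  conv_lhs => rw [← sum_coord_smul v]
  rw [map_sum]
  simp

/-- The trace of an endomorphism of coordinate space. -/
def tr {m : ℕ} : (E m →L[ℝ] E m) →L[ℝ] ℝ :=
  ∑ i, (EuclideanSpace.proj i).comp (ContinuousLinearMap.apply ℝ (E m) (sgl i))

lemma tr_apply (A : E m →L[ℝ] E m) : tr A = ∑ i, A (sgl i) i := by
  simp [tr]

lemma tr_eq_trace (A : E m →L[ℝ] E m) : tr A = LinearMap.trace ℝ (E m) A := by
  rw [tr_apply, LinearMap.trace_eq_matrix_trace ℝ (EuclideanSpace.basisFun (Fin m) ℝ).toBasis]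
  simp [Matrix.trace, LinearMap.toMatrix_apply]

lemma tr_comm (A B : E m →L[ℝ] E m) : tr (A.comp B) = tr (B.comp A) := by
  rw [tr_eq_trace, tr_eq_trace]
  exact LinearMap.trace_mul_comm ℝ (A : E m →ₗ[ℝ] E m) B

lemma tr_id : tr (ContinuousLinearMap.id ℝ (E m)) = m := by
  simp [tr_apply]

lemma tr_smulRight (f : E m →L[ℝ] ℝ) (v : E m) : tr (f.smulRight v) = f v := by
  rw [tr_apply, map_eq_sum f v]
  simp [mul_comm]

/-- Cyclicity of the trace. With `A` the Jacobian matrix of a coordinate change, this compares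
traces formed in two charts. -/
lemma tr_conj {A B : E m →L[ℝ] E m} (h : A.comp B = .id ℝ _) (X : E m →L[ℝ] E m) :
    tr (B.comp (X.comp A)) = tr X := by
  rw [tr_comm, ContinuousLinearMap.comp_assoc, h, ContinuousLinearMap.comp_id]

set_option maxHeartbeats 1000000 in
/-- The transformation law of `∂_s Π^s_{ij} - Π^p_{qi} Π^q_{pj}`, as an identity between the values
and derivatives at one point of the two families of coefficients `P`, `Pb`, of the coordinate change
(`A`, `F2`, `F3`), and of the logarithm of its Jacobian (`L1`, `L2`). -/
lemma projRicci_law_aux {A B : E m →L[ℝ] E m} (hAB : A.comp B = .id ℝ _) (hBA : B.comp A = .id ℝ _)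
    {F2 P Pb : E m →L[ℝ] E m →L[ℝ] E m} {F3 dP dPb : E m →L[ℝ] E m →L[ℝ] E m →L[ℝ] E m}
    {L1 : E m →L[ℝ] ℝ} {L2 : E m →L[ℝ] E m →L[ℝ] ℝ} {ε : ℝ}
    (law : ∀ u v, F2 u v = A (P u v) - Pb (A u) (A v) + ε • (L1 u • A v + L1 v • A u))
    (law' : ∀ w u v, F3 w u v = F2 w (P u v) + A (dP w u v) - dPb (A w) (A u) (A v)
      - Pb (F2 w u) (A v) - Pb (A u) (F2 w v)
      + ε • (L2 w u • A v + L1 u • F2 w v + L2 w v • A u + L1 v • F2 w u))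
    (hL1 : ∀ u, L1 u = tr (B.comp (F2 u)))
    (hL2 : ∀ z u, L2 z u = tr (B.comp (F3 z u)) - tr ((B.comp (F2 z)).comp (B.comp (F2 u))))
    (sF2 : ∀ u v, F2 u v = F2 v u) (sF3 : ∀ w u v, F3 w u v = F3 u w v)
    (sF3' : ∀ w u v, F3 w u v = F3 w v u) (sPb : ∀ u v, Pb u v = Pb v u)
    (sP : ∀ u v, P u v = P v u)
    (sL2 : ∀ u v, L2 u v = L2 v u) (trP : ∀ u, tr (P u) = 0) (u v : E m) :
    (1 - 2 * ε) * L2 u v = (1 - 2 * ε) * L1 (P u v)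
      + (tr ((dP.flip u).flip v) - tr ((P u).comp (P v)))
      - (tr ((dPb.flip (A u)).flip (A v)) - tr ((Pb (A u)).comp (Pb (A v))))
      + (2 * ε - ε ^ 2 * (m + 3)) * (L1 u * L1 v) := by
  -- `H u` and `Q u` are the second derivative of the coordinate change and the coefficients of the
  -- target chart, both transported back to the source chart, so that all traces can be taken there.
  set H : E m → E m →L[ℝ] E m := fun u => B.comp (F2 u) with hH
  set Q : E m → E m →L[ℝ] E m := fun u => B.comp ((Pb (A u)).comp A) with hQ
  have AB : ∀ x, A (B x) = x := fun x => by simpa using congr($hAB x)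
  have BA : ∀ x, B (A x) = x := fun x => by simpa using congr($hBA x)
  -- The differentiated law, read as an endomorphism in the direction of differentiation `w`. The
  -- full symmetry of `F3` moves `w` to the last slot; the trace over `w` then yields the divergence
  -- terms ∂_sΠ^s of both charts.
  have e1 : B.comp (F3 u v) = B.comp ((F2.flip) (P u v)) + (dP.flip u).flip v
      - B.comp (((dPb.flip (A u)).flip (A v)).comp A) - (Q v).comp (H u) - (Q u).comp (H v)
      + ε • ((L2 u).smulRight v + L1 u • H v + (L2 v).smulRight u + L1 v • H u) := by
    ext1 w
    have h0 : F3 u v w = F3 w u v := by rw [sF3', sF3]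
    have h1 : ∀ z, F2 w z = F2 z w := fun z => sF2 w z
    have h2 : ∀ z, A (B (F2 z w)) = F2 z w := fun z => AB _
    simp only [ContinuousLinearMap.comp_apply, add_apply,
      sub_apply, smul_apply, ContinuousLinearMap.flip_apply,
      ContinuousLinearMap.smulRight_apply, hH, hQ, h0, law' w u v, map_add, map_sub, map_smul, BA,
      h2, h1]
    rw [sPb (F2 u w) (A v), sL2 w u, sL2 w v]
  -- The undifferentiated law as an identity of endomorphisms. Tracing the product of its instances
  -- at `u` and `v` expresses tr(HH) + tr(QH) + tr(HQ) through the quadratic terms ΠΠ of the two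
  -- charts; the factor m + 3 arises from tr(id) = m and three further traces.
  have e2 : ∀ u, Q u + H u = P u + ε • (L1 u • .id ℝ _ + L1.smulRight u) := fun u => by
    ext1 w
    simp only [hH, hQ, ContinuousLinearMap.comp_apply, add_apply,
      smul_apply, ContinuousLinearMap.smulRight_apply,
      ContinuousLinearMap.id_apply, law u w, map_add, map_sub, map_smul, BA]
    abel
  have t1 := congrArg tr e1
  have t2 := congrArg tr congr(($(e2 u)).comp $(e2 v))
  have hc : ∀ z, tr (B.comp (F2.flip z)) = L1 z := fun z => by
    rw [hL1]
    congr 2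
    ext1 w
    exact sF2 w z
  have hQQ : tr ((Q u).comp (Q v)) = tr ((Pb (A u)).comp (Pb (A v))) := by
    rw [← tr_conj hAB ((Pb (A u)).comp (Pb (A v)))]
    congr 1
    ext1 w
    simp [hQ, AB]
  simp only [map_add, map_sub, map_smul, tr_smulRight, hc, tr_conj hAB, smul_eq_mul] at t1
  simp only [ContinuousLinearMap.comp_add, ContinuousLinearMap.add_comp,
    ContinuousLinearMap.comp_smul, ContinuousLinearMap.smul_comp, ContinuousLinearMap.comp_id,
    ContinuousLinearMap.id_comp, map_add, map_smul, hQQ, trP, smul_eq_mul, smul_add, tr_id,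
    tr_smulRight] at t2
  have h5 : tr ((P u).comp (L1.smulRight v)) = L1 (P u v) := by
    rw [← tr_smulRight L1 (P u v)]
    congr 1
    ext1 w
    simp
  have h6 : tr ((L1.smulRight u).comp (P v)) = L1 (P u v) := by
    rw [sP, ← tr_smulRight L1 (P v u), tr_comm]
    congr 1
    ext1 w
    simp
  have h7 : tr ((L1.smulRight u).comp (L1.smulRight v)) = L1 u * L1 v := by
    rw [show (L1.smulRight u).comp (L1.smulRight v) = L1 v • L1.smulRight u by
      ext1 w; simp [smul_smul, mul_comm]]
    simp [tr_smulRight, mul_comm]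
  have h8 := hL2 u v
  have hh : ∀ z, tr (H z) = L1 z := fun z => (hL1 z).symm
  have h9 : tr ((Q v).comp (H u)) = tr ((H u).comp (Q v)) := tr_comm _ _
  rw [h5, h6, h7] at t2
  rw [hh, hh, h9, sL2 v u] at t1
  change L2 u v = _ - tr ((H u).comp (H v)) at h8
  -- The term tr(HH) of `h8` and the mixed traces of `t1` occur together in `t2`, and so are
  -- eliminated.
  linear_combination h8 + t1 - t2

end LinearAlgebra

/-! ### Jacobi's formula for the derivative of the determinant -/

section Jacobi

variable {m : ℕ}

lemma det_eq_matrix_det (A : E m →L[ℝ] E m) : A.det = (Matrix.of fun i j => A (sgl j) i).det := by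
  rw [ContinuousLinearMap.det,
    ← LinearMap.det_toMatrix (EuclideanSpace.basisFun (Fin m) ℝ).toBasis]
  congr 1

lemma contDiff_det : ContDiff ℝ ∞ (fun A : E m →L[ℝ] E m => A.det) := by
  simp only [det_eq_matrix_det, Matrix.det_apply]
  refine ContDiff.sum fun σ _ => ContDiff.const_smul _ (contDiff_prod fun i _ => ?_)
  simp only [Matrix.of_apply]
  exact ((EuclideanSpace.proj (𝕜 := ℝ) (σ i)).comp
    (ContinuousLinearMap.apply ℝ (E m) (sgl i))).contDiff

/-- The determinant is smooth, so directional derivatives suffice, and det(1 + tX) is a polynomial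
in t whose linear coefficient is the trace of X. -/
lemma hasFDerivAt_det_id :
    HasFDerivAt (fun A : E m →L[ℝ] E m => A.det) tr (ContinuousLinearMap.id ℝ (E m)) := by
  have h0 : DifferentiableAt ℝ (fun A : E m →L[ℝ] E m => A.det) (.id ℝ (E m)) :=
    contDiff_det.contDiffAt.differentiableAt (by simp)
  convert h0.hasFDerivAt using 1
  ext1 X
  have h2 := h0.hasFDerivAt.hasLineDerivAt X
  set N : Matrix (Fin m) (Fin m) ℝ := Matrix.of fun i j => X (sgl j) i with hN
  have h3 : (fun t : ℝ => (ContinuousLinearMap.id ℝ (E m) + t • X).det) =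
      fun t => Polynomial.eval t (1 + (Polynomial.X : Polynomial ℝ) • N.map Polynomial.C).det := by
    funext t
    simp only [det_eq_matrix_det]
    rw [← Polynomial.coe_evalRingHom, RingHom.map_det]
    congr 1
    ext i j
    simp [hN, Matrix.one_apply]
    by_cases h : i = j <;> simp [h, mul_comm]
  unfold HasLineDerivAt at h2
  rw [h3] at h2
  have h4 := h2.unique (Polynomial.hasDerivAt _ 0)
  rw [h4, Matrix.derivative_det_one_add_X_smul, tr_apply]
  simp [Matrix.trace, hN]

/-- Writing det X = det A · det(A⁻¹X) moves the base point to the identity; the factor det A then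
cancels in the logarithmic derivative. -/
lemma hasFDerivAt_log_abs_det {A B : E m →L[ℝ] E m} (hAB : A.comp B = .id ℝ _)
    (hBA : B.comp A = .id ℝ _) :
    HasFDerivAt (fun A : E m →L[ℝ] E m => Real.log |A.det|)
      (tr.comp (ContinuousLinearMap.compL ℝ (E m) (E m) (E m) B)) A := by
  have hdet : ∀ X Y : E m →L[ℝ] E m, (X.comp Y).det = X.det * Y.det := fun X Y => by
    simp only [ContinuousLinearMap.det, ContinuousLinearMap.toLinearMap_comp, LinearMap.det_comp]
  have hid : (ContinuousLinearMap.id ℝ (E m)).det = 1 := by simp [ContinuousLinearMap.det]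
  have hA : A.det * B.det = 1 := by rw [← hdet, hAB, hid]
  have hA0 : A.det ≠ 0 := left_ne_zero_of_mul_eq_one hA
  simp only [Real.log_abs]
  have e1 : (fun X : E m →L[ℝ] E m => X.det) = fun X => A.det * (B.comp X).det := by
    funext X
    rw [hdet, ← mul_assoc, hA, one_mul]
  have h1 : HasFDerivAt (fun X : E m →L[ℝ] E m => (B.comp X).det)
      (tr.comp (ContinuousLinearMap.compL ℝ (E m) (E m) (E m) B)) A := by
    refine HasFDerivAt.comp (g := fun A : E m →L[ℝ] E m => A.det) A ?_
      (ContinuousLinearMap.compL ℝ (E m) (E m) (E m) B).hasFDerivAt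
    simpa [hBA] using hasFDerivAt_det_id
  have h2 : HasFDerivAt (fun X : E m →L[ℝ] E m => X.det)
      (A.det • tr.comp (ContinuousLinearMap.compL ℝ (E m) (E m) (E m) B)) A := by
    rw [e1]
    exact h1.const_mul _
  have := h2.log hA0
  rwa [smul_smul, inv_mul_cancel₀ hA0, one_smul] at this

end Jacobi

/-! ### Vector fields and Lie brackets in charts, with tangent spaces identified with coordinate
space -/

section ChartCalculus

variable {m : ℕ} {N : Type*} [TopologicalSpace N] [ChartedSpace (E m) N]

lemma two_le_infty : (2 : WithTop ℕ∞) ≤ ∞ := by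
  exact WithTop.coe_le_coe.2 (le_top : (2 : ℕ∞) ≤ ⊤)

/-- The tangent map of the chart `e` at a point. -/
def chartTo (e : Chart m N) (p : N) : E m →L[ℝ] E m := mfderiv 𝓘(ℝ, E m) 𝓘(ℝ, E m) e.1 p

/-- The tangent map of the inverse of the chart `e`. -/
def chartFrom (e : Chart m N) (x : E m) : E m →L[ℝ] E m :=
  mfderiv 𝓘(ℝ, E m) 𝓘(ℝ, E m) e.1.symm x

lemma overlap_of_mem {e e' : Chart m N} {p : N} (hp : p ∈ e.1.source) (hp' : p ∈ e'.1.source) :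
    e.1 p ∈ overlap e e' :=
  mem_overlap.2 ⟨e.1.map_source hp, by rwa [e.1.left_inv hp]⟩

lemma coordTrans_apply {e : Chart m N} (e' : Chart m N) {p : N} (hp : p ∈ e.1.source) :
    coordTrans e e' (e.1 p) = e'.1 p := by
  rw [coordTrans, e.1.left_inv hp]

lemma symm_coordTrans {e e' : Chart m N} {x : E m} (hx : x ∈ overlap e e') :
    e'.1.symm (coordTrans e e' x) = e.1.symm x := by
  rw [coordTrans, e'.1.left_inv (mem_overlap.1 hx).2]

lemma coordTrans_coordTrans {e e' : Chart m N} {x : E m} (hx : x ∈ overlap e e') :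
    coordTrans e' e (coordTrans e e' x) = x := by
  rw [coordTrans, symm_coordTrans hx, e.1.right_inv (mem_overlap.1 hx).1]

lemma chart_mdifferentiable (e : Chart m N) :
    e.1.MDifferentiable 𝓘(ℝ, E m) 𝓘(ℝ, E m) :=
  ⟨(contMDiffOn_of_mem_maximalAtlas e.2).mdifferentiableOn (by simp),
    (contMDiffOn_symm_of_mem_maximalAtlas e.2).mdifferentiableOn (by simp)⟩

lemma contMDiffAt_chart (e : Chart m N) {p : N} (hp : p ∈ e.1.source) :
    ContMDiffAt 𝓘(ℝ, E m) 𝓘(ℝ, E m) ∞ e.1 p := contMDiffAt_of_mem_maximalAtlas e.2 hp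

lemma contMDiffAt_chart_symm (e : Chart m N) {x : E m} (hx : x ∈ e.1.target) :
    ContMDiffAt 𝓘(ℝ, E m) 𝓘(ℝ, E m) ∞ e.1.symm x := contMDiffAt_symm_of_mem_maximalAtlas e.2 hx

variable [IsManifold 𝓘(ℝ, E m) ∞ N]

lemma chartFrom_comp_chartTo {e : Chart m N} {p : N} (hp : p ∈ e.1.source) :
    (chartFrom e (e.1 p)).comp (chartTo e p) = .id ℝ _ :=
  (chart_mdifferentiable e).symm_comp_deriv hp

lemma chartTo_comp_chartFrom {e : Chart m N} {x : E m} (hx : x ∈ e.1.target) :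
    (chartTo e (e.1.symm x)).comp (chartFrom e x) = .id ℝ _ :=
  (chart_mdifferentiable e).comp_symm_deriv hx

lemma chartFrom_chartTo {e : Chart m N} {p : N} (hp : p ∈ e.1.source) (v : E m) :
    chartFrom e (e.1 p) (chartTo e p v) = v := congr($(chartFrom_comp_chartTo hp) v)

lemma chartTo_chartFrom {e : Chart m N} {x : E m} (hx : x ∈ e.1.target) (v : E m) :
    chartTo e (e.1.symm x) (chartFrom e x v) = v := congr($(chartTo_comp_chartFrom hx) v)

lemma chartFrom_chartTo' {e : Chart m N} {x : E m} (hx : x ∈ e.1.target) (v : E m) :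
    chartFrom e x (chartTo e (e.1.symm x) v) = v := by
  have := chartFrom_chartTo (e.1.map_target hx) v
  rwa [e.1.right_inv hx] at this

lemma fderiv_coordTrans {e e' : Chart m N} {x : E m} (hx : x ∈ overlap e e') :
    fderiv ℝ (coordTrans e e') x = (chartTo e' (e.1.symm x)).comp (chartFrom e x) := by
  have h := mem_overlap.1 hx
  rw [← mfderiv_eq_fderiv]
  exact mfderiv_comp (I' := 𝓘(ℝ, E m)) x ((chart_mdifferentiable e').mdifferentiableAt h.2)
    ((chart_mdifferentiable e).mdifferentiableAt_symm h.1)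

lemma fderiv_coordTrans_chartTo {e e' : Chart m N} {x : E m} (hx : x ∈ overlap e e') (v : E m) :
    fderiv ℝ (coordTrans e e') x (chartTo e (e.1.symm x) v) = chartTo e' (e.1.symm x) v := by
  rw [fderiv_coordTrans hx, ContinuousLinearMap.comp_apply, chartFrom_chartTo' (mem_overlap.1 hx).1]

lemma isInvertible_mfderiv_chart {e : Chart m N} {p : N} (hp : p ∈ e.1.source) :
    (mfderiv 𝓘(ℝ, E m) 𝓘(ℝ, E m) e.1 p).IsInvertible :=
  ⟨(chart_mdifferentiable e).mfderiv hp, rfl⟩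

lemma isInvertible_mfderiv_chart_symm {e : Chart m N} {x : E m} (hx : x ∈ e.1.target) :
    (mfderiv 𝓘(ℝ, E m) 𝓘(ℝ, E m) e.1.symm x).IsInvertible :=
  ⟨(chart_mdifferentiable e).symm.mfderiv hx, rfl⟩

lemma mfderiv_chart_symm_inverse {e : Chart m N} {x : E m} (hx : x ∈ e.1.target) :
    (mfderiv 𝓘(ℝ, E m) 𝓘(ℝ, E m) e.1.symm x).inverse = chartTo e (e.1.symm x) := by
  refine ContinuousLinearMap.inverse_eq ?_ ?_
  · have := chartFrom_comp_chartTo (e.1.map_target hx)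
    rwa [e.1.right_inv hx] at this
  · exact chartTo_comp_chartFrom hx

lemma mfderiv_chart_inverse {e : Chart m N} {p : N} (hp : p ∈ e.1.source) :
    (mfderiv 𝓘(ℝ, E m) 𝓘(ℝ, E m) e.1 p).inverse = chartFrom e (e.1 p) := by
  refine ContinuousLinearMap.inverse_eq ?_ ?_
  · have := chartTo_comp_chartFrom (e.1.map_source hp)
    rwa [e.1.left_inv hp] at this
  · exact chartFrom_comp_chartTo hp

/-- The components of a vector field in the chart `e`. -/
def vfRep (σ : ∀ p : N, TangentSpace 𝓘(ℝ, E m) p) (e : Chart m N) (x : E m) : E m :=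
  chartTo e (e.1.symm x) (σ (e.1.symm x))

/-- The vector field with given components in the chart `e`. -/
def vfOf (V : E m → E m) (e : Chart m N) (p : N) : TangentSpace 𝓘(ℝ, E m) p :=
  chartFrom e (e.1 p) (V (e.1 p))

lemma vfRep_vfOf {V : E m → E m} {e : Chart m N} {x : E m} (hx : x ∈ e.1.target) :
    vfRep (vfOf V e) e x = V x := by
  rw [vfRep, vfOf, e.1.right_inv hx]
  exact chartTo_chartFrom hx _

lemma vfOf_vfRep {σ : ∀ p : N, TangentSpace 𝓘(ℝ, E m) p} {e : Chart m N} {p : N}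
    (hp : p ∈ e.1.source) : vfOf (vfRep σ e) e p = σ p := by
  unfold vfOf vfRep
  rw [e.1.left_inv hp]
  exact chartFrom_chartTo hp _

lemma vfRep_trans {σ : ∀ p : N, TangentSpace 𝓘(ℝ, E m) p} {e e' : Chart m N} {x : E m}
    (hx : x ∈ overlap e e') :
    vfRep σ e' (coordTrans e e' x) = fderiv ℝ (coordTrans e e') x (vfRep σ e x) := by
  rw [vfRep, symm_coordTrans hx, vfRep]
  exact (fderiv_coordTrans_chartTo hx _).symm

lemma mdifferentiableAt_vectorSpace_iff {V : ∀ x : E m, TangentSpace 𝓘(ℝ, E m) x} {x : E m} :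
    MDifferentiableAt 𝓘(ℝ, E m) 𝓘(ℝ, E m).tangent
      (fun y => (⟨y, V y⟩ : TangentBundle 𝓘(ℝ, E m) (E m))) x ↔
      DifferentiableAt ℝ (V : E m → E m) x := by
  refine (mdifferentiableAt_section _ _).trans ?_
  simp only [mfld_simps]
  exact mdifferentiableAt_iff_differentiableAt

/-- The component function is the pullback of the field under the inverse chart, so its regularity
is that of a pullback. The next lemmas use the same device for the chart itself and in the smooth
category. -/
lemma differentiableAt_vfRep {σ : ∀ p : N, TangentSpace 𝓘(ℝ, E m) p} {e : Chart m N} {x : E m}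
    (hx : x ∈ e.1.target)
    (hσ : MDifferentiableAt 𝓘(ℝ, E m) 𝓘(ℝ, E m).tangent
      (fun p => (⟨p, σ p⟩ : TangentBundle 𝓘(ℝ, E m) N)) (e.1.symm x)) :
    DifferentiableAt ℝ (vfRep σ e) x := by
  have h := MDifferentiableAt.mpullback_vectorField (I := 𝓘(ℝ, E m)) (n := ∞) hσ
    (contMDiffAt_chart_symm e hx) (isInvertible_mfderiv_chart_symm hx) two_le_infty
  have h2 := mdifferentiableAt_vectorSpace_iff.1 h
  refine h2.congr_of_eventuallyEq ?_
  filter_upwards [e.1.open_target.mem_nhds hx] with y hy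
  unfold VectorField.mpullback
  rw [mfderiv_chart_symm_inverse hy]
  rfl

lemma mdifferentiableAt_vfOf {V : E m → E m} {e : Chart m N} {p : N} (hp : p ∈ e.1.source)
    (hV : DifferentiableAt ℝ V (e.1 p)) :
    MDifferentiableAt 𝓘(ℝ, E m) 𝓘(ℝ, E m).tangent
      (fun p => (⟨p, vfOf V e p⟩ : TangentBundle 𝓘(ℝ, E m) N)) p := by
  have h := MDifferentiableAt.mpullback_vectorField (I := 𝓘(ℝ, E m)) (I' := 𝓘(ℝ, E m)) (n := ∞)
    (V := V) (mdifferentiableAt_vectorSpace_iff.2 hV)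
    (contMDiffAt_chart e hp) (isInvertible_mfderiv_chart hp) two_le_infty
  refine h.congr_of_eventuallyEq ?_
  filter_upwards [e.1.open_source.mem_nhds hp] with q hq
  unfold VectorField.mpullback
  rw [mfderiv_chart_inverse hq]
  rfl

lemma contDiffAt_vfRep {σ : ∀ p : N, TangentSpace 𝓘(ℝ, E m) p} {e : Chart m N} {x : E m}
    (hx : x ∈ e.1.target)
    (hσ : ContMDiffAt 𝓘(ℝ, E m) 𝓘(ℝ, E m).tangent ∞
      (fun p => (⟨p, σ p⟩ : TangentBundle 𝓘(ℝ, E m) N)) (e.1.symm x)) :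
    ContDiffAt ℝ ∞ (vfRep σ e) x := by
  have h := ContMDiffAt.mpullback_vectorField_preimage (I := 𝓘(ℝ, E m)) (n := ∞) hσ
    (contMDiffAt_chart_symm e hx) (isInvertible_mfderiv_chart_symm hx) (by simp)
  have h2 := contMDiffAt_vectorSpace_iff_contDiffAt.1 h
  refine h2.congr_of_eventuallyEq ?_
  filter_upwards [e.1.open_target.mem_nhds hx] with y hy
  unfold VectorField.mpullback
  rw [mfderiv_chart_symm_inverse hy]
  rfl

lemma contMDiffAt_vfOf {V : E m → E m} {e : Chart m N} {p : N} (hp : p ∈ e.1.source)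
    (hV : ContDiffAt ℝ ∞ V (e.1 p)) :
    ContMDiffAt 𝓘(ℝ, E m) 𝓘(ℝ, E m).tangent ∞
      (fun p => (⟨p, vfOf V e p⟩ : TangentBundle 𝓘(ℝ, E m) N)) p := by
  have h := ContMDiffAt.mpullback_vectorField_preimage (I := 𝓘(ℝ, E m)) (I' := 𝓘(ℝ, E m)) (n := ∞)
    (V := V) (contMDiffAt_vectorSpace_iff_contDiffAt.2 hV)
    (contMDiffAt_chart e hp) (isInvertible_mfderiv_chart hp) (by simp)
  refine h.congr_of_eventuallyEq ?_
  filter_upwards [e.1.open_source.mem_nhds hp] with q hq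
  unfold VectorField.mpullback
  rw [mfderiv_chart_inverse hq]
  rfl

lemma mlieBracket_vectorSpace (V W : ∀ x : E m, TangentSpace 𝓘(ℝ, E m) x) (x : E m) :
    VectorField.mlieBracket 𝓘(ℝ, E m) V W x =
      fderiv ℝ (W : E m → E m) x (V x) - fderiv ℝ (V : E m → E m) x (W x) := by
  have h := VectorField.mlieBracketWithin_eq_lieBracketWithin (V := V) (W := W) (s := univ)
  rw [VectorField.mlieBracketWithin_univ] at h
  exact (congrFun h x).trans (congrFun VectorField.lieBracketWithin_univ x)

/-- The Lie bracket of vector fields in coordinates. -/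
lemma chartTo_mlieBracket {σ τ : ∀ p : N, TangentSpace 𝓘(ℝ, E m) p} {e : Chart m N} {x : E m}
    (hx : x ∈ e.1.target)
    (hσ : MDifferentiableAt 𝓘(ℝ, E m) 𝓘(ℝ, E m).tangent
      (fun p => (⟨p, σ p⟩ : TangentBundle 𝓘(ℝ, E m) N)) (e.1.symm x))
    (hτ : MDifferentiableAt 𝓘(ℝ, E m) 𝓘(ℝ, E m).tangent
      (fun p => (⟨p, τ p⟩ : TangentBundle 𝓘(ℝ, E m) N)) (e.1.symm x)) :
    chartTo e (e.1.symm x) (VectorField.mlieBracket 𝓘(ℝ, E m) σ τ (e.1.symm x)) =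
      fderiv ℝ (vfRep τ e) x (vfRep σ e x) - fderiv ℝ (vfRep σ e) x (vfRep τ e x) := by
  have : IsManifold 𝓘(ℝ, E m) (minSmoothness ℝ 2) N :=
    IsManifold.of_le (n := ∞) (by simpa using two_le_infty)
  -- The Lie bracket commutes with pullback under the inverse chart, and on a vector space it is the
  -- commutator of derivatives.
  have h := VectorField.mpullback_mlieBracket (I := 𝓘(ℝ, E m)) (n := ∞) hσ hτ
    (contMDiffAt_chart_symm e hx) (by simpa using two_le_infty)
  have hc : ∀ ρ : (∀ p : N, TangentSpace 𝓘(ℝ, E m) p),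
      VectorField.mpullback 𝓘(ℝ, E m) 𝓘(ℝ, E m) e.1.symm ρ =ᶠ[𝓝 x] vfRep ρ e := fun ρ => by
    filter_upwards [e.1.open_target.mem_nhds hx] with y hy
    unfold VectorField.mpullback
    rw [mfderiv_chart_symm_inverse hy]
    rfl
  have h1 := (hc σ).mlieBracket_vectorField_eq (hc τ)
  rw [h1, (hc _).eq_of_nhds] at h
  exact h.trans (mlieBracket_vectorSpace _ _ x)

end ChartCalculus

/-! ### Bilinear maps from their coefficients -/

section Bilinear

variable {m : ℕ}

/-- The bilinear map with given coefficients. -/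
def bil (c : Fin m → Fin m → Fin m → ℝ) : E m →L[ℝ] E m →L[ℝ] E m :=
  ∑ k, ∑ i, ∑ j, c k i j • (EuclideanSpace.proj i : E m →L[ℝ] ℝ).smulRight
    ((EuclideanSpace.proj j : E m →L[ℝ] ℝ).smulRight (sgl k))

lemma bil_apply (c : Fin m → Fin m → Fin m → ℝ) (u v : E m) (k : Fin m) :
    bil c u v k = ∑ i, ∑ j, c k i j * u i * v j := by
  simp [bil, Finset.sum_apply, Pi.single_apply, mul_assoc]

lemma bil_sgl (c : Fin m → Fin m → Fin m → ℝ) (i j k : Fin m) :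
    bil c (sgl i) (sgl j) k = c k i j := by
  simp [bil_apply]

lemma bil_ext {B B' : E m →L[ℝ] E m →L[ℝ] E m} (h : ∀ i j, B (sgl i) (sgl j) = B' (sgl i) (sgl j)) :
    B = B' := by
  ext1 u
  ext1 v
  rw [map_eq_sum B u, map_eq_sum B' u]
  simp only [sum_apply, smul_apply]
  refine Finset.sum_congr rfl fun i _ => ?_
  rw [map_eq_sum (B (sgl i)) v, map_eq_sum (B' (sgl i)) v]
  simp only [h]

lemma contDiffOn_bil {F : Type*} [NormedAddCommGroup F] [NormedSpace ℝ F] {s : Set F}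
    {c : Fin m → Fin m → Fin m → F → ℝ} (hc : ∀ k i j, ContDiffOn ℝ ∞ (c k i j) s) :
    ContDiffOn ℝ ∞ (fun x => bil fun k i j => c k i j x) s := by
  unfold bil
  exact ContDiffOn.sum fun k _ => ContDiffOn.sum fun i _ => ContDiffOn.sum fun j _ =>
    (ContinuousLinearMap.toSpanSingleton ℝ _).contDiff.comp_contDiffOn (hc k i j)

end Bilinear

/-! ### Connections in coordinates: coefficients, transformation law, symmetry -/

section ConnectionCalculus

variable {m : ℕ} {N : Type*} [TopologicalSpace N] [ChartedSpace (E m) N]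
  [IsManifold 𝓘(ℝ, E m) ∞ N]

lemma mfderiv_comp_chart {F : Type*} [NormedAddCommGroup F] [NormedSpace ℝ F] {h : E m → F}
    {e : Chart m N} {p : N} (hp : p ∈ e.1.source) (hh : DifferentiableAt ℝ h (e.1 p)) :
    mfderiv 𝓘(ℝ, E m) 𝓘(ℝ, F) (h ∘ e.1) p = (fderiv ℝ h (e.1 p)).comp (chartTo e p) := by
  rw [mfderiv_comp (I' := 𝓘(ℝ, E m)) p hh.mdifferentiableAt
    ((chart_mdifferentiable e).mdifferentiableAt hp), mfderiv_eq_fderiv]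
  rfl

lemma mfderiv_eq_fderiv_comp_chartTo {F : Type*} [NormedAddCommGroup F] [NormedSpace ℝ F]
    {f : N → F} {e : Chart m N} {x : E m} (hx : x ∈ e.1.target)
    (hf : DifferentiableAt ℝ (f ∘ e.1.symm) x) :
    mfderiv 𝓘(ℝ, E m) 𝓘(ℝ, F) f (e.1.symm x) =
      (fderiv ℝ (f ∘ e.1.symm) x).comp (chartTo e (e.1.symm x)) := by
  have hp := e.1.map_target hx
  have h : f =ᶠ[𝓝 (e.1.symm x)] (f ∘ e.1.symm) ∘ e.1 := by
    filter_upwards [e.1.open_source.mem_nhds hp] with q hq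
    simp [e.1.left_inv hq]
  rw [h.mfderiv_eq, mfderiv_comp_chart hp (by rwa [e.1.right_inv hx]), e.1.right_inv hx]

lemma mdifferentiableAt_coordField {e : Chart m N} (j : Fin m) {p : N} (hp : p ∈ e.1.source) :
    MDifferentiableAt 𝓘(ℝ, E m) 𝓘(ℝ, E m).tangent
      (fun p => (⟨p, coordField e j p⟩ : TangentBundle 𝓘(ℝ, E m) N)) p :=
  mdifferentiableAt_vfOf hp (differentiableAt_const _)

/-- The connection coefficients in the chart `e`, as a bilinear map. -/
def Connection.gam (D : Connection m N) (e : Chart m N) (x : E m) : E m →L[ℝ] E m →L[ℝ] E m :=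
  bil fun k i j => D.coeff e k i j x

/-- The covariant derivative of a vector field at a point, as an endomorphism of coordinate space. -/
def Connection.covE (D : Connection m N) (σ : ∀ p : N, TangentSpace 𝓘(ℝ, E m) p) (p : N) :
    E m →L[ℝ] E m := D.cov σ p

lemma Connection.covE_congr (D : Connection m N) {σ τ : ∀ p : N, TangentSpace 𝓘(ℝ, E m) p} {p : N}
    (hσ : MDifferentiableAt 𝓘(ℝ, E m) 𝓘(ℝ, E m).tangent
      (fun p => (⟨p, σ p⟩ : TangentBundle 𝓘(ℝ, E m) N)) p)
    (hτ : MDifferentiableAt 𝓘(ℝ, E m) 𝓘(ℝ, E m).tangent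
      (fun p => (⟨p, τ p⟩ : TangentBundle 𝓘(ℝ, E m) N)) p) (h : ∀ᶠ q in 𝓝 p, σ q = τ q) :
    D.covE σ p = D.covE τ p :=
  D.cov.isCovariantDerivativeOnUniv.congr_of_eventuallyEq hσ hτ univ_mem h

/-- The differential of `g` and the value of `σ` enter through equations, so that they can be
replaced by elements typed over plain coordinate space rather than over the tangent space at `p`. -/
lemma Connection.covE_leibniz (D : Connection m N) {σ : ∀ p : N, TangentSpace 𝓘(ℝ, E m) p} {p : N}
    (hσ : MDifferentiableAt 𝓘(ℝ, E m) 𝓘(ℝ, E m).tangent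
      (fun p => (⟨p, σ p⟩ : TangentBundle 𝓘(ℝ, E m) N)) p) {g : N → ℝ} {g' : E m →L[ℝ] ℝ}
    (hg : MDifferentiableAt 𝓘(ℝ, E m) 𝓘(ℝ, ℝ) g p)
    (hg' : mfderiv 𝓘(ℝ, E m) 𝓘(ℝ, ℝ) g p = g') {w : E m} (hw : σ p = w) :
    D.covE (g • σ) p = g p • D.covE σ p + g'.smulRight w := by
  subst hg' hw
  exact D.cov.isCovariantDerivativeOnUniv.leibniz hσ hg

lemma Connection.gam_sgl_apply (D : Connection m N) (e : Chart m N) (x : E m) (i j k : Fin m) :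
    D.gam e x (sgl i) (sgl j) k = D.coeff e k i j x := bil_sgl _ _ _ _

lemma Connection.gam_sgl (D : Connection m N) {e : Chart m N} {x : E m} (hx : x ∈ e.1.target)
    (i j : Fin m) : D.gam e x (sgl i) (sgl j) =
      chartTo e (e.1.symm x) (D.covE (coordField e j) (e.1.symm x) (chartFrom e x (sgl i))) := by
  ext k
  have h := D.gam_sgl_apply e x i j k
  have h2 : coordField e i (e.1.symm x) = chartFrom e x (sgl i) := by
    change chartFrom e (e.1 (e.1.symm x)) (sgl i) = _
    rw [e.1.right_inv hx]
  rw [h, ← h2]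
  rfl

lemma mdifferentiableAt_sum_vf {ι : Type*} (s : Finset ι)
    {σ : ι → ∀ p : N, TangentSpace 𝓘(ℝ, E m) p} {p : N}
    (hσ : ∀ i ∈ s, MDifferentiableAt 𝓘(ℝ, E m) 𝓘(ℝ, E m).tangent
      (fun p => (⟨p, σ i p⟩ : TangentBundle 𝓘(ℝ, E m) N)) p) :
    MDifferentiableAt 𝓘(ℝ, E m) 𝓘(ℝ, E m).tangent
      (fun p => (⟨p, (∑ i ∈ s, σ i) p⟩ : TangentBundle 𝓘(ℝ, E m) N)) p := by
  classical
  induction s using Finset.induction_on with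
  | empty =>
    simp only [Finset.sum_empty]
    exact mdifferentiableAt_zeroSection ..
  | insert a s ha ih =>
    rw [Finset.sum_insert ha]
    exact mdifferentiableAt_add_section (hσ a (by simp)) (ih fun i hi => hσ i (by simp [hi]))

lemma Connection.covE_sum (D : Connection m N) {ι : Type*} (s : Finset ι)
    {σ : ι → ∀ p : N, TangentSpace 𝓘(ℝ, E m) p} {p : N}
    (hσ : ∀ i ∈ s, MDifferentiableAt 𝓘(ℝ, E m) 𝓘(ℝ, E m).tangent
      (fun p => (⟨p, σ i p⟩ : TangentBundle 𝓘(ℝ, E m) N)) p) :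
    D.covE (∑ i ∈ s, σ i) p = ∑ i ∈ s, D.covE (σ i) p := by
  classical
  induction s using Finset.induction_on with
  | empty =>
    simp only [Finset.sum_empty]
    exact congrFun D.cov.zero p
  | insert a s ha ih =>
    have h := mdifferentiableAt_sum_vf s fun i hi => hσ i (by simp [hi])
    rw [Finset.sum_insert ha, Finset.sum_insert ha, ← ih fun i hi => hσ i (by simp [hi])]
    exact D.cov.isCovariantDerivativeOnUniv.add (hσ a (by simp)) h

/-- The covariant derivative in coordinates. -/
lemma Connection.chartTo_cov (D : Connection m N) {e : Chart m N} {x : E m} (hx : x ∈ e.1.target)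
    {σ : ∀ p : N, TangentSpace 𝓘(ℝ, E m) p}
    (hσ : MDifferentiableAt 𝓘(ℝ, E m) 𝓘(ℝ, E m).tangent
      (fun p => (⟨p, σ p⟩ : TangentBundle 𝓘(ℝ, E m) N)) (e.1.symm x)) (v : E m) :
    chartTo e (e.1.symm x) (D.covE σ (e.1.symm x) (chartFrom e x v)) =
      fderiv ℝ (vfRep σ e) x v + D.gam e x v (vfRep σ e x) := by
  set p := e.1.symm x with hp
  have hps : p ∈ e.1.source := e.1.map_target hx
  have hep : e.1 p = x := e.1.right_inv hx
  have hd := differentiableAt_vfRep hx hσ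
  have hdj : ∀ j, DifferentiableAt ℝ (fun y => vfRep σ e y j) (e.1 p) := fun j => by
    rw [hep]
    exact (EuclideanSpace.proj (𝕜 := ℝ) j).differentiableAt.comp x hd
  set g : Fin m → N → ℝ := fun j => (fun y => vfRep σ e y j) ∘ e.1 with hg
  have hgd : ∀ j, MDifferentiableAt 𝓘(ℝ, E m) 𝓘(ℝ, ℝ) (g j) p := fun j =>
    (hdj j).mdifferentiableAt.comp p ((chart_mdifferentiable e).mdifferentiableAt hps)
  have hs : ∀ j ∈ Finset.univ, MDifferentiableAt 𝓘(ℝ, E m) 𝓘(ℝ, E m).tangent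
      (fun p => (⟨p, (g j • coordField e j) p⟩ : TangentBundle 𝓘(ℝ, E m) N)) p := fun j _ =>
    (hgd j).smul_section (mdifferentiableAt_coordField j hps)
  -- Near `p` the field is the combination of the coordinate fields with its components as
  -- coefficients; locality of the covariant derivative and the Leibniz rule reduce the claim to the
  -- definition of the coefficients.
  have heq : ∀ᶠ q in 𝓝 p, σ q = (∑ j, g j • coordField e j) q := by
    filter_upwards [e.1.open_source.mem_nhds hps] with q hq
    rw [← vfOf_vfRep (σ := σ) hq]
    change chartFrom e (e.1 q) (vfRep σ e (e.1 q)) = _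
    rw [map_eq_sum (chartFrom e (e.1 q)) (vfRep σ e (e.1 q)), Finset.sum_apply]
    rfl
  rw [D.covE_congr hσ (mdifferentiableAt_sum_vf _ hs) heq, D.covE_sum _ hs]
  have hj : ∀ j, chartTo e p (D.covE (g j • coordField e j) p (chartFrom e x v)) =
      vfRep σ e x j • D.gam e x v (sgl j) + (fderiv ℝ (vfRep σ e) x v) j • sgl j := fun j => by
    have h2 : mfderiv 𝓘(ℝ, E m) 𝓘(ℝ, ℝ) (g j) p =
        ((EuclideanSpace.proj (𝕜 := ℝ) j).comp (fderiv ℝ (vfRep σ e) x)).comp (chartTo e p) := by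
      rw [mfderiv_comp_chart hps (hdj j), hep]
      congr 1
      exact ((EuclideanSpace.proj (𝕜 := ℝ) j).hasFDerivAt.comp x hd.hasFDerivAt).fderiv
    have h3 : coordField e j p = chartFrom e x (sgl j) := by
      change chartFrom e (e.1 p) (sgl j) = _
      rw [hep]
    rw [D.covE_leibniz (mdifferentiableAt_coordField j hps) (hgd j) h2 h3]
    have h1 : chartTo e p (D.covE (coordField e j) p (chartFrom e x v)) = D.gam e x v (sgl j) := by
      rw [map_eq_sum (D.gam e x) v, map_eq_sum (chartFrom e x) v]
      simp only [sum_apply, smul_apply, D.gam_sgl hx]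
      rw [map_sum, map_sum]
      simp only [map_smul]
      rfl
    have h4 : g j p = vfRep σ e x j := by simp [hg, hep]
    rw [← h1, ← h4]
    simp only [add_apply, smul_apply, ContinuousLinearMap.smulRight_apply,
      ContinuousLinearMap.comp_apply, map_add, map_smul, hp, chartTo_chartFrom hx]
    rfl
  rw [sum_apply, map_sum, Finset.sum_congr rfl fun j _ => hj j, Finset.sum_add_distrib,
    sum_coord_smul, ← map_eq_sum (D.gam e x v), add_comm]

/-- The transformation law of the connection coefficients. -/
lemma Connection.gam_trans (D : Connection m N) {e e' : Chart m N} {x : E m}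
    (hx : x ∈ overlap e e') (u v : E m) :
    fderiv ℝ (fderiv ℝ (coordTrans e e')) x u v =
      fderiv ℝ (coordTrans e e') x (D.gam e x u v) -
        D.gam e' (coordTrans e e' x) (fderiv ℝ (coordTrans e e') x u)
          (fderiv ℝ (coordTrans e e') x v) := by
  have hxe := (mem_overlap.1 hx).1
  have hy := (mem_overlap.1 (trans_mem hx)).1
  -- A field with constant components in `e` has in `e'` the components F'(y)v, whose derivative is
  -- the second derivative of the coordinate change. Computing ∇σ in both charts and comparing gives
  -- the law.
  set σ : ∀ p : N, TangentSpace 𝓘(ℝ, E m) p := vfOf (fun _ => v) e with hσ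
  have hps := e.1.map_target hxe
  have hd : MDifferentiableAt 𝓘(ℝ, E m) 𝓘(ℝ, E m).tangent
      (fun p => (⟨p, σ p⟩ : TangentBundle 𝓘(ℝ, E m) N)) (e.1.symm x) :=
    mdifferentiableAt_vfOf hps (differentiableAt_const _)
  have h1 := D.chartTo_cov hxe hd u
  have hd' := hd
  rw [← symm_coordTrans hx] at hd'
  have h2 := D.chartTo_cov hy hd' (fderiv ℝ (coordTrans e e') x u)
  have hrep : vfRep σ e =ᶠ[𝓝 x] fun _ => v := by
    filter_upwards [e.1.open_target.mem_nhds hxe] with y hy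
    exact vfRep_vfOf hy
  rw [hrep.fderiv_eq, hrep.eq_of_nhds] at h1
  simp only [fderiv_fun_const, Pi.zero_apply, zero_apply, zero_add] at h1
  have hrep' : vfRep σ e' ∘ coordTrans e e' =ᶠ[𝓝 x] fun y => fderiv ℝ (coordTrans e e') y v := by
    filter_upwards [(isOpen_overlap e e').mem_nhds hx] with y hy
    rw [Function.comp_apply, vfRep_trans hy, vfRep_vfOf (mem_overlap.1 hy).1]
  have hF : DifferentiableAt ℝ (fderiv ℝ (coordTrans e e')) x :=
    ((((contDiffOn_trans e e').contDiffAt ((isOpen_overlap e e').mem_nhds hx)).fderiv_right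
      (m := ∞) (by simp))).differentiableAt (by simp)
  have hrd := differentiableAt_vfRep hy hd'
  have h3 : fderiv ℝ (fderiv ℝ (coordTrans e e')) x u v =
      fderiv ℝ (vfRep σ e') (coordTrans e e' x) (fderiv ℝ (coordTrans e e') x u) := by
    have ha := (hF.hasFDerivAt.clm_apply (hasFDerivAt_const v x)).fderiv
    rw [← hrep'.fderiv_eq, fderiv_comp x hrd (differentiableAt_trans hx)] at ha
    have := congr($ha u)
    simpa using this.symm
  have h4 : vfRep σ e' (coordTrans e e' x) = fderiv ℝ (coordTrans e e') x v := hrep'.eq_of_nhds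
  have h5 : chartFrom e' (coordTrans e e' x) (fderiv ℝ (coordTrans e e') x u) =
      chartFrom e x u := by
    rw [fderiv_coordTrans hx]
    have := chartFrom_chartTo' hy (chartFrom e x u)
    rw [symm_coordTrans hx] at this
    exact this
  rw [h3, eq_sub_iff_add_eq, ← h1]
  rw [h4] at h2
  rw [← h2, symm_coordTrans hx, h5, fderiv_coordTrans_chartTo hx]

/-- Fields with constant components commute, so vanishing torsion on such fields is the symmetry of
the coefficients. -/
lemma Connection.gam_symm (D : Connection m N) {e : Chart m N} {x : E m} (hx : x ∈ e.1.target)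
    (u v : E m) : D.gam e x u v = D.gam e x v u := by
  have hps := e.1.map_target hx
  have hd : ∀ w : E m, MDifferentiableAt 𝓘(ℝ, E m) 𝓘(ℝ, E m).tangent
      (fun p => (⟨p, vfOf (fun _ => w) e p⟩ : TangentBundle 𝓘(ℝ, E m) N)) (e.1.symm x) :=
    fun w => mdifferentiableAt_vfOf hps (differentiableAt_const _)
  have hrep : ∀ w : E m, vfRep (N := N) (vfOf (fun _ => w) e) e =ᶠ[𝓝 x] fun _ => w := fun w => by
    filter_upwards [e.1.open_target.mem_nhds hx] with y hy
    exact vfRep_vfOf hy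
  have hval : ∀ w : E m, vfOf (N := N) (fun _ => w) e (e.1.symm x) = chartFrom e x w := fun w => by
    unfold vfOf
    rw [e.1.right_inv hx]
  have h0 : D.cov.torsion = 0 := by
    funext p
    exact D.torsion_free p
  have h1 : (D.covE (vfOf (fun _ => v) e) (e.1.symm x) (vfOf (fun _ => u) e (e.1.symm x)) : E m) -
      D.covE (vfOf (fun _ => u) e) (e.1.symm x) (vfOf (fun _ => v) e (e.1.symm x)) =
        VectorField.mlieBracket 𝓘(ℝ, E m) (vfOf (fun _ => u) e) (vfOf (fun _ => v) e) (e.1.symm x) :=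
    D.cov.torsion_eq_zero_iff.1 h0 (hd u) (hd v)
  have h2 := congrArg (chartTo e (e.1.symm x)) h1
  rw [chartTo_mlieBracket hx (hd u) (hd v), (hrep u).fderiv_eq, (hrep v).fderiv_eq, map_sub] at h2
  simp only [fderiv_fun_const, Pi.zero_apply, zero_apply, sub_zero] at h2
  rw [hval, hval] at h2
  have h3 := D.chartTo_cov hx (hd v) u
  have h4 := D.chartTo_cov hx (hd u) v
  rw [(hrep _).fderiv_eq, (hrep _).eq_of_nhds] at h3 h4
  simp only [fderiv_fun_const, Pi.zero_apply, zero_apply, zero_add] at h3 h4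
  rw [← h3, ← h4, ← sub_eq_zero]
  exact h2

end ConnectionCalculus

/-! ### Smoothness of connection coefficients, and connections glued from local coefficients -/

section Gluing

variable {m : ℕ} {N : Type*} [TopologicalSpace N] [ChartedSpace (E m) N]
  [IsManifold 𝓘(ℝ, E m) ∞ N]

/-- Smoothness of a connection is a statement about global smooth fields, whereas ∂_j lives on the
chart only. A bump function equal to 1 near the point, available because the manifold is Hausdorff,
makes it global without changing its covariant derivative nearby. -/
lemma Connection.contDiffOn_coeff [T2Space N] (D : Connection m N) (e : Chart m N)
    (k i j : Fin m) : ContDiffOn ℝ ∞ (D.coeff e k i j) e.1.target := by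
  intro x hx
  refine ContDiffAt.contDiffWithinAt ?_
  set p := e.1.symm x with hp
  have hps : p ∈ e.1.source := e.1.map_target hx
  obtain ⟨χ, -, hχ⟩ := (SmoothBumpFunction.nhds_basis_tsupport (I := 𝓘(ℝ, E m)) p).mem_iff.1
    (e.1.open_source.mem_nhds hps)
  have hfield : ∀ l, ∀ q ∈ e.1.source, ContMDiffAt 𝓘(ℝ, E m) 𝓘(ℝ, E m).tangent ∞
      (fun p => (⟨p, coordField e l p⟩ : TangentBundle 𝓘(ℝ, E m) N)) q := fun l q hq =>
    contMDiffAt_vfOf hq contDiffAt_const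
  have hσ := ContMDiffOn.smul_section_of_tsupport (u := e.1.source) (s := coordField e j)
    χ.contMDiff.contMDiffOn e.1.open_source hχ fun q hq => (hfield j q hq).contMDiffWithinAt
  have h1 := (D.smooth.contMDiff.contMDiff (by simpa using hσ.contMDiffOn)).contMDiffAt
    (x := p) univ_mem
  have h2 := contDiffAt_vfRep (e := e) hx (h1.clm_bundle_apply (hfield i p hps))
  have h3 := (EuclideanSpace.proj (𝕜 := ℝ) k).contDiff.contDiffAt.comp x h2
  refine h3.congr_of_eventuallyEq ?_
  have h4 : ∀ᶠ q in 𝓝 p, D.cov ((χ : N → ℝ) • coordField e j) q = D.cov (coordField e j) q := by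
    filter_upwards [χ.eventuallyEq_one.eventually_nhds, e.1.open_source.mem_nhds hps] with q hq hqs
    refine D.cov.isCovariantDerivativeOnUniv.congr_of_eventuallyEq
      ((hσ q).mdifferentiableAt (by simp)) (mdifferentiableAt_coordField j hqs) univ_mem ?_
    filter_upwards [hq] with r hr
    simp [hr]
  have h5 := (e.1.continuousAt_symm hx).eventually h4
  filter_upwards [h5] with y hy
  unfold Connection.coeff
  rw [← hy]
  rfl

lemma Connection.contDiffOn_gam [T2Space N] (D : Connection m N) (e : Chart m N) :
    ContDiffOn ℝ ∞ (D.gam e) e.1.target :=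
  contDiffOn_bil fun k i j => D.contDiffOn_coeff e k i j

/-- The expression in coordinates of the covariant derivative with connection coefficients `G`. -/
def locCov (G : E m → E m →L[ℝ] E m →L[ℝ] E m) (r : E m → E m) (x : E m) : E m →L[ℝ] E m :=
  fderiv ℝ r x + (G x).flip (r x)

lemma chartFrom_fderiv_coordTrans {e e' : Chart m N} {x : E m} (hx : x ∈ overlap e e') (v : E m) :
    chartFrom e' (coordTrans e e' x) (fderiv ℝ (coordTrans e e') x v) = chartFrom e x v := by
  rw [fderiv_coordTrans hx]
  have := chartFrom_chartTo' (mem_overlap.1 (trans_mem hx)).1 (chartFrom e x v)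
  rw [symm_coordTrans hx] at this
  exact this

lemma differentiableAt_fderiv_coordTrans {e e' : Chart m N} {x : E m} (hx : x ∈ overlap e e') :
    DifferentiableAt ℝ (fderiv ℝ (coordTrans e e')) x :=
  (((contDiffOn_trans e e').contDiffAt ((isOpen_overlap e e').mem_nhds hx)).fderiv_right
    (m := ∞) (by simp)).differentiableAt (by simp)

/-- Differentiating the transformation rule of vector components produces F''(u, σ) as the only
non-tensorial term, and the law for the coefficients replaces it by what the two zeroth-order terms
need. -/
lemma locCov_trans {e e' : Chart m N} {x : E m} (hx : x ∈ overlap e e')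
    {G G' : E m → E m →L[ℝ] E m →L[ℝ] E m}
    (law : ∀ u v, fderiv ℝ (fderiv ℝ (coordTrans e e')) x u v =
      fderiv ℝ (coordTrans e e') x (G x u v) - G' (coordTrans e e' x)
        (fderiv ℝ (coordTrans e e') x u) (fderiv ℝ (coordTrans e e') x v))
    {σ : ∀ p : N, TangentSpace 𝓘(ℝ, E m) p}
    (hσ : MDifferentiableAt 𝓘(ℝ, E m) 𝓘(ℝ, E m).tangent
      (fun p => (⟨p, σ p⟩ : TangentBundle 𝓘(ℝ, E m) N)) (e.1.symm x)) (u : E m) :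
    locCov G' (vfRep σ e') (coordTrans e e' x) (fderiv ℝ (coordTrans e e') x u) =
      fderiv ℝ (coordTrans e e') x (locCov G (vfRep σ e) x u) := by
  have hy := (mem_overlap.1 (trans_mem hx)).1
  have h1 := differentiableAt_vfRep (mem_overlap.1 hx).1 hσ
  rw [← symm_coordTrans hx] at hσ
  have h2 := differentiableAt_vfRep hy hσ
  have h3 : vfRep σ e' ∘ coordTrans e e' =ᶠ[𝓝 x]
      fun y => fderiv ℝ (coordTrans e e') y (vfRep σ e y) := by
    filter_upwards [(isOpen_overlap e e').mem_nhds hx] with y hy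
    exact vfRep_trans hy
  have h4 := ((differentiableAt_fderiv_coordTrans hx).hasFDerivAt.clm_apply h1.hasFDerivAt).fderiv
  rw [← h3.fderiv_eq, fderiv_comp x h2 (differentiableAt_trans hx)] at h4
  have h5 := congr($h4 u)
  simp only [ContinuousLinearMap.comp_apply, add_apply, ContinuousLinearMap.flip_apply, law] at h5
  simp only [locCov, add_apply, ContinuousLinearMap.flip_apply, h5, map_add, vfRep_trans hx]
  abel

/-- The operator `∇σ` at a point computed in the chart `e` with connection coefficients `G`. -/
def covIn (e : Chart m N) (G : E m → E m →L[ℝ] E m →L[ℝ] E m)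
    (σ : ∀ p : N, TangentSpace 𝓘(ℝ, E m) p) (p : N) : E m →L[ℝ] E m :=
  (chartFrom e (e.1 p)).comp ((locCov G (vfRep σ e) (e.1 p)).comp (chartTo e p))

/-- This is the well-definedness on which gluing rests: `locCov_trans` conjugated back to the
tangent space at the point. -/
lemma covIn_eq {e e' : Chart m N} {p : N} (hp : p ∈ e.1.source) (hp' : p ∈ e'.1.source)
    {G G' : E m → E m →L[ℝ] E m →L[ℝ] E m}
    (law : ∀ u v, fderiv ℝ (fderiv ℝ (coordTrans e e')) (e.1 p) u v =
      fderiv ℝ (coordTrans e e') (e.1 p) (G (e.1 p) u v) - G' (coordTrans e e' (e.1 p))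
        (fderiv ℝ (coordTrans e e') (e.1 p) u) (fderiv ℝ (coordTrans e e') (e.1 p) v))
    {σ : ∀ p : N, TangentSpace 𝓘(ℝ, E m) p}
    (hσ : MDifferentiableAt 𝓘(ℝ, E m) 𝓘(ℝ, E m).tangent
      (fun p => (⟨p, σ p⟩ : TangentBundle 𝓘(ℝ, E m) N)) p) :
    covIn e' G' σ p = covIn e G σ p := by
  ext1 v
  have hx := overlap_of_mem hp hp'
  have h1 := fderiv_coordTrans_chartTo hx v
  rw [e.1.left_inv hp] at h1
  have h2 := locCov_trans hx law (σ := σ) (by rwa [e.1.left_inv hp]) (chartTo e p v)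
  rw [coordTrans_apply e' hp, h1] at h2
  have h3 := chartFrom_fderiv_coordTrans hx (locCov G (vfRep σ e) (e.1 p) (chartTo e p v))
  rw [coordTrans_apply e' hp, ← h2] at h3
  exact h3

lemma covIn_add {e : Chart m N} {G : E m → E m →L[ℝ] E m →L[ℝ] E m}
    {σ τ : ∀ p : N, TangentSpace 𝓘(ℝ, E m) p} {p : N} (hp : p ∈ e.1.source)
    (hσ : MDifferentiableAt 𝓘(ℝ, E m) 𝓘(ℝ, E m).tangent
      (fun p => (⟨p, σ p⟩ : TangentBundle 𝓘(ℝ, E m) N)) p)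
    (hτ : MDifferentiableAt 𝓘(ℝ, E m) 𝓘(ℝ, E m).tangent
      (fun p => (⟨p, τ p⟩ : TangentBundle 𝓘(ℝ, E m) N)) p) :
    covIn e G (σ + τ) p = covIn e G σ p + covIn e G τ p := by
  rw [← e.1.left_inv hp] at hσ hτ
  have h1 : vfRep (σ + τ) e = vfRep σ e + vfRep τ e := by
    funext x
    exact map_add (chartTo e (e.1.symm x)) _ _
  have h2 : locCov G (vfRep (σ + τ) e) (e.1 p) =
      locCov G (vfRep σ e) (e.1 p) + locCov G (vfRep τ e) (e.1 p) := by
    rw [h1, locCov, fderiv_add (differentiableAt_vfRep (e.1.map_source hp) hσ)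
      (differentiableAt_vfRep (e.1.map_source hp) hτ), Pi.add_apply, map_add]
    simp only [locCov]
    abel
  rw [covIn, h2, ContinuousLinearMap.add_comp, ContinuousLinearMap.comp_add]
  rfl

lemma covIn_leibniz {e : Chart m N} {G : E m → E m →L[ℝ] E m →L[ℝ] E m}
    {σ : ∀ p : N, TangentSpace 𝓘(ℝ, E m) p} {p : N} (hp : p ∈ e.1.source)
    (hσ : MDifferentiableAt 𝓘(ℝ, E m) 𝓘(ℝ, E m).tangent
      (fun p => (⟨p, σ p⟩ : TangentBundle 𝓘(ℝ, E m) N)) p) {g : N → ℝ} {g' : E m →L[ℝ] ℝ}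
    (hg : MDifferentiableAt 𝓘(ℝ, E m) 𝓘(ℝ, ℝ) g p)
    (hg' : mfderiv 𝓘(ℝ, E m) 𝓘(ℝ, ℝ) g p = g') {w : E m} (hw : σ p = w) :
    covIn e G (g • σ) p = g p • covIn e G σ p + g'.smulRight w := by
  have hx := e.1.map_source hp
  have h0 := e.1.left_inv hp
  rw [← h0] at hσ hg
  have hgd : DifferentiableAt ℝ (g ∘ e.1.symm) (e.1 p) :=
    (hg.comp (e.1 p) ((chart_mdifferentiable e).mdifferentiableAt_symm hx)).differentiableAt
  have h1 : vfRep (g • σ) e = fun x => (g ∘ e.1.symm) x • vfRep σ e x := by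
    funext x
    exact map_smul (chartTo e (e.1.symm x)) _ _
  have h2 := mfderiv_eq_fderiv_comp_chartTo hx hgd
  rw [h0, hg'] at h2
  have h4 : chartFrom e (e.1 p) (vfRep σ e (e.1 p)) = w := by
    rw [← hw]
    exact vfOf_vfRep hp
  ext1 v
  simp only [covIn, locCov, h1, ContinuousLinearMap.comp_apply, add_apply,
    ContinuousLinearMap.flip_apply, fderiv_fun_smul hgd (differentiableAt_vfRep hx hσ), smul_apply,
    ContinuousLinearMap.smulRight_apply, map_add, map_smul, h2, h4]
  simp only [Function.comp_apply, h0, smul_add]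
  abel

set_option synthInstance.maxHeartbeats 200000 in
/-- Smooth symmetric connection coefficients, given in the charts of an atlas and obeying the
transformation law, define a torsion-free connection. -/
theorem exists_connection {ι : Type*} (c : ι → Chart m N)
    (hc : ∀ p : N, ∃ i, (c i).1 = chartAt (E m) p) (G : ι → E m → E m →L[ℝ] E m →L[ℝ] E m)
    (hG : ∀ i, ContDiffOn ℝ ∞ (G i) (c i).1.target)
    (hsymm : ∀ i, ∀ x ∈ (c i).1.target, ∀ u v, G i x u v = G i x v u)
    (law : ∀ i j, ∀ x ∈ overlap (c i) (c j), ∀ u v,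
      fderiv ℝ (fderiv ℝ (coordTrans (c i) (c j))) x u v =
      fderiv ℝ (coordTrans (c i) (c j)) x (G i x u v) - G j (coordTrans (c i) (c j) x)
        (fderiv ℝ (coordTrans (c i) (c j)) x u) (fderiv ℝ (coordTrans (c i) (c j)) x v)) :
    ∃ D : Connection m N, ∀ i, ∀ x ∈ (c i).1.target, D.gam (c i) x = G i x := by
  choose idx hidx using hc
  have hsrc : ∀ p, p ∈ (c (idx p)).1.source := fun p => by
    rw [hidx]
    exact mem_chart_source _ p
  have hind : ∀ i {p : N} (_ : p ∈ (c i).1.source) {σ : ∀ p : N, TangentSpace 𝓘(ℝ, E m) p}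
      (_ : MDifferentiableAt 𝓘(ℝ, E m) 𝓘(ℝ, E m).tangent
        (fun p => (⟨p, σ p⟩ : TangentBundle 𝓘(ℝ, E m) N)) p),
      covIn (c (idx p)) (G (idx p)) σ p = covIn (c i) (G i) σ p := fun i p hp σ hσ =>
    covIn_eq hp (hsrc p) (law i _ _ (overlap_of_mem hp (hsrc p))) hσ
  -- The chart `c (idx p)` varies with the point without any regularity; `hind` allows it to be
  -- replaced by one fixed chart of the family near a given point.
  let cov : CovariantDerivative 𝓘(ℝ, E m) (E m) (TangentSpace 𝓘(ℝ, E m) : N → Type _) :=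
    { toFun := fun σ p => covIn (c (idx p)) (G (idx p)) σ p
      isCovariantDerivativeOnUniv :=
        { add := fun hσ hτ _ => covIn_add (hsrc _) hσ hτ
          leibniz := fun hσ hg _ => covIn_leibniz (hsrc _) hσ hg rfl rfl } }
  have hloc : ∀ i, ∀ {x : E m}, x ∈ (c i).1.target →
      ∀ {σ : ∀ p : N, TangentSpace 𝓘(ℝ, E m) p},
      MDifferentiableAt 𝓘(ℝ, E m) 𝓘(ℝ, E m).tangent
        (fun p => (⟨p, σ p⟩ : TangentBundle 𝓘(ℝ, E m) N)) ((c i).1.symm x) → ∀ v : E m,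
      chartTo (c i) ((c i).1.symm x) (cov σ ((c i).1.symm x) v) =
        locCov (G i) (vfRep σ (c i)) x (chartTo (c i) ((c i).1.symm x) v) := fun i x hx σ hσ v => by
    have h1 : (cov σ ((c i).1.symm x) v : E m) = covIn (c i) (G i) σ ((c i).1.symm x) v :=
      congr($(hind i ((c i).1.map_target hx) hσ) v)
    rw [h1, covIn, (c i).1.right_inv hx]
    exact chartTo_chartFrom hx _
  have hsm : cov.ContMDiffCovariantDerivative ∞ := by
    refine ⟨⟨fun {σ} hσ => ?_⟩⟩
    rw [contMDiffOn_univ]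
    have hσ' : ContMDiff 𝓘(ℝ, E m) 𝓘(ℝ, E m).tangent ∞
        (fun p => (⟨p, σ p⟩ : TangentBundle 𝓘(ℝ, E m) N)) := by
      simpa [contMDiffOn_univ] using hσ
    intro p₀
    rw [contMDiffAt_hom_bundle]
    refine ⟨contMDiffAt_id, ?_⟩
    set i := idx p₀ with hi
    have hp₀ : p₀ ∈ (c i).1.source := hsrc p₀
    have h1 : ContDiffAt ℝ ∞ (locCov (G i) (vfRep σ (c i))) ((c i).1 p₀) := by
      have hx := (c i).1.map_source hp₀
      have hr : ContDiffAt ℝ ∞ (vfRep σ (c i)) ((c i).1 p₀) := contDiffAt_vfRep hx (hσ' _)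
      refine (hr.fderiv_right (m := ∞) (by simp)).add ?_
      have hGi := (hG i).contDiffAt ((c i).1.open_target.mem_nhds hx)
      exact ((ContinuousLinearMap.flipₗᵢ ℝ (E m) (E m) (E m)).contDiff.contDiffAt.comp _
        hGi).clm_apply hr
    have h2 := h1.contMDiffAt.comp p₀ (contMDiffAt_chart (c i) hp₀)
    refine h2.congr_of_eventuallyEq ?_
    filter_upwards [(c i).1.open_source.mem_nhds hp₀] with p hp
    have hp' : p ∈ (chartAt (E m) p₀).source := by rwa [← hidx]
    ext1 v
    -- The trivialisation of the tangent bundle at `p₀` is given by the tangent map of the preferred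
    -- chart there. For this reason the family is required to contain the preferred charts and not
    -- merely to cover.
    have hA := TangentBundle.continuousLinearMapAt_trivializationAt (I := 𝓘(ℝ, E m)) hp'
    have hB := TangentBundle.symmL_trivializationAt (I := 𝓘(ℝ, E m)) hp'
    have hA' : ∀ w : E m, (trivializationAt (E m) (TangentSpace 𝓘(ℝ, E m)) p₀).continuousLinearMapAt ℝ
        p w = chartTo (c i) p w := fun w => by
      rw [hA, chartTo, hidx]
      simp
      rfl
    have hB' : (trivializationAt (E m) (TangentSpace 𝓘(ℝ, E m)) p₀).symmL ℝ p v =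
        chartFrom (c i) ((c i).1 p) v := by
      rw [hB, chartFrom, hidx]
      simp
      rfl
    have e1 : (cov σ p ((trivializationAt (E m) (TangentSpace 𝓘(ℝ, E m)) p₀).symmL ℝ p v) : E m) =
        covIn (c i) (G i) σ p (chartFrom (c i) ((c i).1 p) v) :=
      (congrArg (cov σ p) hB').trans
        congr($(hind i hp ((hσ' p).mdifferentiableAt (by simp))) (chartFrom (c i) ((c i).1 p) v))
    change (trivializationAt (E m) (TangentSpace 𝓘(ℝ, E m)) p₀).continuousLinearMapAt ℝ p (cov σ p
      ((trivializationAt (E m) (TangentSpace 𝓘(ℝ, E m)) p₀).symmL ℝ p v)) = _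
    refine ((hA' _).trans (congrArg (chartTo (c i) p) e1)).trans ?_
    have h3 := chartTo_chartFrom ((c i).1.map_source hp)
    rw [(c i).1.left_inv hp] at h3
    simp only [covIn, ContinuousLinearMap.comp_apply, h3, Function.comp_apply]
  -- In coordinates the derivative terms of ∇_X Y - ∇_Y X form the Lie bracket, and the zeroth-order
  -- terms cancel by symmetry of the coefficients.
  have htor : cov.torsion = 0 := by
    rw [cov.torsion_eq_zero_iff]
    intro X Y p hX hY
    obtain ⟨i, x, hx, rfl⟩ : ∃ i, ∃ x, x ∈ (c i).1.target ∧ (c i).1.symm x = p :=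
      ⟨idx p, (c (idx p)).1 p, (c (idx p)).1.map_source (hsrc p), (c (idx p)).1.left_inv (hsrc p)⟩
    have h1 := hloc i hx hY (X ((c i).1.symm x))
    have h2 := hloc i hx hX (Y ((c i).1.symm x))
    have h3 := chartTo_mlieBracket hx hX hY
    have hinj : Function.Injective (chartTo (c i) ((c i).1.symm x)) := fun a b hab => by
      rw [← chartFrom_chartTo' hx a, hab, chartFrom_chartTo' hx]
    apply hinj
    refine Eq.trans ?_ h3.symm
    refine (map_sub (chartTo (c i) _) _ _).trans ?_
    rw [h1, h2]
    simp only [vfRep, locCov, add_apply, ContinuousLinearMap.flip_apply]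
    rw [hsymm i _ hx (chartTo (c i) _ (X _))]
    exact add_sub_add_right_eq_sub _ _ _
  refine ⟨⟨cov, hsm, fun p => congrFun htor p⟩, fun i x hx => bil_ext fun a b => ?_⟩
  rw [Connection.gam_sgl _ hx]
  have hd : MDifferentiableAt 𝓘(ℝ, E m) 𝓘(ℝ, E m).tangent
      (fun p => (⟨p, coordField (c i) b p⟩ : TangentBundle 𝓘(ℝ, E m) N)) ((c i).1.symm x) :=
    mdifferentiableAt_coordField b ((c i).1.map_target hx)
  refine (hloc i hx hd _).trans ?_
  have hrep : vfRep (N := N) (coordField (c i) b) (c i) =ᶠ[𝓝 x] fun _ => sgl b := by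
    filter_upwards [(c i).1.open_target.mem_nhds hx] with y hy
    exact vfRep_vfOf (V := fun _ => sgl b) hy
  rw [chartTo_chartFrom hx, locCov, hrep.fderiv_eq, hrep.eq_of_nhds]
  simp

end Gluing

/-! ### Bilinear maps with every vector an eigendirection -/

section Algebra

variable {m : ℕ}

/-- The trace-free part of the symmetric bilinear map `T` vanishes if `T(v, v)` is always a multiple
of `v`. -/
lemma traceFree_eq_zero {T : E m →L[ℝ] E m →L[ℝ] E m} (hs : ∀ u v, T u v = T v u)
    (h : ∀ v, ∃ μ : ℝ, T v v = μ • v) (k i j : Fin m) :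
    T (sgl i) (sgl j) k - 1 / ((m : ℝ) + 1) *
      ((if k = i then ∑ s, T (sgl s) (sgl j) s else 0) +
        if k = j then ∑ s, T (sgl i) (sgl s) s else 0) = 0 := by
  choose μ hμ using h
  -- Polarisation: the i- and j-components of the hypothesis at e_i + e_j and e_i - e_j force `μ` to
  -- be additive on e_i + e_j. The remaining components then determine T(e_i, e_j), which is
  -- therefore pure trace.
  have key : ∀ i j, (2 : ℝ) • T (sgl i) (sgl j) = μ (sgl j) • sgl i + μ (sgl i) • sgl j := by
    intro i j
    by_cases hij : i = j
    · subst hij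
      rw [hμ, two_smul]
    have h1 := hμ (sgl i + sgl j)
    have h2 := hμ (sgl i - sgl j)
    simp only [map_add, map_sub, add_apply, sub_apply, hμ (sgl i), hμ (sgl j),
      hs (sgl j) (sgl i)] at h1 h2
    have c1 : ∀ k, μ (sgl i) * sgl i k + T (sgl i) (sgl j) k +
        (T (sgl i) (sgl j) k + μ (sgl j) * sgl j k) =
        μ (sgl i + sgl j) * (sgl i k + sgl j k) := fun k => by
      have := congr($h1 k)
      simpa only [PiLp.add_apply, PiLp.smul_apply, smul_eq_mul] using this
    have c2 : ∀ k, μ (sgl i) * sgl i k - T (sgl i) (sgl j) k -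
        (T (sgl i) (sgl j) k - μ (sgl j) * sgl j k) =
        μ (sgl i - sgl j) * (sgl i k - sgl j k) := fun k => by
      have := congr($h2 k)
      simpa only [PiLp.add_apply, PiLp.sub_apply, PiLp.smul_apply, smul_eq_mul] using this
    have hji : ¬ j = i := fun h => hij h.symm
    have a1 := c1 i
    have a2 := c1 j
    have b1 := c2 i
    have b2 := c2 j
    simp [hij, hji] at a1 a2 b1 b2
    ext k
    have ck := c1 k
    simp only [PiLp.add_apply, PiLp.smul_apply, smul_eq_mul]
    have e : μ (sgl i + sgl j) = μ (sgl i) + μ (sgl j) := by linarith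
    rw [e] at ck
    linarith
  have kc : ∀ i j k, T (sgl i) (sgl j) k =
      (μ (sgl j) * sgl i k + μ (sgl i) * sgl j k) / 2 := fun i j k => by
    have := congr($(key i j) k)
    simp only [PiLp.add_apply, PiLp.smul_apply, smul_eq_mul] at this
    linarith
  have hm : (m : ℝ) + 1 ≠ 0 := by positivity
  have t1 : ∀ j, ∑ s, T (sgl s) (sgl j) s = ((m : ℝ) + 1) / 2 * μ (sgl j) := fun j => by
    simp only [kc, ← Finset.sum_div, Finset.sum_add_distrib]
    simp
    ring
  have t2 : ∀ i, ∑ s, T (sgl i) (sgl s) s = ((m : ℝ) + 1) / 2 * μ (sgl i) := fun i => by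
    simp only [fun s => hs (sgl i) (sgl s), t1]
  rw [t1, t2, kc]
  by_cases h1 : k = i <;> by_cases h2 : k = j <;> simp [h1, h2]
  all_goals (try split_ifs) <;> field_simp <;> ring_nf

end Algebra

/-! ### Geodesics, and the invariance of Π within a projective class -/

section Geodesics

variable {m : ℕ} {N : Type*} [TopologicalSpace N] [ChartedSpace (E m) N]
  [IsManifold 𝓘(ℝ, E m) ∞ N]

lemma deriv_coord {y : ℝ → E m} {t : ℝ} (hy : DifferentiableAt ℝ y t) (k : Fin m) :
    deriv (fun s => y s k) t = deriv y t k :=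
  ((EuclideanSpace.proj (𝕜 := ℝ) k).hasFDerivAt.comp_hasDerivAt t hy.hasDerivAt).deriv

lemma eventually_differentiableAt {y : ℝ → E m} {t : ℝ} (hy : ContDiffAt ℝ ∞ y t) :
    ∀ᶠ s in 𝓝 t, DifferentiableAt ℝ y s := by
  filter_upwards [(hy.of_le two_le_infty).eventually (by simp)] with s hs
  exact hs.differentiableAt (by simp)

lemma contDiffAt_deriv {y : ℝ → E m} {t : ℝ} (hy : ContDiffAt ℝ ∞ y t) :
    ContDiffAt ℝ ∞ (deriv y) t := by
  have : deriv y = fun s => fderiv ℝ y s 1 := by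
    funext s
    simp
  rw [this]
  exact (hy.fderiv_right (m := ∞) (by simp)).clm_apply contDiffAt_const

lemma geodesic_equation_iff (D : Connection m N) (e : Chart m N) {y : ℝ → E m} {t : ℝ}
    (hy : ContDiffAt ℝ ∞ y t) :
    (∀ k, deriv (deriv fun s => y s k) t + ∑ i, ∑ j, D.coeff e k i j (y t) *
        deriv (fun s => y s i) t * deriv (fun s => y s j) t = 0) ↔
      deriv (deriv y) t + D.gam e (y t) (deriv y t) (deriv y t) = 0 := by
  have h1 : ∀ k, (deriv fun s => y s k) =ᶠ[𝓝 t] fun s => deriv y s k := fun k => by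
    filter_upwards [eventually_differentiableAt hy] with s hs
    exact deriv_coord hs k
  have h2 : ∀ k, deriv (deriv fun s => y s k) t = deriv (deriv y) t k := fun k => by
    rw [(h1 k).deriv_eq, deriv_coord ((contDiffAt_deriv hy).differentiableAt (by simp))]
  have h3 : ∀ k, deriv (fun s => y s k) t = deriv y t k := fun k => (h1 k).eq_of_nhds
  simp only [h2, h3, Connection.gam]
  constructor
  · intro h
    ext k
    simpa [bil_apply] using h k
  · intro h k
    simpa [bil_apply] using congr($h k)

lemma contDiffAt_chart_comp {c : ℝ → N} {J : Set ℝ} (hJ : IsOpen J)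
    (hc : ContMDiffOn 𝓘(ℝ, ℝ) 𝓘(ℝ, E m) ∞ c J) (e : Chart m N) {t : ℝ} (ht : t ∈ J)
    (hte : c t ∈ e.1.source) : ContDiffAt ℝ ∞ (fun s => e.1 (c s)) t :=
  ((contMDiffAt_chart e hte).comp t (hc.contMDiffAt (hJ.mem_nhds ht))).contDiffAt

lemma deriv_comp_eventually {f : E m → E m} {y : ℝ → E m} {t : ℝ}
    (hf : ContDiffAt ℝ ∞ f (y t)) (hy : ContDiffAt ℝ ∞ y t) :
    deriv (f ∘ y) =ᶠ[𝓝 t] fun s => fderiv ℝ f (y s) (deriv y s) := by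
  filter_upwards [eventually_differentiableAt hy, hy.continuousAt.eventually
    ((hf.of_le two_le_infty).eventually (by simp))] with s hs hs'
  exact ((hs'.differentiableAt (by simp)).hasFDerivAt.comp_hasDerivAt s hs.hasDerivAt).deriv

lemma deriv_deriv_comp {f : E m → E m} {y : ℝ → E m} {t : ℝ}
    (hf : ContDiffAt ℝ ∞ f (y t)) (hy : ContDiffAt ℝ ∞ y t) :
    deriv (deriv (f ∘ y)) t = fderiv ℝ (fderiv ℝ f) (y t) (deriv y t) (deriv y t) +
      fderiv ℝ f (y t) (deriv (deriv y) t) := by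
  rw [(deriv_comp_eventually hf hy).deriv_eq]
  have h1 := ((hf.fderiv_right (m := ∞) (by simp)).differentiableAt
    (by simp)).hasFDerivAt.comp_hasDerivAt t (hy.differentiableAt (by simp)).hasDerivAt
  have h2 := ((contDiffAt_deriv hy).differentiableAt (by simp)).hasDerivAt
  exact (h1.clm_apply h2).deriv

/-- The chain rule contributes F''(y', y') to the acceleration in the new chart, and the
transformation law of the coefficients compensates for it. -/
lemma geodesic_equation_trans (D : Connection m N) {e e' : Chart m N} {y : ℝ → E m} {t : ℝ}
    (hy : ContDiffAt ℝ ∞ y t) (ht : y t ∈ overlap e e')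
    (h : deriv (deriv y) t + D.gam e (y t) (deriv y t) (deriv y t) = 0) :
    deriv (deriv (coordTrans e e' ∘ y)) t + D.gam e' ((coordTrans e e' ∘ y) t)
      (deriv (coordTrans e e' ∘ y) t) (deriv (coordTrans e e' ∘ y) t) = 0 := by
  have hf := (contDiffOn_trans e e').contDiffAt ((isOpen_overlap e e').mem_nhds ht)
  rw [deriv_deriv_comp hf hy, (deriv_comp_eventually hf hy).eq_of_nhds, D.gam_trans ht,
    eq_neg_of_add_eq_zero_left h, map_neg]
  simp only [Function.comp_apply]
  abel

/-- A solution of the geodesic equation in one chart is a geodesic. -/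
lemma isGeodesicOn_of_chart (D : Connection m N) (e : Chart m N) {y : ℝ → E m} {J : Set ℝ}
    (hJ : IsOpen J) (hy : ContDiffOn ℝ ∞ y J) (hmem : ∀ t ∈ J, y t ∈ e.1.target)
    (h : ∀ t ∈ J, deriv (deriv y) t + D.gam e (y t) (deriv y t) (deriv y t) = 0) :
    IsGeodesicOn D (fun t => e.1.symm (y t)) J := by
  refine ⟨fun t ht => ?_, fun e' t ht hte => ?_⟩
  · exact ((contMDiffAt_chart_symm e (hmem t ht)).comp t
      (hy.contDiffAt (hJ.mem_nhds ht)).contMDiffAt).contMDiffWithinAt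
  · have hyt := hy.contDiffAt (hJ.mem_nhds ht)
    have hx : y t ∈ overlap e e' := mem_overlap.2 ⟨hmem t ht, hte⟩
    have hf := (contDiffOn_trans e e').contDiffAt ((isOpen_overlap e e').mem_nhds hx)
    exact (geodesic_equation_iff D e' (y := coordTrans e e' ∘ y) (hf.comp t hyt)).2
      (geodesic_equation_trans D hyt hx (h t ht))

/-- Existence of geodesics. -/
lemma exists_geodesic [T2Space N] (D : Connection m N) (e : Chart m N) {x : E m}
    (hx : x ∈ e.1.target) (v : E m) :
    ∃ (y : ℝ → E m) (J : Set ℝ), IsOpen J ∧ J.OrdConnected ∧ 0 ∈ J ∧ ContDiffOn ℝ ∞ y J ∧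
      (∀ t ∈ J, y t ∈ e.1.target) ∧
      (∀ t ∈ J, deriv (deriv y) t + D.gam e (y t) (deriv y t) (deriv y t) = 0) ∧
      y 0 = x ∧ deriv y 0 = v := by
  -- The geodesic equation as a first-order system for position and velocity, to which
  -- Picard–Lindelöf applies. The interval is then shrunk so that the solution stays in the
  -- coordinate domain.
  let f : E m × E m → E m × E m := fun z => (z.2, -D.gam e z.1 z.2 z.2)
  have hf : ContDiffOn ℝ ∞ f (e.1.target ×ˢ univ) := by
    have h1 : ContDiffOn ℝ ∞ (fun z : E m × E m => D.gam e z.1) (e.1.target ×ˢ univ) :=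
      (D.contDiffOn_gam e).comp contDiffOn_fst fun z hz => hz.1
    exact contDiffOn_snd.prodMk ((h1.clm_apply contDiffOn_snd).clm_apply contDiffOn_snd).neg
  have hopen : IsOpen (e.1.target ×ˢ (univ : Set (E m))) := e.1.open_target.prod isOpen_univ
  have hf1 : ContDiffAt ℝ 1 f (x, v) :=
    (hf.contDiffAt (hopen.mem_nhds ⟨hx, mem_univ v⟩)).of_le (by simp)
  obtain ⟨α, hα0, ε, hε, hα⟩ :=
    hf1.exists_forall_mem_closedBall_exists_eq_forall_mem_Ioo_hasDerivAt₀ 0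
  have hcont : ContinuousAt α 0 := (hα 0 (by simp [hε])).continuousAt
  have hev : ∀ᶠ t in 𝓝 (0 : ℝ), α t ∈ e.1.target ×ˢ (univ : Set (E m)) ∧
      t ∈ Ioo (0 - ε) (0 + ε) :=
    (hcont.eventually (by rw [hα0]; exact hopen.mem_nhds ⟨hx, mem_univ v⟩)).and
      (isOpen_Ioo.mem_nhds (by simp [hε]))
  obtain ⟨δ, hδ, hball⟩ := Metric.eventually_nhds_iff_ball.1 hev
  rw [Real.ball_eq_Ioo] at hball
  set J := Ioo (0 - δ) (0 + δ) with hJ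
  have hJo : IsOpen J := isOpen_Ioo
  have hd : ∀ t ∈ J, HasDerivAt α (f (α t)) t := fun t ht => hα t (hball t ht).2
  -- Bootstrapping: if α is C^k then so is its derivative f ∘ α, hence α is C^(k+1).
  have hsm : ∀ k : ℕ, ContDiffOn ℝ k α J := by
    intro k
    induction k with
    | zero => exact contDiffOn_zero.2 fun t ht => (hd t ht).continuousAt.continuousWithinAt
    | succ k ih =>
      refine (contDiffOn_succ_iff_deriv_of_isOpen (n := (k : WithTop ℕ∞)) hJo).2
        ⟨fun t ht => (hd t ht).differentiableAt.differentiableWithinAt, by simp, ?_⟩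
      refine ((hf.of_le (by exact_mod_cast le_top)).comp ih fun t ht => (hball t ht).1).congr
        fun t ht => (hd t ht).deriv
  have hsm' : ContDiffOn ℝ ∞ α J := contDiffOn_infty.2 hsm
  have hy : ∀ t ∈ J, HasDerivAt (fun t => (α t).1) (α t).2 t := fun t ht => (hd t ht).fst
  have hv : ∀ t ∈ J, HasDerivAt (fun t => (α t).2) (-D.gam e (α t).1 (α t).2 (α t).2) t :=
    fun t ht => (hd t ht).snd
  have h0 : (0 : ℝ) ∈ J := by simp [hJ, hδ]
  refine ⟨fun t => (α t).1, J, hJo, ordConnected_Ioo, h0, contDiff_fst.comp_contDiffOn hsm',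
    fun t ht => (hball t ht).1.1, fun t ht => ?_, by simp [hα0], by rw [(hy 0 h0).deriv, hα0]⟩
  have h1 : deriv (fun t => (α t).1) =ᶠ[𝓝 t] fun t => (α t).2 := by
    filter_upwards [hJo.mem_nhds ht] with s hs
    exact (hy s hs).deriv
  rw [h1.deriv_eq, h1.eq_of_nhds, (hv t ht).deriv]
  simp

/-- If the geodesics of `D` are, up to reparametrisation, geodesics of `D'`, the difference of the
connections sends `(v, v)` to a multiple of `v`. -/
lemma GeodesicsReparam.gam_sub [T2Space N] {D D' : Connection m N} (h : GeodesicsReparam D D')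
    (e : Chart m N) {x : E m} (hx : x ∈ e.1.target) (v : E m) :
    ∃ μ : ℝ, (D'.gam e x - D.gam e x) v v = μ • v := by
  obtain ⟨y, J, hJo, hJc, h0, hy, hmem, hgeo, hy0, hv⟩ := exists_geodesic D e hx v
  obtain ⟨J', φ, ψ, hJ'o, -, hφ, hψ, mφ, mψ, inv, hc'⟩ :=
    h _ J hJo hJc (isGeodesicOn_of_chart D e hJo hy hmem hgeo)
  set s := ψ 0 with hs
  have hsJ : s ∈ J' := mψ h0
  have hφs : φ s = 0 := inv.2 h0
  have hφa := hφ.contDiffAt (hJ'o.mem_nhds hsJ)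
  have hψa := hψ.contDiffAt (hJo.mem_nhds h0)
  have hφd := (hφa.differentiableAt (by simp)).hasDerivAt
  -- The reparametrisation has the smooth inverse ψ, so by the chain rule its derivative cannot
  -- vanish.
  have hne : deriv φ s ≠ 0 := by
    intro hz
    have h1 := hφd.comp (0 : ℝ) (hψa.differentiableAt (by simp)).hasDerivAt
    have h2 : φ ∘ ψ =ᶠ[𝓝 0] id := by
      filter_upwards [hJo.mem_nhds h0] with t ht
      exact inv.2 ht
    have h3 := h1.congr_of_eventuallyEq h2.symm
    have h4 := h3.unique (hasDerivAt_id 0)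
    rw [hz] at h4
    simp at h4
  have hz : ((fun t => e.1.symm (y t)) ∘ φ) s ∈ e.1.source := e.1.map_target (hmem _ (mφ hsJ))
  have h1 := hc'.2 e s hsJ hz
  have hzc := contDiffAt_chart_comp hJ'o hc'.1 e hsJ hz
  have hzeq : (fun r => e.1 (((fun t => e.1.symm (y t)) ∘ φ) r)) =ᶠ[𝓝 s] fun r => y (φ r) := by
    filter_upwards [hJ'o.mem_nhds hsJ] with r hr
    exact e.1.right_inv (hmem _ (mφ hr))
  rw [geodesic_equation_iff D' e hzc] at h1
  have hd1 : deriv (fun r => y (φ r)) =ᶠ[𝓝 s] fun r => deriv φ r • deriv y (φ r) := by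
    filter_upwards [hJ'o.mem_nhds hsJ] with r hr
    have a1 := ((hφ.contDiffAt (hJ'o.mem_nhds hr)).differentiableAt (by simp)).hasDerivAt
    have a2 := ((hy.contDiffAt (hJo.mem_nhds (mφ hr))).differentiableAt (by simp)).hasDerivAt
    exact (a2.scomp r a1).deriv
  have hya : ContDiffAt ℝ ∞ y (φ s) := hφs ▸ hy.contDiffAt (hJo.mem_nhds h0)
  have hd2 : deriv (deriv fun r => y (φ r)) s =
      deriv φ s • (deriv φ s • deriv (deriv y) (φ s)) + deriv (deriv φ) s • deriv y (φ s) := by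
    rw [hd1.deriv_eq]
    have b1 : HasDerivAt (deriv φ) (deriv (deriv φ) s) s := by
      have : ContDiffAt ℝ ∞ (deriv φ) s := by
        have e1 : deriv φ = fun s => fderiv ℝ φ s 1 := by funext s; simp
        rw [e1]
        exact (hφa.fderiv_right (m := ∞) (by simp)).clm_apply contDiffAt_const
      exact (this.differentiableAt (by simp)).hasDerivAt
    have b2 := ((contDiffAt_deriv hya).differentiableAt (by simp)).hasDerivAt.scomp s hφd
    exact (b1.smul b2).deriv
  rw [hzeq.deriv.deriv_eq, hzeq.deriv.eq_of_nhds] at h1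
  change deriv (deriv fun r => y (φ r)) s + D'.gam e (e.1 (e.1.symm (y (φ s)))) _ _ = 0 at h1
  rw [hd2, hd1.eq_of_nhds, hφs, hy0, e.1.right_inv hx, hv] at h1
  have h2 := hgeo 0 h0
  rw [hy0, hv] at h2
  rw [eq_neg_of_add_eq_zero_left h2] at h1
  -- The equation for y ∘ φ with `D'` reads φ'² y'' + φ'' v + φ'² Γ'(v, v) = 0; inserting y'' =
  -- -Γ(v, v) and dividing by φ'² gives this factor.
  refine ⟨-(deriv (deriv φ) s / deriv φ s ^ 2), ?_⟩
  have h3 : deriv φ s ^ 2 • ((D'.gam e x - D.gam e x) v v) = -(deriv (deriv φ) s • v) := by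
    rw [eq_neg_iff_add_eq_zero, ← h1]
    simp only [sub_apply, map_smul, smul_apply, smul_sub, smul_smul, smul_neg, pow_two]
    abel
  rw [neg_smul, div_eq_inv_mul, mul_smul, ← smul_neg, ← h3, smul_smul, inv_mul_cancel₀ (by simpa),
    one_smul]

/-- The coefficients `Π` depend only on the projective class. -/
lemma GeodesicsReparam.projCoeff_eq [T2Space N] {D D' : Connection m N} (h : GeodesicsReparam D D')
    (e : Chart m N) {x : E m} (hx : x ∈ e.1.target) (k i j : Fin m) :
    D'.projCoeff e k i j x = D.projCoeff e k i j x := by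
  have h1 := traceFree_eq_zero (T := D'.gam e x - D.gam e x)
    (fun u v => by simp only [sub_apply, D.gam_symm hx u v, D'.gam_symm hx u v])
    (h.gam_sub e hx) k i j
  simp only [sub_apply, PiLp.sub_apply, Connection.gam_sgl_apply, Finset.sum_sub_distrib] at h1
  simp only [Connection.projCoeff]
  rw [← sub_eq_zero, ← h1]
  split_ifs <;> ring

lemma Connection.Mem.reparam {D D' : Connection m N} {P : ProjectiveClass m N} (h : D.Mem P)
    (h' : D'.Mem P) : GeodesicsReparam D D' :=
  (Quotient.exact (h.trans h'.symm)).1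

lemma Connection.Mem.projCoeff_eq [T2Space N] {D D' : Connection m N} {P : ProjectiveClass m N}
    (h : D.Mem P) (h' : D'.Mem P) (e : Chart m N) {x : E m} (hx : x ∈ e.1.target) (k i j : Fin m) :
    D'.projCoeff e k i j x = D.projCoeff e k i j x :=
  (h.reparam h').projCoeff_eq e hx k i j

lemma fderiv_coordTrans_eq_iff {e e' : Chart m N} {x : E m} (hx : x ∈ overlap e e') {u v : E m} :
    fderiv ℝ (coordTrans e e') x u = fderiv ℝ (coordTrans e e') x v ↔ u = v := by
  refine ⟨fun h => ?_, fun h => by rw [h]⟩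
  have h1 := chartFrom_fderiv_coordTrans hx u
  rw [h, chartFrom_fderiv_coordTrans hx v] at h1
  rw [← chartTo_chartFrom (mem_overlap.1 hx).1 u, ← h1, chartTo_chartFrom (mem_overlap.1 hx).1]

/-- Connections with the same coefficients in the charts of an atlas have the same coefficients in
all charts. -/
lemma Connection.gam_eq_of_atlas {D D' : Connection m N} {ι : Type*} (c : ι → Chart m N)
    (hc : ∀ p : N, ∃ i, p ∈ (c i).1.source)
    (h : ∀ i, ∀ x ∈ (c i).1.target, D.gam (c i) x = D'.gam (c i) x) (e : Chart m N) {x : E m}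
    (hx : x ∈ e.1.target) : D.gam e x = D'.gam e x := by
  obtain ⟨i, hi⟩ := hc (e.1.symm x)
  have hov : x ∈ overlap e (c i) := mem_overlap.2 ⟨hx, hi⟩
  ext1 u
  ext1 v
  have h1 := D.gam_trans hov u v
  rw [D'.gam_trans hov u v, h i _ (mem_overlap.1 (trans_mem hov)).1, sub_left_inj,
    fderiv_coordTrans_eq_iff hov] at h1
  exact h1.symm

/-- The geodesic equation involves the connection through its coefficients only, so the identity
serves as reparametrisation. -/
lemma GeodesicsReparam.of_gam_eq {D D' : Connection m N}
    (h : ∀ (e : Chart m N), ∀ x ∈ e.1.target, D.gam e x = D'.gam e x) : GeodesicsReparam D D' := by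
  intro c J hJ hJc hc
  refine ⟨J, id, id, hJ, hJc, contDiffOn_id, contDiffOn_id, mapsTo_id J, mapsTo_id J,
    ⟨fun _ _ => rfl, fun _ _ => rfl⟩, hc.1, fun e t ht hte k => ?_⟩
  have h1 := hc.2 e t ht hte k
  have h2 : ∀ i j, D.coeff e k i j (e.1 (c t)) = D'.coeff e k i j (e.1 (c t)) := fun i j => by
    rw [← D.gam_sgl_apply, ← D'.gam_sgl_apply, h e (e.1 (c t)) (e.1.map_source hte)]
  simp only [h2] at h1
  exact h1

lemma projSetoid_of_atlas {D D' : Connection m N} {ι : Type*} (c : ι → Chart m N)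
    (hc : ∀ p : N, ∃ i, p ∈ (c i).1.source)
    (h : ∀ i, ∀ x ∈ (c i).1.target, D.gam (c i) x = D'.gam (c i) x) : projSetoid m N D D' :=
  ⟨.of_gam_eq fun e _ hx => Connection.gam_eq_of_atlas c hc h e hx,
    .of_gam_eq fun e _ hx => (Connection.gam_eq_of_atlas c hc h e hx).symm⟩

end Geodesics

instance {m : ℕ} : NormedAddCommGroup (E m →L[ℝ] E m →L[ℝ] E m) :=
  ContinuousLinearMap.toNormedAddCommGroup

/-! ### Transformation laws of Π and of ∂_s Π^s_{ij} - Π^p_{qi} Π^q_{pj} -/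

section ProjectiveLaw

variable {n : ℕ} {M : Type*} [TopologicalSpace M] [ChartedSpace (E n) M]
  [IsManifold 𝓘(ℝ, E n) ∞ M]

/-- The coefficients `Π` in the chart `e`, as a bilinear map. -/
def Connection.pgam (D : Connection n M) (e : Chart n M) (x : E n) : E n →L[ℝ] E n →L[ℝ] E n :=
  bil fun k i j => D.projCoeff e k i j x

lemma Connection.pgam_sgl_apply (D : Connection n M) (e : Chart n M) (x : E n) (i j k : Fin n) :
    D.pgam e x (sgl i) (sgl j) k = D.projCoeff e k i j x := bil_sgl _ _ _ _

/-- A coordinate-free form in which both contractions of Γ are traces of the same kind; the two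
possible contractions agree by symmetry of the coefficients. -/
lemma Connection.pgam_apply (D : Connection n M) {e : Chart n M} {x : E n} (hx : x ∈ e.1.target)
    (u v : E n) : D.pgam e x u v = D.gam e x u v -
      (1 / ((n : ℝ) + 1)) • (tr (D.gam e x v) • u + tr (D.gam e x u) • v) := by
  have h : D.pgam e x = D.gam e x - (1 / ((n : ℝ) + 1)) •
      ((ContinuousLinearMap.smulRightL ℝ (E n) (E n) (tr.comp (D.gam e x))).flip +
        ContinuousLinearMap.smulRightL ℝ (E n) (E n) (tr.comp (D.gam e x))).flip := by
    refine bil_ext fun i j => ?_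
    ext k
    rw [pgam_sgl_apply, projCoeff]
    simp only [sub_apply, smul_apply, add_apply, ContinuousLinearMap.flip_apply, PiLp.sub_apply,
      PiLp.smul_apply, PiLp.add_apply, D.gam_sgl_apply, smul_eq_mul,
      ContinuousLinearMap.smulRightL_apply_apply, ContinuousLinearMap.smulRight_apply,
      ContinuousLinearMap.comp_apply, tr_apply]
    have h1 : ∀ s, D.coeff e s s j x = D.coeff e s j s x := fun s => by
      rw [← D.gam_sgl_apply, ← D.gam_sgl_apply, D.gam_symm hx]
    simp only [h1]
    by_cases hi : k = i <;> by_cases hj : k = j <;> simp [hi, hj]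
  rw [h]
  simp only [sub_apply, smul_apply, add_apply, ContinuousLinearMap.flip_apply,
      ContinuousLinearMap.smulRightL_apply_apply, ContinuousLinearMap.smulRight_apply,
      ContinuousLinearMap.comp_apply]

lemma Connection.pgam_symm (D : Connection n M) {e : Chart n M} {x : E n} (hx : x ∈ e.1.target)
    (u v : E n) : D.pgam e x u v = D.pgam e x v u := by
  rw [D.pgam_apply hx, D.pgam_apply hx, D.gam_symm hx, add_comm (tr (D.gam e x v) • u)]

/-- The correction contributes 1/(n+1) times tr Γ(u) once from the rank-one term and n times from
the identity. -/
lemma Connection.tr_pgam (D : Connection n M) {e : Chart n M} {x : E n} (hx : x ∈ e.1.target)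
    (u : E n) : tr (D.pgam e x u) = 0 := by
  have h : D.pgam e x u = D.gam e x u - (1 / ((n : ℝ) + 1)) •
      ((tr.comp (D.gam e x)).smulRight u + tr (D.gam e x u) • ContinuousLinearMap.id ℝ (E n)) := by
    ext1 v
    rw [D.pgam_apply hx]
    simp
  have hn : (n : ℝ) + 1 ≠ 0 := by positivity
  rw [h, map_sub, map_smul, map_add, map_smul, tr_smulRight, tr_id]
  simp only [ContinuousLinearMap.comp_apply, smul_eq_mul]
  field_simp
  ring

lemma contDiffAt_coordTrans {e e' : Chart n M} {x : E n} (hx : x ∈ overlap e e') :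
    ContDiffAt ℝ ∞ (coordTrans e e') x :=
  (contDiffOn_trans e e').contDiffAt ((isOpen_overlap e e').mem_nhds hx)

lemma fderiv_coordTrans_comp_self {e e' : Chart n M} {x : E n} (hx : x ∈ overlap e e') :
    (fderiv ℝ (coordTrans e' e) (coordTrans e e' x)).comp (fderiv ℝ (coordTrans e e') x) =
      .id ℝ _ := by
  ext1 u
  have hy := trans_mem hx
  rw [ContinuousLinearMap.comp_apply, fderiv_coordTrans hy, ContinuousLinearMap.comp_apply,
    chartFrom_fderiv_coordTrans hx, symm_coordTrans hx, chartTo_chartFrom (mem_overlap.1 hx).1]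
  rfl

lemma fderiv_coordTrans_comp_self' {e e' : Chart n M} {x : E n} (hx : x ∈ overlap e e') :
    (fderiv ℝ (coordTrans e e') x).comp (fderiv ℝ (coordTrans e' e) (coordTrans e e' x)) =
      .id ℝ _ := by
  have h := fderiv_coordTrans_comp_self (trans_mem hx)
  rwa [coordTrans_coordTrans hx] at h

/-- The logarithm of the Jacobian of a change of coordinates. -/
def logJac (e e' : Chart n M) (x : E n) : ℝ := Real.log (jac e e' x)

/-- The logarithmic derivative of the Jacobian. -/
lemma fderiv_logJac {e e' : Chart n M} {x : E n} (hx : x ∈ overlap e e') (u : E n) :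
    fderiv ℝ (logJac e e') x u =
      tr ((fderiv ℝ (coordTrans e' e) (coordTrans e e' x)).comp
        (fderiv ℝ (fderiv ℝ (coordTrans e e')) x u)) := by
  have h := (hasFDerivAt_log_abs_det (fderiv_coordTrans_comp_self' hx)
    (fderiv_coordTrans_comp_self hx)).comp x (differentiableAt_fderiv_coordTrans hx).hasFDerivAt
  have h1 : fderiv ℝ (logJac e e') x = _ := h.fderiv
  rw [h1]
  rfl

/-- Tracing the law for Γ and applying Jacobi's formula shows that tr Γ changes by the derivative of
log J. Removing the trace part from the law for Γ leaves precisely these derivatives as a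
correction. -/
lemma Connection.pgam_trans (D : Connection n M) {e e' : Chart n M} {x : E n}
    (hx : x ∈ overlap e e') (u v : E n) :
    fderiv ℝ (fderiv ℝ (coordTrans e e')) x u v =
      fderiv ℝ (coordTrans e e') x (D.pgam e x u v) -
        D.pgam e' (coordTrans e e' x) (fderiv ℝ (coordTrans e e') x u)
          (fderiv ℝ (coordTrans e e') x v) +
      (1 / ((n : ℝ) + 1)) • (fderiv ℝ (logJac e e') x u • fderiv ℝ (coordTrans e e') x v +
        fderiv ℝ (logJac e e') x v • fderiv ℝ (coordTrans e e') x u) := by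
  have hy := trans_mem hx
  have h1 : ∀ w, fderiv ℝ (logJac e e') x w = tr (D.gam e x w) -
      tr (D.gam e' (coordTrans e e' x) (fderiv ℝ (coordTrans e e') x w)) := fun w => by
    have h2 : fderiv ℝ (fderiv ℝ (coordTrans e e')) x w =
        (fderiv ℝ (coordTrans e e') x).comp (D.gam e x w) -
          (D.gam e' (coordTrans e e' x) (fderiv ℝ (coordTrans e e') x w)).comp
            (fderiv ℝ (coordTrans e e') x) := by
      ext1 z
      exact D.gam_trans hx w z
    rw [fderiv_logJac hx, h2, ContinuousLinearMap.comp_sub, map_sub,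
      tr_conj (fderiv_coordTrans_comp_self' hx), ← ContinuousLinearMap.comp_assoc,
      fderiv_coordTrans_comp_self hx, ContinuousLinearMap.id_comp]
  rw [D.gam_trans hx, D.pgam_apply (mem_overlap.1 hx).1, D.pgam_apply (mem_overlap.1 hy).1, h1, h1]
  simp only [map_sub, map_smul, map_add, sub_smul]
  module

lemma Connection.contDiffOn_projCoeff [T2Space M] (D : Connection n M) (e : Chart n M)
    (k i j : Fin n) : ContDiffOn ℝ ∞ (D.projCoeff e k i j) e.1.target := by
  unfold Connection.projCoeff
  refine (D.contDiffOn_coeff e k i j).sub (contDiffOn_const.mul (ContDiffOn.add ?_ ?_)) <;>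
  split_ifs <;> first
    | exact ContDiffOn.sum fun s _ => D.contDiffOn_coeff e _ _ _
    | exact contDiffOn_const

lemma Connection.contDiffOn_pgam [T2Space M] (D : Connection n M) (e : Chart n M) :
    ContDiffOn ℝ ∞ (D.pgam e) e.1.target :=
  contDiffOn_bil fun k i j => D.contDiffOn_projCoeff e k i j

lemma Connection.differentiableAt_pgam [T2Space M] (D : Connection n M) {e : Chart n M} {x : E n}
    (hx : x ∈ e.1.target) : DifferentiableAt ℝ (D.pgam e) x :=
  ((D.contDiffOn_pgam e).contDiffAt (e.1.open_target.mem_nhds hx)).differentiableAt (by simp)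

lemma contDiffOn_pd {f : E n → ℝ} {s : Set (E n)} (hf : ContDiffOn ℝ ∞ f s) (hs : IsOpen s)
    (i : Fin n) : ContDiffOn ℝ ∞ (pd i f) s :=
  (hf.fderiv_of_isOpen hs (m := ∞) (by simp)).clm_apply contDiffOn_const

lemma Connection.contDiffOn_projRicci [T2Space M] (D : Connection n M) (e : Chart n M)
    (i j : Fin n) : ContDiffOn ℝ ∞ (D.projRicci e i j) e.1.target := by
  unfold Connection.projRicci
  refine (ContDiffOn.sum fun s _ => ?_).sub (ContDiffOn.sum fun p _ => ContDiffOn.sum fun q _ => ?_)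
  · exact contDiffOn_pd (D.contDiffOn_projCoeff e s i j) e.1.open_target s
  · exact (D.contDiffOn_projCoeff e p q i).mul (D.contDiffOn_projCoeff e q p j)

/-- The quantity `∂_s Π^s_{ij} - Π^p_{qi} Π^q_{pj}`, as a bilinear form. -/
def Connection.ricci (D : Connection n M) (e : Chart n M) (x : E n) (u v : E n) : ℝ :=
  tr (((fderiv ℝ (D.pgam e) x).flip u).flip v) - tr ((D.pgam e x u).comp (D.pgam e x v))

set_option synthInstance.maxHeartbeats 400000 in
set_option maxHeartbeats 1000000 in
lemma Connection.ricci_sgl [T2Space M] (D : Connection n M) {e : Chart n M} {x : E n}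
    (hx : x ∈ e.1.target) (i j : Fin n) :
    D.ricci e x (sgl i) (sgl j) = D.projRicci e i j x := by
  have h1 : ∀ s, pd s (D.projCoeff e s i j) x =
      fderiv ℝ (D.pgam e) x (sgl s) (sgl i) (sgl j) s := fun s => by
    have h2 : D.projCoeff e s i j = fun y => D.pgam e y (sgl i) (sgl j) s :=
      funext fun y => (D.pgam_sgl_apply e y i j s).symm
    have h3 := ((D.differentiableAt_pgam hx).hasFDerivAt.clm_apply
      (hasFDerivAt_const (sgl i) x)).clm_apply (hasFDerivAt_const (sgl j) x)
    have h4 := ((EuclideanSpace.proj (𝕜 := ℝ) s).hasFDerivAt.comp x h3).fderiv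
    have h5 : fderiv ℝ (fun y => D.pgam e y (sgl i) (sgl j) s) x = _ := h4
    rw [pd, h2, h5]
    simp
  have h6 : tr ((D.pgam e x (sgl i)).comp (D.pgam e x (sgl j))) =
      ∑ p, ∑ q, D.projCoeff e p q i x * D.projCoeff e q p j x := by
    rw [tr_apply]
    refine Finset.sum_congr rfl fun p _ => ?_
    rw [ContinuousLinearMap.comp_apply, map_eq_sum (D.pgam e x (sgl i))]
    simp only [WithLp.ofLp_sum, Finset.sum_apply, PiLp.smul_apply, D.pgam_symm hx (sgl i),
      D.pgam_symm hx (sgl j), D.pgam_sgl_apply, smul_eq_mul]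
    exact Finset.sum_congr rfl fun q _ => mul_comm _ _
  rw [Connection.ricci, h6, Connection.projRicci, tr_apply]
  simp only [h1, ContinuousLinearMap.flip_apply]

/-- The form is defined by traces as a bare function of two vectors. Once its bilinearity is
checked, its values on basis vectors determine it. -/
lemma Connection.ricci_eq_sum [T2Space M] (D : Connection n M) {e : Chart n M} {x : E n}
    (hx : x ∈ e.1.target) (u v : E n) :
    D.ricci e x u v = ∑ i, ∑ j, D.projRicci e i j x * u i * v j := by
  have h : ∀ (a : ℝ) (w w' v : E n), D.ricci e x (a • w + w') v =
      a * D.ricci e x w v + D.ricci e x w' v := fun a w w' v => by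
    simp only [Connection.ricci, map_add, map_smul, ContinuousLinearMap.flip_add,
      ContinuousLinearMap.flip_smul, ContinuousLinearMap.add_comp, ContinuousLinearMap.smul_comp,
      add_apply, smul_apply, smul_eq_mul]
    ring
  have h' : ∀ (a : ℝ) (w w' v : E n), D.ricci e x v (a • w + w') =
      a * D.ricci e x v w + D.ricci e x v w' := fun a w w' v => by
    simp only [Connection.ricci, map_add, map_smul, ContinuousLinearMap.comp_add,
      ContinuousLinearMap.comp_smul, smul_eq_mul]
    ring
  let R : E n →ₗ[ℝ] E n →ₗ[ℝ] ℝ := LinearMap.mk₂ ℝ (D.ricci e x)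
    (fun a b c => by simpa using h 1 a b c)
    (fun r a c => by
      have h0 : D.ricci e x 0 c = 0 := by simpa using h 1 0 0 c
      simpa [h0] using h r a 0 c)
    (fun a b c => by simpa using h' 1 b c a)
    (fun r a c => by
      have h0 : D.ricci e x a 0 = 0 := by simpa using h' 1 0 0 a
      simpa [h0] using h' r c 0 a)
  change R u v = _
  rw [map_eq_sum R u, LinearMap.sum_apply]
  refine Finset.sum_congr rfl fun i _ => ?_
  rw [LinearMap.smul_apply, map_eq_sum (R (sgl i)) v, Finset.smul_sum]
  refine Finset.sum_congr rfl fun j _ => ?_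
  change u i • v j • D.ricci e x (sgl i) (sgl j) = _
  rw [D.ricci_sgl hx]
  simp only [smul_eq_mul]
  ring

lemma contDiffAt_logJac {e e' : Chart n M} {x : E n} (hx : x ∈ overlap e e') :
    ContDiffAt ℝ ∞ (logJac e e') x :=
  (contDiffOn_log_jac e e').contDiffAt ((isOpen_overlap e e').mem_nhds hx)

lemma fderiv_fderiv_symm {F : Type*} [NormedAddCommGroup F] [NormedSpace ℝ F] {f : E n → F}
    {x : E n} (hf : ContDiffAt ℝ ∞ f x) (u v : E n) :
    fderiv ℝ (fderiv ℝ f) x u v = fderiv ℝ (fderiv ℝ f) x v u :=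
  (hf.isSymmSndFDerivAt (by simpa using two_le_infty)) u v

set_option synthInstance.maxHeartbeats 400000 in
set_option maxHeartbeats 1000000 in
/-- The transformation law of `∂_s Π^s_{ij} - Π^p_{qi} Π^q_{pj}`. -/
lemma Connection.ricci_trans [T2Space M] (hn : 1 < n) (D : Connection n M) {e e' : Chart n M}
    {x : E n} (hx : x ∈ overlap e e') (u v : E n) :
    fderiv ℝ (fderiv ℝ (logJac e e')) x u v =
      fderiv ℝ (logJac e e') x (D.pgam e x u v) +
        ((n : ℝ) + 1) / ((n : ℝ) - 1) * D.ricci e x u v -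
        ((n : ℝ) + 1) / ((n : ℝ) - 1) * D.ricci e' (coordTrans e e' x)
          (fderiv ℝ (coordTrans e e') x u) (fderiv ℝ (coordTrans e e') x v) +
      1 / ((n : ℝ) + 1) * (fderiv ℝ (logJac e e') x u * fderiv ℝ (logJac e e') x v) := by
  have hxt := (mem_overlap.1 hx).1
  have hyt := (mem_overlap.1 (trans_mem hx)).1
  have hF := contDiffAt_coordTrans hx
  have hF1 : ContDiffAt ℝ ∞ (fderiv ℝ (coordTrans e e')) x := hF.fderiv_right (m := ∞) (by simp)
  have hF2 : ContDiffAt ℝ ∞ (fderiv ℝ (fderiv ℝ (coordTrans e e'))) x :=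
    hF1.fderiv_right (m := ∞) (by simp)
  have hL := contDiffAt_logJac hx
  have hL1 : ContDiffAt ℝ ∞ (fderiv ℝ (logJac e e')) x := hL.fderiv_right (m := ∞) (by simp)
  have d0 := (differentiableAt_trans hx).hasFDerivAt
  have d1 := (hF1.differentiableAt (by simp)).hasFDerivAt
  have d2 := (hF2.differentiableAt (by simp)).hasFDerivAt
  have dL := (hL1.differentiableAt (by simp)).hasFDerivAt
  have dP := (D.differentiableAt_pgam hxt).hasFDerivAt
  have dQ : HasFDerivAt (fun y => D.pgam e' (coordTrans e e' y))
      ((fderiv ℝ (D.pgam e') (coordTrans e e' x)).comp (fderiv ℝ (coordTrans e e') x)) x :=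
    HasFDerivAt.comp (g := D.pgam e') x (D.differentiableAt_pgam hyt).hasFDerivAt d0
  have hov := (isOpen_overlap e e').mem_nhds hx
  set A := fderiv ℝ (coordTrans e e') x with hA
  set B := fderiv ℝ (coordTrans e' e) (coordTrans e e' x) with hB
  have hAB : A.comp B = .id ℝ _ := fderiv_coordTrans_comp_self' hx
  have hBA : B.comp A = .id ℝ _ := fderiv_coordTrans_comp_self hx
  -- The law `Connection.pgam_trans`, valid on the whole overlap, differentiated in the direction
  -- `w`.
  have law' : ∀ w u v, fderiv ℝ (fderiv ℝ (fderiv ℝ (coordTrans e e'))) x w u v =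
      fderiv ℝ (fderiv ℝ (coordTrans e e')) x w (D.pgam e x u v) +
      A (fderiv ℝ (D.pgam e) x w u v) -
      fderiv ℝ (D.pgam e') (coordTrans e e' x) (A w) (A u) (A v) -
      D.pgam e' (coordTrans e e' x) (fderiv ℝ (fderiv ℝ (coordTrans e e')) x w u) (A v) -
      D.pgam e' (coordTrans e e' x) (A u) (fderiv ℝ (fderiv ℝ (coordTrans e e')) x w v) +
      (1 / ((n : ℝ) + 1)) • (fderiv ℝ (fderiv ℝ (logJac e e')) x w u • A v +
        fderiv ℝ (logJac e e') x u • fderiv ℝ (fderiv ℝ (coordTrans e e')) x w v +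
        fderiv ℝ (fderiv ℝ (logJac e e')) x w v • A u +
        fderiv ℝ (logJac e e') x v • fderiv ℝ (fderiv ℝ (coordTrans e e')) x w u) := by
    intro w u v
    have cst : ∀ z : E n, HasFDerivAt (fun _ : E n => z) (0 : E n →L[ℝ] E n) x :=
      fun z => hasFDerivAt_const z x
    have l := (d2.clm_apply (cst u)).clm_apply (cst v)
    have r1 := d1.clm_apply ((dP.clm_apply (cst u)).clm_apply (cst v))
    have r2 := (dQ.clm_apply (d1.clm_apply (cst u))).clm_apply (d1.clm_apply (cst v))
    have r3 := ((dL.clm_apply (cst u)).smul (d1.clm_apply (cst v))).add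
      ((dL.clm_apply (cst v)).smul (d1.clm_apply (cst u)))
    have r := (r1.sub r2).add (r3.const_smul (1 / ((n : ℝ) + 1)))
    have heq := l.unique (r.congr_of_eventuallyEq (by
      filter_upwards [hov] with y hy
      exact D.pgam_trans hy u v))
    have := congr($heq w)
    simp only [add_apply, sub_apply, ContinuousLinearMap.comp_apply, smul_apply,
      ContinuousLinearMap.flip_apply, ContinuousLinearMap.smulRight_apply, zero_apply, map_zero,
      zero_add, ← hA] at this
    rw [this]
    simp only [smul_add]
    abel
  have hL2 : ∀ z u, fderiv ℝ (fderiv ℝ (logJac e e')) x z u =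
      tr (B.comp (fderiv ℝ (fderiv ℝ (fderiv ℝ (coordTrans e e'))) x z u)) -
      tr ((B.comp (fderiv ℝ (fderiv ℝ (coordTrans e e')) x z)).comp
        (B.comp (fderiv ℝ (fderiv ℝ (coordTrans e e')) x u))) := by
    intro z u
    have dB : DifferentiableAt ℝ (fun y => fderiv ℝ (coordTrans e' e) (coordTrans e e' y)) x :=
      ((differentiableAt_fderiv_coordTrans (trans_mem hx)).comp x (differentiableAt_trans hx))
    set B1 := fderiv ℝ (fun y => fderiv ℝ (coordTrans e' e) (coordTrans e e' y)) x with hB1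
    have hB' := dB.hasFDerivAt
    -- The derivative of the inverse Jacobian matrix, obtained by differentiating B A = 1. It
    -- accounts for the quadratic trace in the second derivative of log J.
    have e1 : B1 z = -(B.comp (fderiv ℝ (fderiv ℝ (coordTrans e e')) x z)).comp B := by
      have c1 := hB'.clm_comp d1
      have c2 : HasFDerivAt (fun _ : E n => ContinuousLinearMap.id ℝ (E n))
          (0 : E n →L[ℝ] E n →L[ℝ] E n) x := hasFDerivAt_const _ _
      have c3 := c1.unique (c2.congr_of_eventuallyEq (by
        filter_upwards [hov] with y hy
        exact fderiv_coordTrans_comp_self hy))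
      have c4 : B.comp (fderiv ℝ (fderiv ℝ (coordTrans e e')) x z) + (B1 z).comp A = 0 :=
        congr($c3 z)
      have c5 : (B1 z).comp A = -(B.comp (fderiv ℝ (fderiv ℝ (coordTrans e e')) x z)) :=
        eq_neg_of_add_eq_zero_right c4
      rw [← ContinuousLinearMap.neg_comp, ← c5, ContinuousLinearMap.comp_assoc, hAB,
        ContinuousLinearMap.comp_id]
    have cu : HasFDerivAt (fun _ : E n => u) (0 : E n →L[ℝ] E n) x := hasFDerivAt_const u x
    have l := dL.clm_apply cu
    have r := (tr (m := n)).hasFDerivAt.comp x (hB'.clm_comp (d2.clm_apply cu))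
    have heq := l.unique (r.congr_of_eventuallyEq (by
      filter_upwards [hov] with y hy
      exact fderiv_logJac hy u))
    have h := congr($heq z)
    simp only [add_apply, ContinuousLinearMap.comp_apply, ContinuousLinearMap.flip_apply,
      zero_apply, map_zero, zero_add, map_add, ContinuousLinearMap.compL_apply, ← hB, ← hB1,
      e1, map_neg] at h
    rw [h, ← sub_eq_add_neg]
    rfl
  have hlaw := projRicci_law_aux hAB hBA (F2 := fderiv ℝ (fderiv ℝ (coordTrans e e')) x)
    (P := D.pgam e x) (Pb := D.pgam e' (coordTrans e e' x))
    (F3 := fderiv ℝ (fderiv ℝ (fderiv ℝ (coordTrans e e'))) x) (dP := fderiv ℝ (D.pgam e) x)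
    (dPb := fderiv ℝ (D.pgam e') (coordTrans e e' x)) (L1 := fderiv ℝ (logJac e e') x)
    (L2 := fderiv ℝ (fderiv ℝ (logJac e e')) x) (ε := 1 / ((n : ℝ) + 1))
    (D.pgam_trans hx) law' (fderiv_logJac hx) hL2 (fderiv_fderiv_symm hF)
    (fun w u v => by rw [fderiv_fderiv_symm hF1 w u])
    (fun w u v => by
      have c : ∀ a b : E n, HasFDerivAt
          (fun y => fderiv ℝ (fderiv ℝ (coordTrans e e')) y a b) _ x := fun a b =>
        (d2.clm_apply (hasFDerivAt_const a x)).clm_apply (hasFDerivAt_const b x)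
      have h := (c u v).unique ((c v u).congr_of_eventuallyEq (by
        filter_upwards [hov] with y hy
        exact fderiv_fderiv_symm (contDiffAt_coordTrans hy) u v))
      have := congr($h w)
      simpa using this)
    (D.pgam_symm hyt) (D.pgam_symm hxt) (fderiv_fderiv_symm hL) (D.tr_pgam hxt) u v
  have hn1 : (n : ℝ) + 1 ≠ 0 := by positivity
  have hn2 : (n : ℝ) - 1 ≠ 0 := by
    have : (1 : ℝ) < n := by exact_mod_cast hn
    linarith
  change _ = _ + D.ricci e x u v - D.ricci e' (coordTrans e e' x) (A u) (A v) + _ at hlaw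
  -- For ε = 1/(n+1) both constants of the pointwise identity are multiples of (n-1)/(n+1), which is
  -- nonzero for n > 1. Dividing by it leaves the coefficients (n+1)/(n-1) and 1/(n+1).
  have e2 : (1 : ℝ) - 2 * (1 / ((n : ℝ) + 1)) = ((n : ℝ) - 1) / ((n : ℝ) + 1) := by
    field_simp
    ring
  have e3 : 2 * (1 / ((n : ℝ) + 1)) - (1 / ((n : ℝ) + 1)) ^ 2 * ((n : ℝ) + 3) =
      ((n : ℝ) - 1) / ((n : ℝ) + 1) * (1 / ((n : ℝ) + 1)) := by
    field_simp
    ring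
  rw [e2, e3] at hlaw
  have hc : ((n : ℝ) - 1) / ((n : ℝ) + 1) ≠ 0 := div_ne_zero hn2 hn1
  apply mul_left_cancel₀ hc
  rw [hlaw]
  have e4 : ((n : ℝ) - 1) / ((n : ℝ) + 1) * (((n : ℝ) + 1) / ((n : ℝ) - 1)) = 1 := by
    field_simp
  linear_combination (D.ricci e' (coordTrans e e' x) (A u) (A v) - D.ricci e x u v) * e4

end ProjectiveLaw

/-! ### Splitting off the coordinate x⁰ -/

section Coordinates

variable {n : ℕ}

/-- The projection `(x⁰, x¹, …, xⁿ) ↦ (x¹, …, xⁿ)`. -/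
def tl : E (n + 1) →L[ℝ] E n :=
  (ContinuousLinearMap.fst ℝ (E n) ℝ).comp (consL n).symm.toContinuousLinearMap

/-- The projection `(x⁰, x¹, …, xⁿ) ↦ x⁰`. -/
def hd : E (n + 1) →L[ℝ] ℝ :=
  (ContinuousLinearMap.snd ℝ (E n) ℝ).comp (consL n).symm.toContinuousLinearMap

@[simp] lemma tl_ext0 (t : ℝ) (x : E n) : tl (ext0 t x) = x := by
  simp [tl, ← consL_apply]

@[simp] lemma hd_ext0 (t : ℝ) (x : E n) : hd (ext0 t x) = t := by
  simp [hd, ← consL_apply]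

lemma ext0_hd_tl (z : E (n + 1)) : ext0 (hd z) (tl z) = z := by
  simp [hd, tl, ← consL_apply]

@[simp] lemma ext0_zero (t : ℝ) (x : E n) : ext0 t x 0 = t := rfl

@[simp] lemma ext0_succ (t : ℝ) (x : E n) (i : Fin n) : ext0 t x i.succ = x i := rfl

lemma tl_apply (z : E (n + 1)) (i : Fin n) : tl z i = z i.succ := by
  conv_rhs => rw [← ext0_hd_tl z]
  rfl

lemma hd_apply (z : E (n + 1)) : hd z = z 0 := by
  conv_rhs => rw [← ext0_hd_tl z]
  rfl

lemma ext0_sub (s t : ℝ) (x y : E n) : ext0 s x - ext0 t y = ext0 (s - t) (x - y) := by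
  simp only [← consL_apply, ← map_sub]
  rfl

lemma sgl_zero_eq : (sgl 0 : E (n + 1)) = ext0 1 0 := by
  ext k
  refine Fin.cases ?_ (fun i => ?_) k <;> simp

lemma sgl_succ_eq (i : Fin n) : (sgl i.succ : E (n + 1)) = ext0 0 (sgl i) := by
  ext k
  refine Fin.cases ?_ (fun j => ?_) k <;> simp

end Coordinates

/-! ### The Thomas connection and the induced projective class -/

section Thomas

variable {n : ℕ} {M : Type*} [TopologicalSpace M] [ChartedSpace (E n) M]
  [IsManifold 𝓘(ℝ, E n) ∞ M]

lemma mem_thomas_target {e : Chart n M} {z : E (n + 1)} :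
    z ∈ (adapted e).1.target ↔ tl z ∈ e.1.target := by
  conv_lhs => rw [← ext0_hd_tl z]
  exact ext0_mem_target

lemma mem_thomas_overlap {e e' : Chart n M} {z : E (n + 1)} :
    z ∈ overlap (adapted e) (adapted e') ↔ tl z ∈ overlap e e' := by
  rw [mem_overlap, mem_overlap, mem_thomas_target]
  refine and_congr_right fun _ => ?_
  conv_lhs => rw [← ext0_hd_tl z]
  change _ ∈ (thomasChart e').source ↔ _
  rw [thomasChart_source]
  rfl

lemma coordTrans_adapted {e e' : Chart n M} {z : E (n + 1)}
    (hz : z ∈ overlap (adapted e) (adapted e')) :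
    coordTrans (adapted e) (adapted e') z =
      ext0 (hd z + logJac e e' (tl z)) (coordTrans e e' (tl z)) := by
  conv_lhs => rw [← ext0_hd_tl z]
  exact thomas_trans (mem_thomas_overlap.1 hz)

lemma hasFDerivAt_coordTrans_adapted {e e' : Chart n M} {z : E (n + 1)}
    (hz : z ∈ overlap (adapted e) (adapted e')) :
    HasFDerivAt (coordTrans (adapted e) (adapted e'))
      ((consL n).toContinuousLinearMap.comp
        (((fderiv ℝ (coordTrans e e') (tl z)).comp tl).prod
          (hd + (fderiv ℝ (logJac e e') (tl z)).comp tl))) z := by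
  have hx := mem_thomas_overlap.1 hz
  have h1 := (differentiableAt_trans hx).hasFDerivAt.comp z (tl (n := n)).hasFDerivAt
  have h2 := ((contDiffAt_logJac hx).differentiableAt (by simp)).hasFDerivAt.comp z
    (tl (n := n)).hasFDerivAt
  have h3 := (consL n).toContinuousLinearMap.hasFDerivAt.comp z
    (h1.prodMk ((hd (n := n)).hasFDerivAt.add h2))
  refine h3.congr_of_eventuallyEq ?_
  filter_upwards [(isOpen_overlap _ _).mem_nhds hz] with y hy
  exact coordTrans_adapted hy

lemma fderiv_coordTrans_adapted {e e' : Chart n M} {z : E (n + 1)}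
    (hz : z ∈ overlap (adapted e) (adapted e')) (U : E (n + 1)) :
    fderiv ℝ (coordTrans (adapted e) (adapted e')) z U =
      ext0 (hd U + fderiv ℝ (logJac e e') (tl z) (tl U)) (fderiv ℝ (coordTrans e e') (tl z) (tl U)) := by
  rw [(hasFDerivAt_coordTrans_adapted hz).fderiv]
  rfl

/-- The adapted coordinate change is a translation in x⁰ by a function of x, so x⁰ drops out after
two differentiations. -/
lemma fderiv_fderiv_coordTrans_adapted {e e' : Chart n M} {z : E (n + 1)}
    (hz : z ∈ overlap (adapted e) (adapted e')) (U V : E (n + 1)) :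
    fderiv ℝ (fderiv ℝ (coordTrans (adapted e) (adapted e'))) z U V =
      ext0 (fderiv ℝ (fderiv ℝ (logJac e e')) (tl z) (tl U) (tl V))
        (fderiv ℝ (fderiv ℝ (coordTrans e e')) (tl z) (tl U) (tl V)) := by
  have hx := mem_thomas_overlap.1 hz
  have c : ∀ v : E n, HasFDerivAt (fun _ : E (n + 1) => v) (0 : E (n + 1) →L[ℝ] E n) z :=
    fun v => hasFDerivAt_const v z
  have h1 := ((differentiableAt_fderiv_coordTrans hx).hasFDerivAt.comp z
    (tl (n := n)).hasFDerivAt).clm_apply (c (tl V))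
  have h2 := ((((contDiffAt_logJac hx).fderiv_right (m := ∞) (by simp)).differentiableAt
    (by simp)).hasFDerivAt.comp z (tl (n := n)).hasFDerivAt).clm_apply (c (tl V))
  have h3 := (consL n).toContinuousLinearMap.hasFDerivAt.comp z
    (h1.prodMk ((hasFDerivAt_const (hd V) z).add h2))
  have h4 := (differentiableAt_fderiv_coordTrans hz).hasFDerivAt.clm_apply (hasFDerivAt_const V z)
  have h5 := h4.unique (h3.congr_of_eventuallyEq (by
    filter_upwards [(isOpen_overlap _ _).mem_nhds hz] with y hy
    exact fderiv_coordTrans_adapted hy V))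
  have h6 := congr($h5 U)
  simp only [add_apply, ContinuousLinearMap.comp_apply, ContinuousLinearMap.flip_apply, zero_apply,
    map_zero, zero_add, ContinuousLinearMap.prod_apply] at h6
  exact h6

/-- The connection coefficients of the Thomas construction. -/
def thomasCoeff (D : Connection n M) (e : Chart n M) (k i j : Fin (n + 1)) (x : E n) : ℝ :=
  Fin.cases
    (Fin.cases (Fin.cases (-1 / ((n : ℝ) + 1)) (fun _ => 0) j)
      (fun i => Fin.cases 0 (fun j => ((n : ℝ) + 1) / ((n : ℝ) - 1) * D.projRicci e i j x) j) i)
    (fun k => Fin.cases (Fin.cases 0 (fun j => if k = j then -1 / ((n : ℝ) + 1) else 0) j)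
      (fun i => Fin.cases (if k = i then -1 / ((n : ℝ) + 1) else 0)
        (fun j => D.projCoeff e k i j x) j) i) k

/-- The connection coefficients of the Thomas construction, as a bilinear map. -/
def thomasGam (D : Connection n M) (e : Chart n M) (z : E (n + 1)) :
    E (n + 1) →L[ℝ] E (n + 1) →L[ℝ] E (n + 1) :=
  bil fun k i j => thomasCoeff D e k i j (tl z)

/-- The block form of the coefficients: with x⁰ separated from x, the transformation law on M̃ can
be checked without indices. -/
lemma thomasGam_apply [T2Space M] (D : Connection n M) {e : Chart n M} {z : E (n + 1)}
    (hz : tl z ∈ e.1.target) (U V : E (n + 1)) :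
    thomasGam D e z U V = ext0
      (((n : ℝ) + 1) / ((n : ℝ) - 1) * D.ricci e (tl z) (tl U) (tl V) -
        1 / ((n : ℝ) + 1) * (hd U * hd V))
      (D.pgam e (tl z) (tl U) (tl V) - (1 / ((n : ℝ) + 1)) • (hd U • tl V + hd V • tl U)) := by
  ext k
  rw [thomasGam, bil_apply]
  refine Fin.cases ?_ (fun k => ?_) k
  · rw [D.ricci_eq_sum hz]
    simp only [Fin.sum_univ_succ, thomasCoeff, Fin.cases_zero, Fin.cases_succ, ext0_zero,
      hd_apply, tl_apply, Finset.mul_sum]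
    simp only [zero_mul, Finset.sum_const_zero, zero_add, add_zero]
    rw [sub_eq_add_neg, add_comm]
    congr 1
    · exact Finset.sum_congr rfl fun i _ => Finset.sum_congr rfl fun j _ => by ring
    · ring
  · simp only [Fin.sum_univ_succ, thomasCoeff, Fin.cases_zero, Fin.cases_succ, ext0_succ,
      hd_apply, tl_apply, PiLp.sub_apply, PiLp.smul_apply, PiLp.add_apply, Connection.pgam,
      bil_apply, smul_eq_mul]
    simp only [zero_mul, zero_add, ite_mul, Finset.sum_ite_eq, Finset.mem_univ, if_true,
      Finset.sum_add_distrib]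
    ring

/-- Points in one fibre lie in a common adapted chart; points in different fibres are separated by
neighbourhoods of their projections. This makes the results needing a Hausdorff manifold available
on M̃. -/
instance [T2Space M] : T2Space (Thomas n M) := by
  refine ⟨fun q r hqr => ?_⟩
  by_cases hp : q.proj = r.proj
  · have hq : q ∈ (thomasChart (chartOf q.proj)).source := by
      rw [thomasChart_source]
      exact mem_chart_source (E n) q.proj
    have hr : r ∈ (thomasChart (chartOf q.proj)).source := by
      rw [thomasChart_source, hp]
      exact mem_chart_source (E n) r.proj
    obtain ⟨u, v, hu, hv, hqu, hrv, huv⟩ :=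
      t2_separation fun h => hqr ((thomasChart (chartOf q.proj)).injOn hq hr h)
    exact ⟨_, _, (thomasChart (chartOf q.proj)).isOpen_inter_preimage hu,
      (thomasChart (chartOf q.proj)).isOpen_inter_preimage hv, ⟨hq, hqu⟩, ⟨hr, hrv⟩,
      (huv.preimage _).mono inter_subset_right inter_subset_right⟩
  · obtain ⟨u, v, hu, hv, hqu, hrv, huv⟩ := t2_separation hp
    have hc : Continuous (Thomas.proj : Thomas n M → M) := (thomasCore n M).continuous_proj
    exact ⟨_, _, hu.preimage hc, hv.preimage hc, hqu, hrv, huv.preimage _⟩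

/-- The components along M are the law of Π, whose log J correction cancels against the mixed
coefficients -1/(n+1), since x⁰-components of vectors shift by the derivative of log J. The
x⁰-component is the law of the Ricci-type form. -/
lemma thomasGam_trans [T2Space M] (hn : 1 < n) (D : Connection n M) {e e' : Chart n M}
    {z : E (n + 1)} (hz : z ∈ overlap (adapted e) (adapted e')) (U V : E (n + 1)) :
    fderiv ℝ (fderiv ℝ (coordTrans (adapted e) (adapted e'))) z U V =
      fderiv ℝ (coordTrans (adapted e) (adapted e')) z (thomasGam D e z U V) -
        thomasGam D e' (coordTrans (adapted e) (adapted e') z)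
          (fderiv ℝ (coordTrans (adapted e) (adapted e')) z U)
          (fderiv ℝ (coordTrans (adapted e) (adapted e')) z V) := by
  have hx := mem_thomas_overlap.1 hz
  have hy := (mem_overlap.1 (trans_mem hx)).1
  rw [fderiv_fderiv_coordTrans_adapted hz, fderiv_coordTrans_adapted hz,
    fderiv_coordTrans_adapted hz, fderiv_coordTrans_adapted hz,
    thomasGam_apply D (mem_overlap.1 hx).1,
    thomasGam_apply D (by rw [coordTrans_adapted hz, tl_ext0]; exact hy), coordTrans_adapted hz]
  simp only [tl_ext0, hd_ext0, ext0_sub]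
  congr 1
  · rw [D.ricci_trans hn hx]
    simp only [map_sub, map_smul, map_add, smul_eq_mul]
    ring
  · rw [D.pgam_trans hx]
    simp only [map_sub, map_smul, map_add]
    module

/-- The Thomas construction assigns a connection on the Thomas manifold to every connection. -/
theorem exists_thomasConnection [T2Space M] (hn : 1 < n) (D : Connection n M) :
    ∃ D' : Connection (n + 1) (Thomas n M), ∀ (e : Chart n M), ∀ z ∈ (adapted e).1.target,
      D'.gam (adapted e) z = thomasGam D e z := by
  refine exists_connection (adapted (n := n) (M := M)) (fun q => ⟨chartOf q.proj, rfl⟩) (thomasGam D)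
    (fun e => ?_) (fun e z hz U V => ?_) (fun e e' z hz => thomasGam_trans hn D hz)
  · refine contDiffOn_bil fun k i j => ?_
    have h : ContDiffOn ℝ ∞ (thomasCoeff D e k i j) e.1.target := by
      refine Fin.cases ?_ (fun k => ?_) k <;> refine Fin.cases ?_ (fun i => ?_) i <;>
      refine Fin.cases ?_ (fun j => ?_) j <;> first
        | exact contDiffOn_const.mul (D.contDiffOn_projRicci e i j)
        | exact D.contDiffOn_projCoeff e k i j
        | exact contDiffOn_const
    exact h.comp (tl (n := n)).contDiff.contDiffOn fun z hz => mem_thomas_target.1 hz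
  · have hx := mem_thomas_target.1 hz
    -- Symmetry of the divergence part is inherited from Π by differentiation, that of the quadratic
    -- part from cyclicity of the trace.
    have hR : D.ricci e (tl z) (tl U) (tl V) = D.ricci e (tl z) (tl V) (tl U) := by
      have h2 : ∀ u v w, fderiv ℝ (D.pgam e) (tl z) w u v = fderiv ℝ (D.pgam e) (tl z) w v u := by
        intro u v w
        have c : ∀ a b : E n, HasFDerivAt (fun y => D.pgam e y a b) _ (tl z) := fun a b =>
          ((D.differentiableAt_pgam hx).hasFDerivAt.clm_apply (hasFDerivAt_const a _)).clm_apply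
            (hasFDerivAt_const b _)
        have h := (c u v).unique ((c v u).congr_of_eventuallyEq (by
          filter_upwards [e.1.open_target.mem_nhds hx] with y hy
          exact D.pgam_symm hy u v))
        have := congr($h w)
        simpa using this
      rw [Connection.ricci, Connection.ricci, tr_comm]
      simp only [tr_apply, ContinuousLinearMap.flip_apply, h2 (tl U) (tl V)]
    rw [thomasGam_apply D hx, thomasGam_apply D hx, hR, D.pgam_symm hx, mul_comm (hd U),
      add_comm (hd U • tl V)]

lemma isThomasConnection_iff_gam {D : Connection n M} {D' : Connection (n + 1) (Thomas n M)} :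
    IsThomasConnection D D' ↔ ∀ (e : Chart n M), ∀ z ∈ (adapted e).1.target,
      D'.gam (adapted e) z = thomasGam D e z := by
  constructor
  · intro h e z hz
    refine bil_ext fun i j => ?_
    ext k
    rw [D'.gam_sgl_apply, thomasGam, bil_sgl]
    obtain ⟨h1, h2, h3, h4⟩ := h e (tl z) (mem_thomas_target.1 hz) (hd z)
    rw [ext0_hd_tl] at h1 h2 h3 h4
    refine Fin.cases ?_ (fun i => ?_) i
    · rw [h2]
      refine Fin.cases ?_ (fun k => ?_) k <;> refine Fin.cases ?_ (fun j => ?_) j <;>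
        simp [thomasCoeff, Fin.succ_ne_zero, (Fin.succ_ne_zero _).symm]
    · refine Fin.cases ?_ (fun j => ?_) j
      · rw [h3]
        refine Fin.cases ?_ (fun k => ?_) k <;>
          simp [thomasCoeff, (Fin.succ_ne_zero _).symm]
      · refine Fin.cases ?_ (fun k => ?_) k
        · rw [h4]
          simp [thomasCoeff]
        · rw [h1]
          simp [thomasCoeff]
  · intro h e x hx t
    have hk : ∀ k i j, D'.coeff (adapted e) k i j (ext0 t x) = thomasCoeff D e k i j x := by
      intro k i j
      rw [← D'.gam_sgl_apply, h e _ (ext0_mem_target.2 hx), thomasGam, bil_sgl, tl_ext0]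
    simp only [hk]
    refine ⟨fun k i j => ?_, fun a b => ?_, fun a b => ?_, fun i j => ?_⟩
    · simp [thomasCoeff]
    · refine Fin.cases ?_ (fun k => ?_) a <;> refine Fin.cases ?_ (fun j => ?_) b <;>
        simp [thomasCoeff, Fin.succ_ne_zero, (Fin.succ_ne_zero _).symm]
    · refine Fin.cases ?_ (fun k => ?_) a <;> refine Fin.cases ?_ (fun j => ?_) b <;>
        simp [thomasCoeff, Fin.succ_ne_zero, (Fin.succ_ne_zero _).symm]
    · simp [thomasCoeff]

lemma Connection.Mem.projRicci_eq [T2Space M] {D D' : Connection n M} {P : ProjectiveClass n M}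
    (h : D.Mem P) (h' : D'.Mem P) (e : Chart n M) {x : E n} (hx : x ∈ e.1.target) (i j : Fin n) :
    D'.projRicci e i j x = D.projRicci e i j x := by
  have h1 : ∀ k i j, D'.projCoeff e k i j =ᶠ[𝓝 x] D.projCoeff e k i j := fun k i j => by
    filter_upwards [e.1.open_target.mem_nhds hx] with y hy
    exact h.projCoeff_eq h' e hy k i j
  have h2 : ∀ s, pd s (D'.projCoeff e s i j) x = pd s (D.projCoeff e s i j) x := fun s => by
    rw [pd, pd, (h1 s i j).fderiv_eq]
  simp only [Connection.projRicci, h2, fun k i j => (h1 k i j).eq_of_nhds]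

/-- The construction uses Π and its derivatives alone, and these are shared by all connections of
the class. -/
lemma Connection.Mem.isThomasConnection [T2Space M] {D D₁ : Connection n M}
    {P : ProjectiveClass n M} (h : D.Mem P) (h₁ : D₁.Mem P)
    {D' : Connection (n + 1) (Thomas n M)} (h' : IsThomasConnection D D') :
    IsThomasConnection D₁ D' := by
  intro e x hx t
  obtain ⟨h1, h2, h3, h4⟩ := h' e x hx t
  refine ⟨fun k i j => ?_, h2, h3, fun i j => ?_⟩
  · rw [h1, h.projCoeff_eq h₁ e hx]
  · rw [h4, h.projRicci_eq h₁ e hx]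

/-- Existence and uniqueness of the induced projective class. -/
theorem existsUnique_inducedClass [T2Space M] (hn : 1 < n) (P : ProjectiveClass n M) :
    ∃! P' : ProjectiveClass (n + 1) (Thomas n M), IsInducedClass P P' := by
  obtain ⟨D, hD⟩ := Quotient.exists_rep P
  obtain ⟨D', hD'⟩ := exists_thomasConnection hn D
  refine ⟨Quotient.mk _ D', ⟨D', rfl, fun D₁ h₁ =>
    Connection.Mem.isThomasConnection hD h₁ (isThomasConnection_iff_gam.2 hD')⟩, ?_⟩
  rintro P'' ⟨D'', rfl, h⟩
  have h1 := isThomasConnection_iff_gam.1 (h D hD)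
  -- Two connections given by the construction have the same coefficients in the adapted charts,
  -- which cover M̃. Hence they agree in all charts and share their geodesics.
  refine Quotient.sound (projSetoid_of_atlas (adapted (n := n) (M := M)) (fun q => ?_)
    fun e z hz => (h1 e z hz).trans (hD' e z hz).symm)
  exact ⟨chartOf q.proj, mem_chart_source (E (n + 1)) q⟩

end Thomas

/-! ### Rules for partial derivatives -/

section PartialDerivatives

variable {m : ℕ} {s : Set (E m)} {f g : E m → ℝ} {x : E m}

lemma pd_congr (hs : IsOpen s) (h : ∀ y ∈ s, f y = g y) (hx : x ∈ s) (i : Fin m) :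
    pd i f x = pd i g x := by
  have h1 : f =ᶠ[𝓝 x] g := by
    filter_upwards [hs.mem_nhds hx] with y hy
    exact h y hy
  rw [pd, pd, h1.fderiv_eq]

lemma differentiableAt_of_contDiffOn {F G : Type*} [NormedAddCommGroup F] [NormedSpace ℝ F]
    [NormedAddCommGroup G] [NormedSpace ℝ G] {s : Set F} {f : F → G} (hs : IsOpen s)
    (hf : ContDiffOn ℝ ∞ f s) {x : F} (hx : x ∈ s) : DifferentiableAt ℝ f x :=
  (hf.contDiffAt (hs.mem_nhds hx)).differentiableAt (by simp)

lemma pd_add (hs : IsOpen s) (hf : ContDiffOn ℝ ∞ f s) (hg : ContDiffOn ℝ ∞ g s) (hx : x ∈ s)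
    (i : Fin m) : pd i (fun y => f y + g y) x = pd i f x + pd i g x := by
  rw [pd, fderiv_fun_add (differentiableAt_of_contDiffOn hs hf hx)
    (differentiableAt_of_contDiffOn hs hg hx)]
  rfl

lemma pd_mul (hs : IsOpen s) (hf : ContDiffOn ℝ ∞ f s) (hg : ContDiffOn ℝ ∞ g s) (hx : x ∈ s)
    (i : Fin m) : pd i (fun y => f y * g y) x = f x * pd i g x + g x * pd i f x := by
  rw [pd, fderiv_fun_mul (differentiableAt_of_contDiffOn hs hf hx)
    (differentiableAt_of_contDiffOn hs hg hx)]
  rfl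

lemma pd_const_mul (c : ℝ) (f : E m → ℝ) (i : Fin m) (x : E m) :
    pd i (fun y => c * f y) x = c * pd i f x := by
  have h : (fun y => c * f y) = c • f := rfl
  rw [pd, h, fderiv_const_smul_field]
  rfl

lemma pd_const (c : ℝ) (i : Fin m) (x : E m) : pd i (fun _ => c) x = 0 := by
  simp [pd]

lemma pd_sum {ι : Type*} (t : Finset ι) {F : ι → E m → ℝ} (hs : IsOpen s)
    (hF : ∀ j ∈ t, ContDiffOn ℝ ∞ (F j) s) (hx : x ∈ s) (i : Fin m) :
    pd i (fun y => ∑ j ∈ t, F j y) x = ∑ j ∈ t, pd i (F j) x := by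
  rw [pd, fderiv_fun_sum fun j hj => differentiableAt_of_contDiffOn hs (hF j hj) hx]
  simp [pd]

lemma pd_comm (hs : IsOpen s) (hf : ContDiffOn ℝ ∞ f s) (hx : x ∈ s) (i j : Fin m) :
    pd i (pd j f) x = pd j (pd i f) x := by
  have hf' := hf.contDiffAt (hs.mem_nhds hx)
  have h : ∀ i j, pd i (pd j f) x = fderiv ℝ (fderiv ℝ f) x (sgl i) (sgl j) := fun i j => by
    have h1 := ((hf'.fderiv_right (m := ∞) (by simp)).differentiableAt (by simp)).hasFDerivAt.clm_apply
      (hasFDerivAt_const (sgl j) x)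
    have h2 : fderiv ℝ (pd j f) x = _ := h1.fderiv
    rw [pd, h2]
    simp
  rw [h, h, fderiv_fderiv_symm hf']

lemma pd_pd (hf : ContDiffAt ℝ ∞ f x) (i j : Fin m) :
    pd i (pd j f) x = fderiv ℝ (fderiv ℝ f) x (sgl i) (sgl j) := by
  have h1 := ((hf.fderiv_right (m := ∞) (by simp)).differentiableAt (by simp)).hasFDerivAt.clm_apply
    (hasFDerivAt_const (sgl j) x)
  have h2 : fderiv ℝ (pd j f) x = _ := h1.fderiv
  rw [pd, h2]
  simp

end PartialDerivatives

/-! ### The projective Laplacian: invariance, existence, uniqueness, product rule -/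

section Laplacian

variable {m : ℕ} {N : Type*} [TopologicalSpace N] [ChartedSpace (E m) N]
  [IsManifold 𝓘(ℝ, E m) ∞ N]

/-- The bilinear form of `S` on covectors expressed in the chart `e`. -/
def SymTensor.chartForm (S : SymTensor m N) (e : Chart m N) (x : E m) (α β : E m →L[ℝ] ℝ) : ℝ :=
  S.form (e.1.symm x) (α.comp (chartTo e (e.1.symm x))) (β.comp (chartTo e (e.1.symm x)))

/-- The bilinear form of `S` at a point, as a form on the dual of coordinate space. -/
def SymTensor.formE (S : SymTensor m N) (p : N) : (E m →L[ℝ] ℝ) →ₗ[ℝ] (E m →L[ℝ] ℝ) →ₗ[ℝ] ℝ :=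
  S.form p

lemma SymTensor.chartForm_eq_formE (S : SymTensor m N) (e : Chart m N) (x : E m)
    (α β : E m →L[ℝ] ℝ) : S.chartForm e x α β = S.formE (e.1.symm x)
      (α.comp (chartTo e (e.1.symm x))) (β.comp (chartTo e (e.1.symm x))) := rfl

lemma SymTensor.chartForm_proj (S : SymTensor m N) (e : Chart m N) (x : E m) (i j : Fin m) :
    S.chartForm e x (EuclideanSpace.proj i) (EuclideanSpace.proj j) = S.comp e i j x := rfl

lemma SymTensor.comp_symm (S : SymTensor m N) (e : Chart m N) (x : E m) (i j : Fin m) :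
    S.comp e i j x = S.comp e j i x := S.symm _ _ _

lemma SymTensor.contDiffOn_comp (S : SymTensor m N) (e : Chart m N) (i j : Fin m) :
    ContDiffOn ℝ ∞ (S.comp e i j) e.1.target := S.smooth e i j

lemma covector_eq_sum (α : E m →L[ℝ] ℝ) :
    α = ∑ i, α (sgl i) • (EuclideanSpace.proj i : E m →L[ℝ] ℝ) := by
  ext1 v
  rw [map_eq_sum α v]
  simp [mul_comm]

lemma SymTensor.chartForm_eq_sum (S : SymTensor m N) (e : Chart m N) (x : E m)
    (α β : E m →L[ℝ] ℝ) :
    S.chartForm e x α β = ∑ i, ∑ j, S.comp e i j x * α (sgl i) * β (sgl j) := by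
  conv_lhs => rw [chartForm_eq_formE, covector_eq_sum α, covector_eq_sum β]
  simp only [ContinuousLinearMap.finsetSum_comp, ContinuousLinearMap.smul_comp, map_sum, map_smul,
    LinearMap.sum_apply, LinearMap.smul_apply, smul_eq_mul, ← S.chartForm_eq_formE,
    S.chartForm_proj]
  rw [Finset.sum_comm]
  refine Finset.sum_congr rfl fun i _ => ?_
  rw [Finset.mul_sum]
  exact Finset.sum_congr rfl fun j _ => by ring

lemma SymTensor.chartForm_trans (S : SymTensor m N) {e e' : Chart m N} {x : E m}
    (hx : x ∈ overlap e e') (α β : E m →L[ℝ] ℝ) :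
    S.chartForm e' (coordTrans e e' x) α β =
      S.chartForm e x (α.comp (fderiv ℝ (coordTrans e e') x))
        (β.comp (fderiv ℝ (coordTrans e e') x)) := by
  have h : chartTo e' (e.1.symm x) =
      (fderiv ℝ (coordTrans e e') x).comp (chartTo e (e.1.symm x)) := by
    ext1 v
    exact (fderiv_coordTrans_chartTo hx v).symm
  rw [S.chartForm_eq_formE, S.chartForm_eq_formE, symm_coordTrans hx, h]
  rfl

/-- The vector field `S(dh, ·)` in the chart `e`. -/
def SymTensor.grad (S : SymTensor m N) (e : Chart m N) (h : E m → ℝ) (x : E m) : E m :=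
  ∑ i, S.chartForm e x (EuclideanSpace.proj i) (fderiv ℝ h x) • sgl i

lemma SymTensor.grad_apply (S : SymTensor m N) (e : Chart m N) (h : E m → ℝ) (x : E m)
    (i : Fin m) : S.grad e h x i = ∑ j, S.comp e i j x * pd j h x := by
  simp [grad, S.chartForm_eq_sum, pd, Pi.single_apply]

/-- A covector pairs with the gradient as S(α, dh), and S does not depend on the chart; so the
gradient transforms as a vector. -/
lemma SymTensor.grad_trans (S : SymTensor m N) {e e' : Chart m N} {x : E m}
    (hx : x ∈ overlap e e') {h h' : E m → ℝ} (hh : h =ᶠ[𝓝 x] h' ∘ coordTrans e e')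
    (hd : DifferentiableAt ℝ h' (coordTrans e e' x)) :
    S.grad e' h' (coordTrans e e' x) = fderiv ℝ (coordTrans e e') x (S.grad e h x) := by
  have h1 : fderiv ℝ h x =
      (fderiv ℝ h' (coordTrans e e' x)).comp (fderiv ℝ (coordTrans e e') x) := by
    rw [hh.fderiv_eq, fderiv_comp x hd (differentiableAt_trans hx)]
  have h2 : ∀ α : E m →L[ℝ] ℝ, α (S.grad e h x) = S.chartForm e x α (fderiv ℝ h x) := fun α => by
    rw [S.chartForm_eq_sum, map_eq_sum α]
    refine Finset.sum_congr rfl fun i _ => ?_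
    rw [S.grad_apply, smul_eq_mul, Finset.sum_mul]
    exact Finset.sum_congr rfl fun j _ => by simp only [pd]; ring
  ext i
  have h3 := h2 ((EuclideanSpace.proj i).comp (fderiv ℝ (coordTrans e e') x))
  rw [h1, ← S.chartForm_trans hx] at h3
  refine Eq.trans ?_ h3.symm
  rw [S.grad_apply, S.chartForm_eq_sum]
  simp [pd]

/-- The Hessian of `h` with connection coefficients `G`. -/
def hess (G : E m → E m →L[ℝ] E m →L[ℝ] E m) (h : E m → ℝ) (x u v : E m) : ℝ :=
  fderiv ℝ (fderiv ℝ h) x u v - fderiv ℝ h x (G x u v)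

/-- The second derivative of h' ∘ F contains h'(F''), and the transformation law of the coefficients
removes it. -/
lemma hess_trans (D : Connection m N) {e e' : Chart m N} {x : E m}
    (hx : x ∈ overlap e e') {h h' : E m → ℝ} (hh : h =ᶠ[𝓝 x] h' ∘ coordTrans e e')
    (hd : ContDiffAt ℝ ∞ h' (coordTrans e e' x)) (u v : E m) :
    hess (D.gam e) h x u v = hess (D.gam e') h' (coordTrans e e' x)
      (fderiv ℝ (coordTrans e e') x u) (fderiv ℝ (coordTrans e e') x v) := by
  have h1 : fderiv ℝ h =ᶠ[𝓝 x] fun y =>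
      (fderiv ℝ h' (coordTrans e e' y)).comp (fderiv ℝ (coordTrans e e') y) := by
    have hd' : ∀ᶠ y in 𝓝 (coordTrans e e' x), ContDiffAt ℝ 2 h' y :=
      (hd.of_le two_le_infty).eventually (by simp)
    filter_upwards [hh.fderiv (𝕜 := ℝ), (isOpen_overlap e e').mem_nhds hx,
      (differentiableAt_trans hx).continuousAt.eventually hd'] with y hy hy' hy''
    rw [hy, fderiv_comp y (hy''.differentiableAt (by simp)) (differentiableAt_trans hy')]
  have h2 := ((hd.fderiv_right (m := ∞) (by simp)).differentiableAt (by simp)).hasFDerivAt.comp x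
    (differentiableAt_trans hx).hasFDerivAt
  have h3 := (h2.clm_comp (differentiableAt_fderiv_coordTrans hx).hasFDerivAt).fderiv
  rw [hess, hess, h1.fderiv_eq, h1.eq_of_nhds]
  have h4 := congr($h3 u v)
  refine (congrArg₂ _ h4 rfl).trans ?_
  simp only [add_apply, ContinuousLinearMap.comp_apply, ContinuousLinearMap.flip_apply,
    ContinuousLinearMap.compL_apply, D.gam_trans hx, map_sub, Function.comp_apply]
  ring

/-- The expression of the projective Laplacian in the chart `e`. -/
def lapIn (D : Connection m N) (S : SymTensor m N) (e : Chart m N) (h : E m → ℝ) (x : E m) : ℝ :=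
  ∑ i, ∑ j, S.comp e i j x * pd i (pd j h) x +
    ∑ i, (2 / ((m : ℝ) + 3) * ∑ j, pd j (S.comp e i j) x -
      ((m : ℝ) + 1) / ((m : ℝ) + 3) * ∑ j, ∑ k, S.comp e j k x * D.projCoeff e i j k x) * pd i h x

lemma contDiffAt_pd {h : E m → ℝ} {x : E m} (hh : ContDiffAt ℝ ∞ h x) (i : Fin m) :
    ContDiffAt ℝ ∞ (pd i h) x :=
  (hh.fderiv_right (m := ∞) (by simp)).clm_apply contDiffAt_const

lemma SymTensor.contDiffAt_comp (S : SymTensor m N) {e : Chart m N} {x : E m}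
    (hx : x ∈ e.1.target) (i j : Fin m) : ContDiffAt ℝ ∞ (S.comp e i j) x :=
  (S.contDiffOn_comp e i j).contDiffAt (e.1.open_target.mem_nhds hx)

lemma SymTensor.contDiffAt_grad (S : SymTensor m N) {e : Chart m N} {x : E m}
    (hx : x ∈ e.1.target) {h : E m → ℝ} (hh : ContDiffAt ℝ ∞ h x) :
    ContDiffAt ℝ ∞ (S.grad e h) x := by
  have h1 : S.grad e h = fun y => ∑ i, (∑ j, S.comp e i j y * pd j h y) • sgl i := by
    funext y
    rw [← sum_coord_smul (S.grad e h y)]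
    simp only [S.grad_apply]
  rw [h1]
  exact ContDiffAt.sum fun i _ => (ContDiffAt.sum fun j _ =>
    (S.contDiffAt_comp hx i j).mul (contDiffAt_pd hh j)).smul contDiffAt_const

/-- The weights 2/(m+3) and (m+1)/(m+3) add up to 1 on the second-order terms. The trace of Γ in the
divergence matches the trace part subtracted from Γ to form Π: (m+1)/(m+3) · 2/(m+1) = 2/(m+3). This
exhibits the operator as a combination of two invariants. -/
lemma lapIn_eq (D : Connection m N) (S : SymTensor m N) {e : Chart m N} {x : E m}
    (hx : x ∈ e.1.target) {h : E m → ℝ} (hh : ContDiffAt ℝ ∞ h x) :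
    lapIn D S e h x = 2 / ((m : ℝ) + 3) * tr (locCov (D.gam e) (S.grad e h) x) +
      ((m : ℝ) + 1) / ((m : ℝ) + 3) *
        ∑ i, ∑ j, S.comp e i j x * hess (D.gam e) h x (sgl i) (sgl j) := by
  have hV := ((S.contDiffAt_grad hx hh).differentiableAt (by simp)).hasFDerivAt
  have h1 : ∀ i, fderiv ℝ (S.grad e h) x (sgl i) i =
      ∑ j, (S.comp e i j x * pd i (pd j h) x + pd j h x * pd i (S.comp e i j) x) := fun i => by
    have a1 := ((EuclideanSpace.proj (𝕜 := ℝ) i).hasFDerivAt.comp x hV)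
    have a2 : HasFDerivAt (fun y => ∑ j, S.comp e i j y * pd j h y) _ x :=
      HasFDerivAt.fun_sum fun j _ =>
        ((S.contDiffAt_comp hx i j).differentiableAt (by simp)).hasFDerivAt.mul
          ((contDiffAt_pd hh j).differentiableAt (by simp)).hasFDerivAt
    have a3 := a1.unique (a2.congr_of_eventuallyEq (Eventually.of_forall fun y => S.grad_apply e h y i))
    have a4 := congr($a3 (sgl i))
    simpa [pd] using a4
  have h2 : ∀ i, D.gam e x (sgl i) (S.grad e h x) i =
      ∑ k, ∑ j, D.coeff e i i k x * (S.comp e k j x * pd j h x) := fun i => by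
    rw [map_eq_sum (D.gam e x (sgl i)) (S.grad e h x)]
    simp only [WithLp.ofLp_sum, Finset.sum_apply, PiLp.smul_apply, smul_eq_mul, D.gam_sgl_apply,
      S.grad_apply, Finset.sum_mul]
    exact Finset.sum_congr rfl fun k _ => Finset.sum_congr rfl fun j _ => by ring
  have h3 : ∀ i j, hess (D.gam e) h x (sgl i) (sgl j) =
      pd i (pd j h) x - ∑ k, D.coeff e k i j x * pd k h x := fun i j => by
    rw [hess, ← pd_pd hh, map_eq_sum (fderiv ℝ h x) (D.gam e x (sgl i) (sgl j))]
    simp only [D.gam_sgl_apply, smul_eq_mul, pd]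
  have hτ : ∀ i k, D.coeff e k i k x = D.coeff e k k i x := fun i k => by
    rw [← D.gam_sgl_apply, ← D.gam_sgl_apply, D.gam_symm hx]
  set τ : Fin m → ℝ := fun i => ∑ s, D.coeff e s s i x with hτd
  have hP : ∀ k i j, D.projCoeff e k i j x = D.coeff e k i j x - 1 / ((m : ℝ) + 1) *
      ((if k = i then τ j else 0) + if k = j then τ i else 0) := fun k i j => by
    have : ∑ s, D.coeff e s i s x = τ i := Finset.sum_congr rfl fun s _ => hτ i s
    rw [Connection.projCoeff, this]
  have e1 : ∑ i, D.gam e x (sgl i) (S.grad e h x) i =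
      ∑ i, (∑ k, S.comp e k i x * τ k) * pd i h x := by
    simp only [h2, hτd, Finset.sum_mul, Finset.mul_sum]
    rw [Finset.sum_comm]
    have : ∀ k, ∑ i, ∑ j, D.coeff e i i k x * (S.comp e k j x * pd j h x) =
        ∑ j, ∑ i, D.coeff e i i k x * (S.comp e k j x * pd j h x) := fun k => Finset.sum_comm
    simp only [this]
    rw [Finset.sum_comm]
    exact Finset.sum_congr rfl fun k _ => Finset.sum_congr rfl fun j _ =>
      Finset.sum_congr rfl fun i _ => by ring
  have e2 : ∀ i, ∑ j, ∑ k, S.comp e j k x * D.projCoeff e i j k x =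
      ∑ j, ∑ k, S.comp e j k x * D.coeff e i j k x -
        2 / ((m : ℝ) + 1) * ∑ k, S.comp e k i x * τ k := fun i => by
    simp only [hP, mul_sub, Finset.sum_sub_distrib, mul_add, Finset.sum_add_distrib, mul_ite,
      mul_zero, Finset.sum_ite_eq, Finset.mem_univ, if_true]
    have : ∑ j, ∑ k, (if i = j then S.comp e j k x * (1 / ((m : ℝ) + 1) * τ k) else 0) =
        ∑ k, S.comp e k i x * (1 / ((m : ℝ) + 1) * τ k) := by
      rw [Finset.sum_comm]
      simp [S.comp_symm e x i]
    rw [this, Finset.mul_sum, ← Finset.sum_add_distrib]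
    congr 1
    exact Finset.sum_congr rfl fun k _ => by ring
  have e3 : ∑ i, ∑ j, S.comp e i j x * ∑ k, D.coeff e k i j x * pd k h x =
      ∑ i, (∑ j, ∑ k, S.comp e j k x * D.coeff e i j k x) * pd i h x := by
    simp only [Finset.sum_mul, Finset.mul_sum]
    have : ∀ i, ∑ j, ∑ k, S.comp e i j x * (D.coeff e k i j x * pd k h x) =
        ∑ k, ∑ j, S.comp e i j x * (D.coeff e k i j x * pd k h x) := fun i => Finset.sum_comm
    simp only [this]
    rw [Finset.sum_comm]
    exact Finset.sum_congr rfl fun k _ => Finset.sum_congr rfl fun j _ =>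
      Finset.sum_congr rfl fun i _ => by ring
  have e4 : ∑ i, ∑ j, pd j h x * pd i (S.comp e i j) x =
      ∑ i, (∑ j, pd j (S.comp e i j) x) * pd i h x := by
    rw [Finset.sum_comm]
    refine Finset.sum_congr rfl fun i _ => ?_
    rw [Finset.sum_mul]
    refine Finset.sum_congr rfl fun j _ => ?_
    have : S.comp e i j = S.comp e j i := funext fun y => S.comp_symm e y i j
    rw [this, mul_comm]
  have hm1 : (m : ℝ) + 1 ≠ 0 := by positivity
  have hm3 : (m : ℝ) + 3 ≠ 0 := by positivity
  rw [lapIn, tr_apply]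
  simp only [locCov, add_apply, PiLp.add_apply, ContinuousLinearMap.flip_apply,
    Finset.sum_add_distrib, h1, h3, mul_sub, Finset.sum_sub_distrib]
  rw [e1, e3, e4]
  simp only [e2, sub_mul, Finset.sum_sub_distrib, mul_sub, mul_assoc, ← Finset.mul_sum]
  field_simp
  ring

/-- In the form of `lapIn_eq` the first term is the trace of a covariant differential and the second
the contraction of a contravariant with a covariant tensor; neither depends on the coordinates. -/
lemma lapIn_trans (D : Connection m N) (S : SymTensor m N) {e e' : Chart m N} {x : E m}
    (hx : x ∈ overlap e e') {h h' : E m → ℝ} (hh : ∀ y ∈ overlap e e', h y = h' (coordTrans e e' y))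
    (hd : ContDiffOn ℝ ∞ h' (overlap e' e)) :
    lapIn D S e h x = lapIn D S e' h' (coordTrans e e' x) := by
  have hxe := (mem_overlap.1 hx).1
  have hxe' := (mem_overlap.1 (trans_mem hx)).1
  have hda : ∀ y ∈ overlap e e', ContDiffAt ℝ ∞ h' (coordTrans e e' y) := fun y hy =>
    hd.contDiffAt ((isOpen_overlap e' e).mem_nhds (trans_mem hy))
  have hev : ∀ y ∈ overlap e e', h =ᶠ[𝓝 y] h' ∘ coordTrans e e' := fun y hy => by
    filter_upwards [(isOpen_overlap e e').mem_nhds hy] with z hz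
    exact hh z hz
  have hha : ContDiffAt ℝ ∞ h x :=
    ((hda x hx).comp x (contDiffAt_coordTrans hx)).congr_of_eventuallyEq (hev x hx)
  rw [lapIn_eq D S hxe hha, lapIn_eq D S hxe' (hda x hx)]
  congr 2
  · have hmd := mdifferentiableAt_vfOf (N := N) (V := S.grad e h) (e.1.map_target hxe)
      (by rw [e.1.right_inv hxe]; exact (S.contDiffAt_grad hxe hha).differentiableAt (by simp))
    have h1 := locCov_trans hx (D.gam_trans hx) hmd
    have h2 : vfRep (N := N) (vfOf (S.grad e h) e) e =ᶠ[𝓝 x] S.grad e h := by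
      filter_upwards [e.1.open_target.mem_nhds hxe] with y hy
      exact vfRep_vfOf hy
    have h3 : vfRep (N := N) (vfOf (S.grad e h) e) e' =ᶠ[𝓝 (coordTrans e e' x)] S.grad e' h' := by
      filter_upwards [(isOpen_overlap e' e).mem_nhds (trans_mem hx)] with y hy
      have hy' := trans_mem hy
      have := vfRep_trans (σ := vfOf (S.grad e h) e) hy'
      rw [coordTrans_coordTrans hy, vfRep_vfOf (mem_overlap.1 hy').1] at this
      rw [this, ← S.grad_trans hy' (hev _ hy') ((hda _ hy').differentiableAt (by simp)),
        coordTrans_coordTrans hy]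
    simp only [locCov, h2.fderiv_eq, h3.fderiv_eq, h2.eq_of_nhds, h3.eq_of_nhds] at h1
    -- The covariant differentials of the gradient in the two charts are conjugate under the
    -- Jacobian matrix, so their traces agree.
    have h4 : (locCov (D.gam e') (S.grad e' h') (coordTrans e e' x)).comp
        (fderiv ℝ (coordTrans e e') x) =
        (fderiv ℝ (coordTrans e e') x).comp (locCov (D.gam e) (S.grad e h) x) := by
      ext1 u
      exact h1 u
    have h5 := tr_conj (fderiv_coordTrans_comp_self' hx)
      (locCov (D.gam e') (S.grad e' h') (coordTrans e e' x))
    rw [h4, ← ContinuousLinearMap.comp_assoc, fderiv_coordTrans_comp_self hx,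
      ContinuousLinearMap.id_comp] at h5
    exact h5
  · set A := fderiv ℝ (coordTrans e e') x with hA
    set H : E m → E m → ℝ := hess (D.gam e') h' (coordTrans e e' x) with hH
    have hb1 : ∀ u v, H u v = ∑ k, ∑ l, u k * v l * H (sgl k) (sgl l) := fun u v => by
      have a1 : ∀ u v, H u v = (fderiv ℝ (fderiv ℝ h') (coordTrans e e' x) -
        (ContinuousLinearMap.compL ℝ (E m) (E m) ℝ (fderiv ℝ h' (coordTrans e e' x))).comp
          (D.gam e' (coordTrans e e' x))) u v := fun u v => rfl
      set B := (fderiv ℝ (fderiv ℝ h') (coordTrans e e' x) -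
        (ContinuousLinearMap.compL ℝ (E m) (E m) ℝ (fderiv ℝ h' (coordTrans e e' x))).comp
          (D.gam e' (coordTrans e e' x))) with hB
      simp only [a1]
      rw [map_eq_sum B u, sum_apply]
      refine Finset.sum_congr rfl fun k _ => ?_
      rw [smul_apply, map_eq_sum (B (sgl k)) v, Finset.smul_sum]
      exact Finset.sum_congr rfl fun l _ => by simp only [smul_eq_mul]; ring
    have hc : ∀ k l, S.comp e' k l (coordTrans e e' x) =
        ∑ i, ∑ j, S.comp e i j x * A (sgl i) k * A (sgl j) l := fun k l => by
      rw [← S.chartForm_proj, S.chartForm_trans hx, S.chartForm_eq_sum]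
      rfl
    simp only [hess_trans D hx (hev x hx) (hda x hx), ← hA, ← hH, hc]
    simp only [fun i j => hb1 (A (sgl i)) (A (sgl j)), Finset.mul_sum, Finset.sum_mul]
    calc _ = ∑ i, ∑ k, ∑ j, ∑ l, S.comp e i j x * (A (sgl i) k * A (sgl j) l * H (sgl k) (sgl l)) :=
          Finset.sum_congr rfl fun i _ => Finset.sum_comm
      _ = ∑ k, ∑ i, ∑ j, ∑ l, S.comp e i j x * (A (sgl i) k * A (sgl j) l * H (sgl k) (sgl l)) :=
          Finset.sum_comm
      _ = ∑ k, ∑ i, ∑ l, ∑ j, S.comp e i j x * (A (sgl i) k * A (sgl j) l * H (sgl k) (sgl l)) :=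
          Finset.sum_congr rfl fun k _ => Finset.sum_congr rfl fun i _ => Finset.sum_comm
      _ = ∑ k, ∑ l, ∑ i, ∑ j, S.comp e i j x * (A (sgl i) k * A (sgl j) l * H (sgl k) (sgl l)) :=
          Finset.sum_congr rfl fun k _ => Finset.sum_comm
      _ = _ := Finset.sum_congr rfl fun k _ => Finset.sum_congr rfl fun l _ =>
          Finset.sum_congr rfl fun i _ => Finset.sum_congr rfl fun j _ => by ring

lemma contDiffOn_comp_symm (e : Chart m N) (f : C^∞⟮𝓘(ℝ, E m), N; ℝ⟯) :
    ContDiffOn ℝ ∞ (f ∘ e.1.symm) e.1.target :=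
  (f.contMDiff.comp_contMDiffOn (contMDiffOn_symm_of_mem_maximalAtlas e.2)).contDiffOn

lemma contDiffOn_lapIn [T2Space N] (D : Connection m N) (S : SymTensor m N) (e : Chart m N)
    {h : E m → ℝ} (hh : ContDiffOn ℝ ∞ h e.1.target) :
    ContDiffOn ℝ ∞ (lapIn D S e h) e.1.target := by
  have ho := e.1.open_target
  unfold lapIn
  refine (ContDiffOn.sum fun i _ => ContDiffOn.sum fun j _ =>
    (S.contDiffOn_comp e i j).mul (contDiffOn_pd (contDiffOn_pd hh ho j) ho i)).add (ContDiffOn.sum fun i _ =>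
    ContDiffOn.mul ?_ (contDiffOn_pd hh ho i))
  refine (contDiffOn_const.mul (ContDiffOn.sum fun j _ => contDiffOn_pd (S.contDiffOn_comp e i j) ho j)).sub
    (contDiffOn_const.mul (ContDiffOn.sum fun j _ => ContDiffOn.sum fun k _ =>
      (S.contDiffOn_comp e j k).mul (D.contDiffOn_projCoeff e i j k)))

lemma lapIn_add (D : Connection m N) (S : SymTensor m N) {e : Chart m N} {x : E m}
    (hx : x ∈ e.1.target) {h k : E m → ℝ} (hh : ContDiffOn ℝ ∞ h e.1.target)
    (hk : ContDiffOn ℝ ∞ k e.1.target) :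
    lapIn D S e (fun y => h y + k y) x = lapIn D S e h x + lapIn D S e k x := by
  have ho := e.1.open_target
  have h1 : ∀ i j, pd i (pd j fun y => h y + k y) x = pd i (pd j h) x + pd i (pd j k) x :=
    fun i j => by
      rw [pd_congr ho (fun y hy => pd_add ho hh hk hy j) hx,
        pd_add ho (contDiffOn_pd hh ho j) (contDiffOn_pd hk ho j) hx]
  simp only [lapIn, h1, pd_add ho hh hk hx, mul_add, Finset.sum_add_distrib]
  ring

lemma lapIn_const_mul (D : Connection m N) (S : SymTensor m N) (e : Chart m N) (x : E m) (c : ℝ)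
    (h : E m → ℝ) : lapIn D S e (fun y => c * h y) x = c * lapIn D S e h x := by
  have h1 : ∀ j, pd j (fun y => c * h y) = fun y => c * pd j h y := fun j =>
    funext fun y => pd_const_mul c h j y
  simp only [lapIn, h1, pd_const_mul, mul_add, Finset.mul_sum]
  congr 1
  · exact Finset.sum_congr rfl fun i _ => Finset.sum_congr rfl fun j _ => by ring
  · exact Finset.sum_congr rfl fun i _ => by ring

lemma lapIn_const (D : Connection m N) (S : SymTensor m N) (e : Chart m N) (x : E m) (c : ℝ) :
    lapIn D S e (fun _ => c) x = 0 := by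
  have h1 : ∀ j, pd j (fun _ : E m => c) = fun _ => 0 := fun j => funext fun y => pd_const c j y
  simp [lapIn, h1, pd_const]

/-- Only the second-order part deviates from a derivation. Its two cross terms coincide by symmetry
of S, whence the factor 2. -/
lemma lapIn_mul (D : Connection m N) (S : SymTensor m N) {e : Chart m N} {x : E m}
    (hx : x ∈ e.1.target) {h k : E m → ℝ} (hh : ContDiffOn ℝ ∞ h e.1.target)
    (hk : ContDiffOn ℝ ∞ k e.1.target) :
    lapIn D S e (fun y => h y * k y) x = h x * lapIn D S e k x + k x * lapIn D S e h x +
      2 * ∑ i, ∑ j, S.comp e i j x * pd i h x * pd j k x := by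
  have ho := e.1.open_target
  have h1 : ∀ i j, pd i (pd j fun y => h y * k y) x =
      h x * pd i (pd j k) x + k x * pd i (pd j h) x + pd j k x * pd i h x + pd j h x * pd i k x :=
    fun i j => by
      rw [pd_congr ho (fun y hy => pd_mul ho hh hk hy j) hx,
        pd_add ho (hh.mul (contDiffOn_pd hk ho j)) (hk.mul (contDiffOn_pd hh ho j)) hx, pd_mul ho hh (contDiffOn_pd hk ho j) hx,
        pd_mul ho hk (contDiffOn_pd hh ho j) hx]
      ring
  have h2 : ∑ i, ∑ j, S.comp e i j x * (pd j h x * pd i k x) =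
      ∑ i, ∑ j, S.comp e i j x * pd i h x * pd j k x := by
    rw [Finset.sum_comm]
    refine Finset.sum_congr rfl fun i _ => Finset.sum_congr rfl fun j _ => ?_
    rw [S.comp_symm]
    ring
  have h3 : ∑ i, ∑ j, S.comp e i j x * (pd j k x * pd i h x) =
      ∑ i, ∑ j, S.comp e i j x * pd i h x * pd j k x :=
    Finset.sum_congr rfl fun i _ => Finset.sum_congr rfl fun j _ => by ring
  simp only [lapIn, h1, pd_mul ho hh hk hx, mul_add, Finset.sum_add_distrib, h2, h3]
  have h4 : ∀ (c : ℝ) (u : Fin m → Fin m → ℝ), ∑ i, ∑ j, S.comp e i j x * (c * u i j) =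
      c * ∑ i, ∑ j, S.comp e i j x * u i j := fun c u => by
    simp only [Finset.mul_sum]
    exact Finset.sum_congr rfl fun i _ => Finset.sum_congr rfl fun j _ => by ring
  have h5 : ∀ (c : ℝ) (u w : Fin m → ℝ), ∑ i, w i * (c * u i) = c * ∑ i, w i * u i :=
    fun c u w => by
      simp only [Finset.mul_sum]
      exact Finset.sum_congr rfl fun i _ => by ring
  rw [h4, h4, h5, h5]
  ring

/-- Existence of the projective Laplacian. -/
theorem exists_projectiveLaplacian [T2Space N] (P : ProjectiveClass m N) (S : SymTensor m N) :
    ∃ L : C^∞⟮𝓘(ℝ, E m), N; ℝ⟯ →ₗ[ℝ] C^∞⟮𝓘(ℝ, E m), N; ℝ⟯, IsProjectiveLaplacian P S L := by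
  obtain ⟨D, hD⟩ := Quotient.exists_rep P
  have hind : ∀ (f : C^∞⟮𝓘(ℝ, E m), N; ℝ⟯) (e e' : Chart m N) (p : N), p ∈ e.1.source →
      p ∈ e'.1.source → lapIn D S e (f ∘ e.1.symm) (e.1 p) = lapIn D S e' (f ∘ e'.1.symm) (e'.1 p) :=
    fun f e e' p hp hp' => by
      rw [← coordTrans_apply e' hp]
      refine lapIn_trans D S (overlap_of_mem hp hp') (fun y hy => ?_)
        ((contDiffOn_comp_symm e' f).mono fun y hy => (mem_overlap.1 hy).1)
      simp [symm_coordTrans hy]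
  let L₀ : C^∞⟮𝓘(ℝ, E m), N; ℝ⟯ → N → ℝ := fun f p =>
    lapIn D S (chartOf p) (f ∘ (chartOf p).1.symm) ((chartOf p).1 p)
  have hL : ∀ f (e : Chart m N), ∀ p ∈ e.1.source, L₀ f p = lapIn D S e (f ∘ e.1.symm) (e.1 p) :=
    fun f e p hp => hind f _ e p (mem_chart_source (E m) p) hp
  have hsm : ∀ f, ContMDiff 𝓘(ℝ, E m) 𝓘(ℝ, ℝ) ∞ (L₀ f) := fun f p => by
    have hp : p ∈ (chartOf (n := m) p).1.source := mem_chart_source (E m) p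
    have h1 := ((contDiffOn_lapIn D S (chartOf p) (contDiffOn_comp_symm _ f)).contDiffAt
      ((chartOf p).1.open_target.mem_nhds ((chartOf p).1.map_source hp))).contMDiffAt.comp p
      (contMDiffAt_chart (chartOf p) hp)
    refine h1.congr_of_eventuallyEq ?_
    filter_upwards [(chartOf (n := m) p).1.open_source.mem_nhds hp] with q hq
    exact hL f (chartOf p) q hq
  refine ⟨{ toFun := fun f => ⟨L₀ f, hsm f⟩, map_add' := ?_, map_smul' := ?_ }, ?_⟩
  · intro f g
    ext p
    exact lapIn_add D S ((chartOf p).1.map_source (mem_chart_source (E m) p))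
      (contDiffOn_comp_symm _ f) (contDiffOn_comp_symm _ g)
  · intro c f
    ext p
    exact lapIn_const_mul D S _ _ c _
  -- The operator was built from one representative `D`; any other enters the formula through Π
  -- only, and so gives the same expression.
  · intro D' hD' e f x hx
    have h1 := hL f e (e.1.symm x) (e.1.map_target hx)
    rw [e.1.right_inv hx] at h1
    refine h1.trans ?_
    simp only [lapIn, fun k i j => Connection.Mem.projCoeff_eq hD' hD e hx k i j]

lemma IsProjectiveLaplacian.unique {P : ProjectiveClass m N} {S : SymTensor m N}
    {L L' : C^∞⟮𝓘(ℝ, E m), N; ℝ⟯ →ₗ[ℝ] C^∞⟮𝓘(ℝ, E m), N; ℝ⟯} (h : IsProjectiveLaplacian P S L)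
    (h' : IsProjectiveLaplacian P S L') : L = L' := by
  obtain ⟨D, hD⟩ := Quotient.exists_rep P
  ext f p
  have hp := mem_chart_source (E m) p
  have h1 := h D hD (chartOf p) f _ ((chartOf p).1.map_source hp)
  rw [← h' D hD (chartOf p) f _ ((chartOf p).1.map_source hp)] at h1
  have h2 : (chartOf (n := m) p).1.symm ((chartOf p).1 p) = p := (chartOf p).1.left_inv hp
  rwa [h2] at h1

lemma SymTensor.form_mfderiv (S : SymTensor m N) (e : Chart m N) {x : E m} (hx : x ∈ e.1.target)
    (f g : C^∞⟮𝓘(ℝ, E m), N; ℝ⟯) :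
    S.form (e.1.symm x) (mfderiv 𝓘(ℝ, E m) 𝓘(ℝ, ℝ) f (e.1.symm x))
      (mfderiv 𝓘(ℝ, E m) 𝓘(ℝ, ℝ) g (e.1.symm x)) =
      ∑ i, ∑ j, S.comp e i j x * pd i (f ∘ e.1.symm) x * pd j (g ∘ e.1.symm) x := by
  have h1 : ∀ f : C^∞⟮𝓘(ℝ, E m), N; ℝ⟯, DifferentiableAt ℝ (f ∘ e.1.symm) x := fun f =>
    differentiableAt_of_contDiffOn e.1.open_target (contDiffOn_comp_symm e f) hx
  rw [mfderiv_eq_fderiv_comp_chartTo hx (h1 f), mfderiv_eq_fderiv_comp_chartTo hx (h1 g)]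
  exact S.chartForm_eq_sum e x _ _

/-- The projective Laplacian generates the bracket of functions given by the tensor field. -/
lemma IsProjectiveLaplacian.leibniz {P : ProjectiveClass m N} {S : SymTensor m N}
    {L : C^∞⟮𝓘(ℝ, E m), N; ℝ⟯ →ₗ[ℝ] C^∞⟮𝓘(ℝ, E m), N; ℝ⟯} (h : IsProjectiveLaplacian P S L)
    (f g : C^∞⟮𝓘(ℝ, E m), N; ℝ⟯) (p : N) :
    L (f * g) p - f p * L g p - L f p * g p + f p * g p * L 1 p =
      2 * S.form p (mfderiv 𝓘(ℝ, E m) 𝓘(ℝ, ℝ) f p) (mfderiv 𝓘(ℝ, E m) 𝓘(ℝ, ℝ) g p) := by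
  obtain ⟨D, hD⟩ := Quotient.exists_rep P
  obtain ⟨e, x, hx, rfl⟩ : ∃ (e : Chart m N) (x : E m), x ∈ e.1.target ∧ e.1.symm x = p :=
    ⟨chartOf p, (chartOf p).1 p, (chartOf p).1.map_source (mem_chart_source (E m) p),
      (chartOf p).1.left_inv (mem_chart_source (E m) p)⟩
  have hl : ∀ f, L f (e.1.symm x) = lapIn D S e (f ∘ e.1.symm) x := fun f => h D hD e f x hx
  have h1 : L 1 (e.1.symm x) = 0 := (hl 1).trans (lapIn_const D S e x 1)
  have h2 : L (f * g) (e.1.symm x) = f (e.1.symm x) * lapIn D S e (g ∘ e.1.symm) x +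
      g (e.1.symm x) * lapIn D S e (f ∘ e.1.symm) x +
      2 * ∑ i, ∑ j, S.comp e i j x * pd i (f ∘ e.1.symm) x * pd j (g ∘ e.1.symm) x :=
    (hl (f * g)).trans
    (lapIn_mul D S hx (contDiffOn_comp_symm e f) (contDiffOn_comp_symm e g))
  rw [h1, h2, hl f, hl g, S.form_mfderiv e hx]
  ring

end Laplacian

/-! ### Smooth parameter integrals and Hadamard's lemma -/

section Hadamard

-- The integral is the value at 0 of the convolution of the indicator function of (0, 1] with u ↦
-- χ(u) G(y, -u). The cut-off χ equals 1 on [-2, 2], so it does not affect the integral, and it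
-- supplies the compact support required for smooth dependence on the parameter y.
open MeasureTheory in
lemma contDiff_integral_unitInterval {F : Type*} [NormedAddCommGroup F] [NormedSpace ℝ F]
    {G : F → ℝ → ℝ} (hG : ContDiff ℝ ∞ (Function.uncurry G)) :
    ContDiff ℝ ∞ (fun y => ∫ s in (0 : ℝ)..1, G y s) := by
  let χ : ContDiffBump (0 : ℝ) := ⟨2, 3, by norm_num, by norm_num⟩
  let f : ℝ → ℝ := indicator (Ioc 0 1) fun _ => 1
  let g : F → ℝ → ℝ := fun p u => χ u * G p (-u)
  have hg : ContDiffOn ℝ ((⊤ : ℕ∞) : WithTop ℕ∞) (Function.uncurry g) (univ ×ˢ univ) := by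
    refine ContDiff.contDiffOn ?_
    have h1 : ContDiff ℝ ∞ fun q : F × ℝ => χ q.2 := χ.contDiff.comp contDiff_snd
    have h2 : ContDiff ℝ ∞ fun q : F × ℝ => Function.uncurry G (q.1, -q.2) :=
      hG.comp (contDiff_fst.prodMk contDiff_snd.neg)
    exact h1.mul h2
  have hf : LocallyIntegrable f volume :=
    (locallyIntegrable_const (1 : ℝ)).indicator measurableSet_Ioc
  have h := contDiffOn_convolution_right_with_param (μ := volume)
    (ContinuousLinearMap.mul ℝ ℝ) (f := f) (g := g) (s := univ) (k := tsupport χ) isOpen_univ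
    χ.hasCompactSupport (fun p x _ hx => by
      change χ x * G p (-x) = 0
      rw [image_eq_zero_of_notMem_tsupport hx, zero_mul]) hf hg
  have h' := (contDiffOn_univ.1 (by simpa using h)).comp
    (contDiff_id.prodMk (contDiff_const (c := (0 : ℝ))))
  convert h' using 1
  funext y
  simp only [Function.comp_apply, convolution, id, f, g]
  rw [intervalIntegral.integral_of_le zero_le_one, ← integral_indicator measurableSet_Ioc]
  refine integral_congr_ae (Eventually.of_forall fun t => ?_)
  by_cases ht : t ∈ Ioc (0 : ℝ) 1
  · have h1 : χ (-t) = 1 := χ.one_of_mem_closedBall (by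
      simp only [Metric.mem_closedBall, dist_zero_right, norm_neg, Real.norm_eq_abs]
      rw [abs_of_pos ht.1]
      exact ht.2.trans one_le_two)
    simp [ht, h1]
  · simp [ht]

/-- Hadamard's lemma. -/
lemma exists_hadamard {m : ℕ} {φ : E m → ℝ} (hφ : ContDiff ℝ ∞ φ) (x : E m) :
    ∃ g : Fin m → E m → ℝ, (∀ i, ContDiff ℝ ∞ (g i)) ∧ (∀ i, g i x = pd i φ x) ∧
      ∀ y, φ y = φ x + ∑ i, (y i - x i) * g i y := by
  -- The fundamental theorem of calculus along the segment from `x` to `y` gives these coefficient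
  -- functions.
  refine ⟨fun i y => ∫ s in (0 : ℝ)..1, pd i φ (x + s • (y - x)), fun i => ?_, fun i => ?_,
    fun y => ?_⟩
  · have h1 : ContDiff ℝ ∞ (pd i φ) := contDiff_iff_contDiffAt.2 fun y =>
      contDiffAt_pd hφ.contDiffAt i
    exact contDiff_integral_unitInterval (G := fun y s => pd i φ (x + s • (y - x)))
      (h1.comp (contDiff_const.add (contDiff_snd.smul (contDiff_fst.sub contDiff_const))))
  · simp
  · have h1 : ∀ i, Continuous fun s : ℝ => pd i φ (x + s • (y - x)) := fun i => by
      have h2 : ContDiff ℝ ∞ (pd i φ) := contDiff_iff_contDiffAt.2 fun y =>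
        contDiffAt_pd hφ.contDiffAt i
      exact h2.continuous.comp (by fun_prop)
    have h2 : ∀ s ∈ uIcc (0 : ℝ) 1, HasDerivAt (fun s : ℝ => φ (x + s • (y - x)))
        (∑ i, (y i - x i) * pd i φ (x + s • (y - x))) s := fun s _ => by
      have a1 : HasDerivAt (fun s : ℝ => x + s • (y - x)) (y - x) s := by
        simpa using ((hasDerivAt_id s).smul_const (y - x)).const_add x
      have a2 := (hφ.differentiable (by simp) (x + s • (y - x))).hasFDerivAt.comp_hasDerivAt s a1
      rw [map_eq_sum (fderiv ℝ φ _) (y - x)] at a2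
      exact a2
    have h4 : ∀ i, Continuous fun s : ℝ => (y i - x i) * pd i φ (x + s • (y - x)) :=
      fun i => continuous_const.mul (h1 i)
    have h3 := intervalIntegral.integral_eq_sub_of_hasDerivAt h2
      ((continuous_finsetSum _ fun i _ => h4 i).intervalIntegrable _ _)
    rw [intervalIntegral.integral_finsetSum fun i _ => (h4 i).intervalIntegrable _ _] at h3
    simp only [intervalIntegral.integral_const_mul, one_smul, zero_smul, add_zero,
      add_sub_cancel] at h3
    rw [h3]
    ring

end Hadamard

/-! ### Linear independence of exponentials -/

section Exponentials

/-- Exponential functions with different exponents are linearly independent. -/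
lemma exp_sum_eq_zero {s : Finset ℝ} {c : ℝ → ℝ}
    (h : ∀ t : ℝ, ∑ μ ∈ s, c μ * Real.exp (μ * t) = 0) : ∀ μ ∈ s, c μ = 0 := by
  -- The exponentials are distinct characters of the additive group of reals, so Dedekind's
  -- independence of characters applies.
  let χ : ℝ → (Multiplicative ℝ →* ℝ) := fun μ =>
    { toFun := fun t => Real.exp (μ * t.toAdd)
      map_one' := by simp
      map_mul' := fun a b => by simp [mul_add, Real.exp_add] }
  have hinj : Function.Injective χ := fun μ ν hμν => by
    have := congr($hμν (Multiplicative.ofAdd 1))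
    simpa [χ] using this
  have hl := (linearIndependent_monoidHom (Multiplicative ℝ) ℝ).comp χ hinj
  rw [linearIndependent_iff'] at hl
  refine hl s c ?_
  funext t
  simpa [χ] using h t.toAdd

end Exponentials

/-! ### Densities as functions on M̃ -/

section Coefficients

variable {n : ℕ} {M : Type*} [TopologicalSpace M] [ChartedSpace (E n) M]

lemma crep_of_notMem (φ : Coeff n M) {e : Chart n M} {x : E n} (hx : x ∉ e.1.target) :
    crep φ e x = 0 :=
  Function.extend_apply' _ _ _ (by rintro ⟨a, rfl⟩; exact hx a.2)

@[simp] lemma crep_zero (e : Chart n M) (x : E n) : crep (0 : Coeff n M) e x = 0 := by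
  by_cases hx : x ∈ e.1.target
  · rw [crep_of_mem _ hx]
    rfl
  · exact crep_of_notMem _ hx

lemma crep_smul (c : ℝ) (φ : Coeff n M) (e : Chart n M) (x : E n) :
    crep (c • φ) e x = c * crep φ e x := by
  by_cases hx : x ∈ e.1.target
  · simp [crep_of_mem _ hx]
  · simp [crep_of_notMem _ hx]

lemma Coeff.ext_crep {φ ψ : Coeff n M} (h : ∀ e, ∀ x ∈ e.1.target, crep φ e x = crep ψ e x) :
    φ = ψ := by
  funext e x
  have := h e x x.2
  rwa [crep_of_mem _ x.2, crep_of_mem _ x.2] at this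

lemma dcoeff_smul (c : ℝ) (a : Densities n M) (μ : ℝ) (e : Chart n M) (x : E n) :
    dcoeff (c • a) μ e x = c * dcoeff a μ e x := crep_smul _ _ _ _

lemma contDiffOn_dcoeff (a : Densities n M) (μ : ℝ) (e : Chart n M) :
    ContDiffOn ℝ ∞ (dcoeff a μ e) e.1.target := (a.2 μ).1 e

lemma Densities.ext_dcoeff {a b : Densities n M}
    (h : ∀ μ e, ∀ x ∈ e.1.target, dcoeff a μ e x = dcoeff b μ e x) : a = b := by
  apply Subtype.ext
  apply AddMonoidAlgebra.ext
  exact Finsupp.ext fun μ => Coeff.ext_crep (h μ)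

lemma dcoeff_eq_zero_of_notMem (a : Densities n M) {μ : ℝ} (hμ : μ ∉ a.1.coeff.support)
    (e : Chart n M) (x : E n) : dcoeff a μ e x = 0 := by
  rw [dcoeff, Finsupp.notMem_support_iff.1 hμ, crep_zero]

variable [IsManifold 𝓘(ℝ, E n) ∞ M]

/-- The point of `M̃` with adapted coordinates `(t, x)`. -/
def pt (e : Chart n M) (t : ℝ) (x : E n) : Thomas n M := (thomasChart e).symm (ext0 t x)

lemma proj_pt (e : Chart n M) (t : ℝ) (x : E n) : (pt e t x).proj = e.1.symm x := rfl

lemma exists_pt {e : Chart n M} {q : Thomas n M} (hq : q.proj ∈ e.1.source) :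
    ∃ t x, x ∈ e.1.target ∧ pt e t x = q := by
  have h : q ∈ (thomasChart e).source := by rwa [thomasChart_source]
  obtain ⟨t, x, hx, h1⟩ := exists_ext0 h
  refine ⟨t, x, hx, ?_⟩
  rw [pt, ← h1, (thomasChart e).left_inv h]

lemma exists_chart_pt (q : Thomas n M) : ∃ (e : Chart n M) (t : ℝ) (x : E n),
    x ∈ e.1.target ∧ pt e t x = q :=
  ⟨chartOf q.proj, exists_pt (mem_chart_source (E n) q.proj)⟩

lemma pt_trans {e e' : Chart n M} {x : E n} (hx : x ∈ overlap e e') (t : ℝ) :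
    pt e' (t + logJac e e' x) (coordTrans e e' x) = pt e t x := by
  have h := thomas_trans (t := t) hx
  have h1 : pt e t x ∈ (thomasChart e').source := by
    rw [thomasChart_source]
    exact (mem_overlap.1 hx).2
  rw [pt, logJac, ← h]
  exact (thomasChart e').left_inv h1

lemma toSmooth_pt (a : Densities n M) {e : Chart n M} {x : E n} (hx : x ∈ e.1.target) (t : ℝ)
    {s : Finset ℝ} (hs : a.1.coeff.support ⊆ s) :
    toSmooth a (pt e t x) = ∑ μ ∈ s, dcoeff a μ e x * Real.exp (μ * t) := by
  refine (densityFun_ext0 a e hx t).trans ?_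
  rw [Finsupp.sum]
  refine Finset.sum_subset hs fun μ _ hμ => ?_
  change dcoeff a μ e x * _ = 0
  rw [dcoeff_eq_zero_of_notMem a hμ, zero_mul]

/-- The coefficients of a density are determined by the function on the fibre. -/
lemma dcoeff_of_expansion (a : Densities n M) {e : Chart n M} {x : E n} (hx : x ∈ e.1.target)
    {s : Finset ℝ} {c : ℝ → ℝ}
    (h : ∀ t, toSmooth a (pt e t x) = ∑ μ ∈ s, c μ * Real.exp (μ * t)) (ν : ℝ) :
    dcoeff a ν e x = if ν ∈ s then c ν else 0 := by
  classical
  -- Including `ν` lets its coefficient be compared even when it occurs in neither expansion.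
  set u := a.1.coeff.support ∪ s ∪ {ν} with hu
  have h1 : ∀ t : ℝ, ∑ μ ∈ u, (dcoeff a μ e x - if μ ∈ s then c μ else 0) * Real.exp (μ * t) = 0 := by
    intro t
    simp only [sub_mul, Finset.sum_sub_distrib]
    have hsub : a.1.coeff.support ⊆ u := fun μ hμ =>
      Finset.mem_union_left _ (Finset.mem_union_left _ hμ)
    have hsub' : s ⊆ u := fun μ hμ => Finset.mem_union_left _ (Finset.mem_union_right _ hμ)
    rw [← toSmooth_pt a hx t hsub, h, ← Finset.sum_subset hsub' (fun μ _ hμ => by simp [hμ]),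
      sub_eq_zero]
    exact Finset.sum_congr rfl fun μ hμ => by simp [hμ]
  have h2 := exp_sum_eq_zero h1 ν (Finset.mem_union_right _ (Finset.mem_singleton_self ν))
  linarith

/-- The weights are recovered from a function on M̃ by independence of exponentials on the fibres.
Identities between densities can hence be checked on functions. -/
lemma toSmooth_injective : Function.Injective (toSmooth : Densities n M → _) := by
  intro a b h
  refine Densities.ext_dcoeff fun μ e x hx => ?_
  have h1 := dcoeff_of_expansion a hx (s := b.1.coeff.support) (c := fun μ => dcoeff b μ e x)
    (fun t => by rw [h, toSmooth_pt b hx t subset_rfl]) μ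
  rw [h1]
  split_ifs with hμ
  · rfl
  · exact (dcoeff_eq_zero_of_notMem b hμ e x).symm

/-- The value at a point of `M̃`, as a ring homomorphism. -/
def evalHom (q : Thomas n M) : AddMonoidAlgebra (Coeff n M) ℝ →+* ℝ :=
  AddMonoidAlgebra.liftNCRingHom
    ((Pi.evalRingHom (fun _ : (chartOf (n := n) q.proj).1.target => ℝ)
      ⟨(chartOf q.proj).1 q.proj, (chartOf q.proj).1.map_source (mem_chart_source (E n) q.proj)⟩).comp
      (Pi.evalRingHom (fun e : Chart n M => e.1.target → ℝ) (chartOf q.proj)))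
    { toFun := fun μ => Real.exp (μ.toAdd * (thomasChart (chartOf q.proj) q) 0)
      map_one' := by simp
      map_mul' := fun a b => by simp [add_mul, Real.exp_add] }
    fun _ _ => Commute.all _ _

/-- The universal property of the monoid algebra makes evaluation at a point a ring homomorphism, so
multiplicativity needs no manipulation of double sums. -/
lemma toSmooth_apply_eq_evalHom (a : Densities n M) (q : Thomas n M) :
    toSmooth a q = evalHom q a.1 := by
  change densityFun a q = _
  rw [densityFun]
  conv_rhs => rw [← AddMonoidAlgebra.sum_coeff_single a.1]
  refine Eq.trans ?_ (map_finsuppSum (evalHom q) _ _).symm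
  refine Finsupp.sum_congr fun μ _ => ?_
  rw [evalHom, AddMonoidAlgebra.liftNCRingHom_single,
    crep_of_mem _ ((chartOf q.proj).1.map_source (mem_chart_source (E n) q.proj))]
  rfl

lemma toSmooth_add (a b : Densities n M) : toSmooth (a + b) = toSmooth a + toSmooth b := by
  ext q
  change toSmooth (a + b) q = toSmooth a q + toSmooth b q
  simp only [toSmooth_apply_eq_evalHom]
  exact map_add (evalHom q) _ _

lemma toSmooth_mul (a b : Densities n M) : toSmooth (a * b) = toSmooth a * toSmooth b := by
  ext q
  change toSmooth (a * b) q = toSmooth a q * toSmooth b q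
  simp only [toSmooth_apply_eq_evalHom]
  exact map_mul (evalHom q) _ _

lemma toSmooth_one : toSmooth (1 : Densities n M) = 1 := by
  ext q
  change toSmooth (1 : Densities n M) q = 1
  simp only [toSmooth_apply_eq_evalHom]
  exact map_one (evalHom q)

lemma toSmooth_smul (c : ℝ) (a : Densities n M) : toSmooth (c • a) = c • toSmooth a := by
  ext q
  change toSmooth (c • a) q = c * toSmooth a q
  obtain ⟨e, t, x, hx, rfl⟩ := exists_chart_pt q
  classical
  rw [toSmooth_pt (c • a) hx t (s := (c • a).1.coeff.support ∪ a.1.coeff.support)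
    Finset.subset_union_left, toSmooth_pt a hx t (s := (c • a).1.coeff.support ∪ a.1.coeff.support)
    Finset.subset_union_right, Finset.mul_sum]
  exact Finset.sum_congr rfl fun μ _ => by rw [dcoeff_smul, mul_assoc]

/-- A condition on all coefficients at a point becomes a condition on the function along one fibre;
the converse again uses independence of exponentials. -/
lemma eqAt_iff {a : Densities n M} {e : Chart n M} {x : E n} (hx : x ∈ e.1.target) {c μ : ℝ} :
    EqAt a e x c μ ↔ ∀ t, toSmooth a (pt e t x) = c * Real.exp (μ * t) := by
  classical
  constructor
  · intro h t
    rw [toSmooth_pt a hx t (s := a.1.coeff.support ∪ {μ}) Finset.subset_union_left]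
    simp only [h _, ite_mul, zero_mul]
    rw [Finset.sum_ite_eq' _ _ _, if_pos (Finset.mem_union_right _ (Finset.mem_singleton_self μ))]
  · intro h ν
    rw [dcoeff_of_expansion a hx (s := {μ}) (c := fun _ => c) (fun t => by simp [h t]) ν]
    simp

lemma locallyEq_iff {a : Densities n M} {e : Chart n M} {x : E n} (hx : x ∈ e.1.target)
    {φ : E n → ℝ} {μ : ℝ} : LocallyEq a e x φ μ ↔
      ∀ᶠ y in 𝓝 x, ∀ t, toSmooth a (pt e t y) = φ y * Real.exp (μ * t) := by
  constructor
  · intro h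
    filter_upwards [h, e.1.open_target.mem_nhds hx] with y hy hyt
    exact (eqAt_iff hyt).1 hy
  · intro h
    filter_upwards [h, e.1.open_target.mem_nhds hx] with y hy hyt
    exact (eqAt_iff hyt).2 hy

end Coefficients

/-! ### Cut-off densities and locality of derivations -/

section Cutoff

variable {n : ℕ} {M : Type*} [TopologicalSpace M] [ChartedSpace (E n) M]
  [IsManifold 𝓘(ℝ, E n) ∞ M]

lemma exists_bump [T2Space M] {p : M} {U : Set M} (hU : U ∈ 𝓝 p) :
    ∃ χ : M → ℝ, ContMDiff 𝓘(ℝ, E n) 𝓘(ℝ, ℝ) ∞ χ ∧ tsupport χ ⊆ U ∧ ∀ᶠ r in 𝓝 p, χ r = 1 := by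
  obtain ⟨χ, -, hχ⟩ := (SmoothBumpFunction.nhds_basis_tsupport (I := 𝓘(ℝ, E n)) p).mem_iff.1 hU
  exact ⟨χ, χ.contMDiff, hχ, χ.eventuallyEq_one⟩

lemma contDiffOn_jac_rpow (e e' : Chart n M) (μ : ℝ) :
    ContDiffOn ℝ ∞ (fun x => jac e e' x ^ μ) (overlap e e') := by
  have h : ContDiffOn ℝ ∞ (fun x => Real.exp (logJac e e' x * μ)) (overlap e e') :=
    Real.contDiff_exp.comp_contDiffOn ((contDiffOn_log_jac e e').mul contDiffOn_const)
  exact h.congr fun x hx => Real.rpow_def_of_pos (jac_pos hx) μ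

/-- The coefficients of the density `χ g |Dx|^μ`, for a function `g` of the coordinates of the chart
`e` and a cut-off function `χ`. -/
def cutCoeff (e : Chart n M) (χ : M → ℝ) (g : E n → ℝ) (μ : ℝ) : Coeff n M := fun e' y =>
  χ (e'.1.symm y) * (g (coordTrans e' e y) * jac e' e y ^ μ)

/-- Inside the domain of `e` this is the transformed expression; outside, the coefficients vanish in
a neighbourhood because the support of χ is closed and contained in that domain. The density law is
multiplicativity of the Jacobian. -/
lemma isDensity_cutCoeff (e : Chart n M) {χ : M → ℝ} (hχ : ContMDiff 𝓘(ℝ, E n) 𝓘(ℝ, ℝ) ∞ χ)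
    (hs : tsupport χ ⊆ e.1.source) {g : E n → ℝ} (hg : ContDiffOn ℝ ∞ g e.1.target) (μ : ℝ) :
    IsDensity μ (cutCoeff e χ g μ) := by
  have hrep : ∀ e' : Chart n M, ∀ y ∈ e'.1.target, crep (cutCoeff e χ g μ) e' y =
      χ (e'.1.symm y) * (g (coordTrans e' e y) * jac e' e y ^ μ) := fun e' y hy =>
    crep_of_mem _ hy
  have hzero : ∀ {p : M}, p ∉ e.1.source → χ p = 0 := fun hp =>
    image_eq_zero_of_notMem_tsupport fun h => hp (hs h)
  refine ⟨fun e' => ?_, fun e' e'' y hy => ?_⟩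
  · refine ContDiffOn.congr (fun y hy => ContDiffAt.contDiffWithinAt ?_) (hrep e')
    by_cases h : e'.1.symm y ∈ e.1.source
    · have hov : y ∈ overlap e' e := mem_overlap.2 ⟨hy, h⟩
      have h1 : ContDiffAt ℝ ∞ (χ ∘ e'.1.symm) y :=
        (hχ.contMDiffAt.comp y (contMDiffAt_chart_symm e' hy)).contDiffAt
      have h2 : ContDiffAt ℝ ∞ (fun y => g (coordTrans e' e y)) y :=
        ContDiffAt.comp y (hg.contDiffAt (e.1.open_target.mem_nhds (e.1.map_source h)))
          (contDiffAt_coordTrans hov)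
      exact h1.mul (h2.mul ((contDiffOn_jac_rpow e' e μ).contDiffAt
        ((isOpen_overlap e' e).mem_nhds hov)))
    · have h1 : ∀ᶠ r in 𝓝 (e'.1.symm y), χ r = 0 := by
        filter_upwards [(isClosed_tsupport χ).isOpen_compl.mem_nhds fun h' => h (hs h')] with r hr
        exact image_eq_zero_of_notMem_tsupport hr
      refine (contDiffAt_const (c := (0 : ℝ))).congr_of_eventuallyEq ?_
      filter_upwards [(e'.1.continuousAt_symm hy).eventually h1] with z hz
      rw [hz, zero_mul]
  · rw [hrep e' y (mem_overlap.1 hy).1, hrep e'' _ (mem_overlap.1 (trans_mem hy)).1,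
      symm_coordTrans hy]
    by_cases h : e'.1.symm y ∈ e.1.source
    · have hov : y ∈ overlap e' e := mem_overlap.2 ⟨(mem_overlap.1 hy).1, h⟩
      have hov' : coordTrans e' e'' y ∈ overlap e'' e :=
        mem_overlap.2 ⟨(mem_overlap.1 (trans_mem hy)).1, by rwa [symm_coordTrans hy]⟩
      have h1 : coordTrans e'' e (coordTrans e' e'' y) = coordTrans e' e y := by
        rw [coordTrans, symm_coordTrans hy, coordTrans]
      rw [h1, jac_comp hy hov, Real.mul_rpow (jac_pos hov').le (jac_pos hy).le]
      ring
    · rw [hzero h]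
      simp

/-- The density `χ g |Dx|^μ`. -/
def cut (e : Chart n M) {χ : M → ℝ} (hχ : ContMDiff 𝓘(ℝ, E n) 𝓘(ℝ, ℝ) ∞ χ)
    (hs : tsupport χ ⊆ e.1.source) {g : E n → ℝ} (hg : ContDiffOn ℝ ∞ g e.1.target) (μ : ℝ) :
    Densities n M :=
  ⟨AddMonoidAlgebra.single μ (cutCoeff e χ g μ), isDensity_single (isDensity_cutCoeff e hχ hs hg μ)⟩

section

variable {e : Chart n M} {χ : M → ℝ} {hχ : ContMDiff 𝓘(ℝ, E n) 𝓘(ℝ, ℝ) ∞ χ}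
  {hs : tsupport χ ⊆ e.1.source} {g : E n → ℝ} {hg : ContDiffOn ℝ ∞ g e.1.target} {μ : ℝ}

lemma homogeneousOfWeight_cut : HomogeneousOfWeight (cut e hχ hs hg μ) μ := fun ν hν => by
  change (AddMonoidAlgebra.single μ (cutCoeff e χ g μ)).coeff ν = 0
  rw [AddMonoidAlgebra.coeff_single]
  exact Finsupp.single_eq_of_ne hν

lemma toSmooth_cut_eq_sum (e' : Chart n M) {x : E n} (hx : x ∈ e'.1.target) (t : ℝ) :
    toSmooth (cut e hχ hs hg μ) (pt e' t x) =
      χ (e'.1.symm x) * (g (coordTrans e' e x) * jac e' e x ^ μ) * Real.exp (μ * t) := by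
  have h1 : (cut e hχ hs hg μ).1.coeff.support ⊆ {μ} := by
    change (AddMonoidAlgebra.single μ (cutCoeff e χ g μ)).coeff.support ⊆ _
    rw [AddMonoidAlgebra.coeff_single]
    exact Finsupp.support_single_subset
  rw [toSmooth_pt _ hx t h1, Finset.sum_singleton, dcoeff]
  change crep ((AddMonoidAlgebra.single μ (cutCoeff e χ g μ)).coeff μ) e' x * _ = _
  rw [AddMonoidAlgebra.coeff_single, Finsupp.single_eq_same, crep_of_mem _ hx]
  rfl

lemma toSmooth_cut {x : E n} (hx : x ∈ e.1.target) (t : ℝ) :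
    toSmooth (cut e hχ hs hg μ) (pt e t x) = χ (e.1.symm x) * g x * Real.exp (μ * t) := by
  have h : coordTrans e e x = x := by rw [coordTrans, e.1.right_inv hx]
  rw [toSmooth_cut_eq_sum e hx, h, jac_self hx, Real.one_rpow, mul_one]

lemma toSmooth_cut_eq_zero {q : Thomas n M} (hq : χ q.proj = 0) :
    toSmooth (cut e hχ hs hg μ) q = 0 := by
  obtain ⟨e', t, x, hx, rfl⟩ := exists_chart_pt q
  rw [toSmooth_cut_eq_sum e' hx]
  rw [proj_pt] at hq
  rw [hq]
  simp

end

/-- Existence of densities with given local expression. -/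
lemma exists_locallyEq [T2Space M] (e : Chart n M) {x : E n} (hx : x ∈ e.1.target) {g : E n → ℝ}
    (hg : ContDiffOn ℝ ∞ g e.1.target) (μ : ℝ) :
    ∃ a : Densities n M, HomogeneousOfWeight a μ ∧ LocallyEq a e x g μ := by
  obtain ⟨χ, hχ, hs, h1⟩ := exists_bump (n := n) (e.1.open_source.mem_nhds (e.1.map_target hx))
  refine ⟨cut e hχ hs hg μ, homogeneousOfWeight_cut, (locallyEq_iff hx).2 ?_⟩
  filter_upwards [(e.1.continuousAt_symm hx).eventually h1, e.1.open_target.mem_nhds hx] with y hy hyt t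
  rw [toSmooth_cut hyt, hy, one_mul]

/-- Derivations of the algebra of densities are local. -/
lemma derivation_local [T2Space M] (X : Derivation ℝ (Densities n M) (Densities n M))
    {a : Densities n M} {e : Chart n M} {x : E n} (hx : x ∈ e.1.target)
    (h : ∀ᶠ y in 𝓝 x, ∀ t, toSmooth a (pt e t y) = 0) (t : ℝ) :
    toSmooth (X a) (pt e t x) = 0 := by
  obtain ⟨V, hV, hVo, hxV⟩ := mem_nhds_iff.1 (inter_mem h (e.1.open_target.mem_nhds hx))
  have hU : e.1.source ∩ e.1 ⁻¹' V ∈ 𝓝 (e.1.symm x) :=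
    (e.1.isOpen_inter_preimage hVo).mem_nhds ⟨e.1.map_target hx, by
      simpa [e.1.right_inv hx] using hxV⟩
  obtain ⟨χ, hχ, hs, h1⟩ := exists_bump (n := n) hU
  have hg : ContDiffOn ℝ ∞ (fun _ : E n => (1 : ℝ)) e.1.target := contDiffOn_const
  set c := cut e hχ (hs.trans inter_subset_left) hg 0 with hc
  -- The cut-off `c` is supported where `a` vanishes and equals 1 near the point. Applying the
  -- Leibniz rule to ca = 0 and evaluating, where a = 0 and c = 1, leaves the value of X a.
  have h0 : c * a = 0 := by
    apply toSmooth_injective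
    have hz : toSmooth (0 : Densities n M) = 0 := by
      have := toSmooth_smul (0 : ℝ) (0 : Densities n M)
      rwa [zero_smul, zero_smul] at this
    rw [toSmooth_mul, hz]
    ext q
    change toSmooth c q * toSmooth a q = 0
    by_cases hq : q.proj ∈ tsupport χ
    · obtain ⟨t, y, hy, rfl⟩ := exists_pt (hs hq).1
      have hyV := (hs hq).2
      rw [proj_pt, mem_preimage, e.1.right_inv hy] at hyV
      rw [(hV hyV).1 t, mul_zero]
    · rw [toSmooth_cut_eq_zero (image_eq_zero_of_notMem_tsupport hq), zero_mul]
  have h2 := X.leibniz c a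
  rw [h0, map_zero] at h2
  have h3 : toSmooth (c • X a + a • X c) (pt e t x) = toSmooth (0 : Densities n M) (pt e t x) := by
    rw [h2]
  have hz : toSmooth (0 : Densities n M) = 0 := by
    have := toSmooth_smul (0 : ℝ) (0 : Densities n M)
    rwa [zero_smul, zero_smul] at this
  rw [smul_eq_mul, smul_eq_mul, toSmooth_add, toSmooth_mul, toSmooth_mul, hz] at h3
  change toSmooth c (pt e t x) * toSmooth (X a) (pt e t x) +
    toSmooth a (pt e t x) * toSmooth (X c) (pt e t x) = 0 at h3
  rw [h.self_of_nhds t, toSmooth_cut hx, h1.self_of_nhds] at h3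
  simpa using h3

lemma derivation_congr [T2Space M] (X : Derivation ℝ (Densities n M) (Densities n M))
    {a b : Densities n M} {e : Chart n M} {x : E n} (hx : x ∈ e.1.target)
    (h : ∀ᶠ y in 𝓝 x, ∀ t, toSmooth a (pt e t y) = toSmooth b (pt e t y)) (t : ℝ) :
    toSmooth (X a) (pt e t x) = toSmooth (X b) (pt e t x) := by
  have hd : ∀ (a b : Densities n M) (q : Thomas n M),
      toSmooth (a + (-1 : ℝ) • b) q = toSmooth a q - toSmooth b q := fun a b q => by
    rw [toSmooth_add, toSmooth_smul]
    change toSmooth a q + -1 * toSmooth b q = _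
    ring
  have h1 := derivation_local X (a := a + (-1 : ℝ) • b) hx (by
    filter_upwards [h] with y hy t
    rw [hd]
    exact sub_eq_zero.2 (hy t)) t
  rw [X.map_add, X.map_smul, hd] at h1
  exact sub_eq_zero.1 h1

end Cutoff

/-! ### Derivatives of functions h(x) e^{μx⁰} -/

section Lift

variable {n : ℕ}

/-- The function `h(x) e^{μ x⁰}`. -/
def liftExp (h : E n → ℝ) (μ : ℝ) (z : E (n + 1)) : ℝ := h (tl z) * Real.exp (μ * hd z)

lemma hasFDerivAt_liftExp {h : E n → ℝ} {z : E (n + 1)} (hh : DifferentiableAt ℝ h (tl z)) (μ : ℝ) :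
    HasFDerivAt (liftExp h μ) (h (tl z) • Real.exp (μ * hd z) • (μ • hd) +
      Real.exp (μ * hd z) • (fderiv ℝ h (tl z)).comp tl) z := by
  have h1 := hh.hasFDerivAt.comp z (tl (n := n)).hasFDerivAt
  have h2 : HasFDerivAt (fun z => μ * hd z) (μ • (hd (n := n))) z :=
    (hd (n := n)).hasFDerivAt.const_mul μ
  exact h1.mul h2.exp

lemma pd_succ_liftExp {h : E n → ℝ} {z : E (n + 1)} (hh : DifferentiableAt ℝ h (tl z)) (μ : ℝ)
    (i : Fin n) : pd i.succ (liftExp h μ) z = liftExp (pd i h) μ z := by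
  rw [pd, (hasFDerivAt_liftExp hh μ).fderiv]
  change h (tl z) * (Real.exp (μ * hd z) * (μ * hd (sgl i.succ))) +
    Real.exp (μ * hd z) * fderiv ℝ h (tl z) (tl (sgl i.succ)) = _
  rw [sgl_succ_eq]
  simp [liftExp, pd, mul_comm]

lemma pd_zero_liftExp {h : E n → ℝ} {z : E (n + 1)} (hh : DifferentiableAt ℝ h (tl z)) (μ : ℝ) :
    pd 0 (liftExp h μ) z = μ * liftExp h μ z := by
  rw [pd, (hasFDerivAt_liftExp hh μ).fderiv]
  change h (tl z) * (Real.exp (μ * hd z) * (μ * hd (sgl 0))) +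
    Real.exp (μ * hd z) * fderiv ℝ h (tl z) (tl (sgl 0)) = _
  rw [sgl_zero_eq]
  simp [liftExp]
  ring

lemma contDiffOn_liftExp {h : E n → ℝ} {s : Set (E n)} (hh : ContDiffOn ℝ ∞ h s) (μ : ℝ) :
    ContDiffOn ℝ ∞ (liftExp h μ) (tl ⁻¹' s) :=
  (hh.comp (tl (n := n)).contDiff.contDiffOn fun _ hz => hz).mul
    (Real.contDiff_exp.comp (contDiff_const.mul (hd (n := n)).contDiff)).contDiffOn

lemma liftExp_ext0 (h : E n → ℝ) (μ t : ℝ) (x : E n) :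
    liftExp h μ (ext0 t x) = h x * Real.exp (μ * t) := by
  simp [liftExp]

end Lift

/-! ### The bracket as a first-order expression in both arguments -/

section Formula

variable {n : ℕ} {M : Type*} [TopologicalSpace M] [T2Space M] [ChartedSpace (E n) M]
  [IsManifold 𝓘(ℝ, E n) ∞ M]

/-- The expression of the function of a density in the adapted chart. -/
def fnIn (e : Chart n M) (a : Densities n M) (z : E (n + 1)) : ℝ :=
  toSmooth a ((adapted e).1.symm z)

lemma fnIn_ext0 (e : Chart n M) (a : Densities n M) (t : ℝ) (x : E n) :
    fnIn e a (ext0 t x) = toSmooth a (pt e t x) := rfl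

lemma fnIn_eq (e : Chart n M) (a : Densities n M) (z : E (n + 1)) :
    fnIn e a z = toSmooth a (pt e (hd z) (tl z)) := by
  rw [← fnIn_ext0, ext0_hd_tl]

lemma fnIn_eq_sum {e : Chart n M} (a : Densities n M) {z : E (n + 1)} (hz : tl z ∈ e.1.target)
    {s : Finset ℝ} (hs : a.1.coeff.support ⊆ s) :
    fnIn e a z = ∑ μ ∈ s, liftExp (dcoeff a μ e) μ z := by
  rw [fnIn_eq, toSmooth_pt a hz _ hs]
  rfl

lemma isOpen_tl_target (e : Chart n M) : IsOpen (tl ⁻¹' e.1.target : Set (E (n + 1))) :=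
  e.1.open_target.preimage (tl (n := n)).continuous

lemma pd_succ_fnIn {e : Chart n M} (a : Densities n M) {z : E (n + 1)} (hz : tl z ∈ e.1.target)
    {s : Finset ℝ} (hs : a.1.coeff.support ⊆ s) (i : Fin n) :
    pd i.succ (fnIn e a) z = ∑ μ ∈ s, liftExp (pd i (dcoeff a μ e)) μ z := by
  rw [pd_congr (isOpen_tl_target e) (fun y hy => fnIn_eq_sum a hy hs) hz,
    pd_sum s (isOpen_tl_target e) (fun μ _ => contDiffOn_liftExp (contDiffOn_dcoeff a μ e) μ) hz]
  exact Finset.sum_congr rfl fun μ _ => pd_succ_liftExp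
    (differentiableAt_of_contDiffOn e.1.open_target (contDiffOn_dcoeff a μ e) hz) μ i

lemma pd_zero_fnIn {e : Chart n M} (a : Densities n M) {z : E (n + 1)} (hz : tl z ∈ e.1.target)
    {s : Finset ℝ} (hs : a.1.coeff.support ⊆ s) :
    pd 0 (fnIn e a) z = ∑ μ ∈ s, μ * liftExp (dcoeff a μ e) μ z := by
  rw [pd_congr (isOpen_tl_target e) (fun y hy => fnIn_eq_sum a hy hs) hz,
    pd_sum s (isOpen_tl_target e) (fun μ _ => contDiffOn_liftExp (contDiffOn_dcoeff a μ e) μ) hz]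
  exact Finset.sum_congr rfl fun μ _ => pd_zero_liftExp
    (differentiableAt_of_contDiffOn e.1.open_target (contDiffOn_dcoeff a μ e) hz) μ

/-- The tangent vector at a point given by a derivation, as a functional. -/
def pointDer (X : Derivation ℝ (Densities n M) (Densities n M)) (q : Thomas n M) :
    Densities n M →ₗ[ℝ] ℝ where
  toFun b := toSmooth (X b) q
  map_add' b c := by
    rw [X.map_add, toSmooth_add]
    rfl
  map_smul' r b := by
    rw [X.map_smul, toSmooth_smul]
    rfl

lemma pointDer_apply (X : Derivation ℝ (Densities n M) (Densities n M)) (q : Thomas n M)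
    (b : Densities n M) : pointDer X q b = toSmooth (X b) q := rfl

lemma pointDer_mul (X : Derivation ℝ (Densities n M) (Densities n M)) (q : Thomas n M)
    (b c : Densities n M) :
    pointDer X q (b * c) = toSmooth b q * pointDer X q c + toSmooth c q * pointDer X q b := by
  simp only [pointDer_apply]
  rw [X.leibniz, smul_eq_mul, smul_eq_mul, toSmooth_add, toSmooth_mul, toSmooth_mul]
  rfl

lemma pointDer_one (X : Derivation ℝ (Densities n M) (Densities n M)) (q : Thomas n M) :
    pointDer X q 1 = 0 := by
  have h := pointDer_mul X q 1 1
  have h1 : toSmooth (1 : Densities n M) q = 1 := by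
    rw [toSmooth_one]
    rfl
  rw [mul_one, h1] at h
  linarith

/-- The value at a point, as a linear functional. -/
def pointVal (q : Thomas n M) : Densities n M →ₗ[ℝ] ℝ where
  toFun b := toSmooth b q
  map_add' b c := by
    rw [toSmooth_add]
    rfl
  map_smul' r b := by
    rw [toSmooth_smul]
    rfl

lemma pointVal_apply (q : Thomas n M) (b : Densities n M) : pointVal q b = toSmooth b q := rfl

lemma pointVal_mul (q : Thomas n M) (b c : Densities n M) :
    pointVal q (b * c) = pointVal q b * pointVal q c := by
  simp only [pointVal_apply, toSmooth_mul]
  rfl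

lemma pointVal_one (q : Thomas n M) : pointVal q (1 : Densities n M) = 1 := by
  rw [pointVal_apply, toSmooth_one]
  rfl

lemma pointDer_congr (X : Derivation ℝ (Densities n M) (Densities n M))
    {a b : Densities n M} {e : Chart n M} {x : E n} (hx : x ∈ e.1.target)
    (h : ∀ᶠ y in 𝓝 x, ∀ t, pointVal (pt e t y) a = pointVal (pt e t y) b) (t : ℝ) :
    pointDer X (pt e t x) a = pointDer X (pt e t x) b := derivation_congr X hx h t

lemma LocallyEq.eventually_pointVal {a : Densities n M} {e : Chart n M} {x : E n}
    (hx : x ∈ e.1.target) {φ : E n → ℝ} {μ : ℝ} (h : LocallyEq a e x φ μ) :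
    ∀ᶠ y in 𝓝 x, ∀ t, pointVal (pt e t y) a = φ y * Real.exp (μ * t) := (locallyEq_iff hx).1 h

/-- The value of a derivation on a local function. -/
lemma pointDer_function (X : Derivation ℝ (Densities n M) (Densities n M)) {e : Chart n M}
    {x : E n} (hx : x ∈ e.1.target) {ξ : Fin n → Densities n M}
    (hξ : ∀ i, LocallyEq (ξ i) e x (fun y => y i) 0) {b : Densities n M} {φ : E n → ℝ}
    (hφ : ContDiffOn ℝ ∞ φ e.1.target) (hb : LocallyEq b e x φ 0) (t : ℝ) :
    pointDer X (pt e t x) b = ∑ i, pd i φ x * pointDer X (pt e t x) (ξ i) := by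
  -- Hadamard's lemma above requires a function smooth on all of coordinate space; locality permits
  -- multiplying φ by a cut-off.
  obtain ⟨χ, hχ, hs, h1⟩ := exists_bump (n := n) (M := E n) (e.1.open_target.mem_nhds hx)
  have hχφ : ContDiff ℝ ∞ (fun y => χ y * φ y) := contDiff_iff_contDiffAt.2 fun y => by
    by_cases hy : y ∈ e.1.target
    · exact hχ.contDiff.contDiffAt.mul (hφ.contDiffAt (e.1.open_target.mem_nhds hy))
    · refine (contDiffAt_const (c := (0 : ℝ))).congr_of_eventuallyEq ?_
      filter_upwards [(isClosed_tsupport χ).isOpen_compl.mem_nhds fun h' => hy (hs h')] with r hr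
      rw [image_eq_zero_of_notMem_tsupport hr, zero_mul]
  have heq : (fun y => χ y * φ y) =ᶠ[𝓝 x] φ := by
    filter_upwards [h1] with y hy
    rw [hy, one_mul]
  obtain ⟨g, hg, hgx, hgy⟩ := exists_hadamard hχφ x
  choose G hGw hG using fun i => exists_locallyEq e hx (hg i).contDiffOn (0 : ℝ)
  have hpd : ∀ i, g i x = pd i φ x := fun i => by rw [hgx, pd, pd, heq.fderiv_eq]
  -- The Hadamard expansion realised by global elements of the algebra. The derivation kills the
  -- constant and the factors ξ_i - x_i vanish at the point, so only the values G_i(x) = ∂_iφ(x)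
  -- survive.
  set d : Densities n M := φ x • 1 + ∑ i, (ξ i + (-x i) • 1) * G i with hd
  have hξ' : ∀ᶠ y in 𝓝 x, ∀ i t, pointVal (pt e t y) (ξ i) = y i := by
    rw [eventually_all]
    intro i
    filter_upwards [(hξ i).eventually_pointVal hx] with y hy t
    simp [hy t]
  have hG' : ∀ᶠ y in 𝓝 x, ∀ i t, pointVal (pt e t y) (G i) = g i y := by
    rw [eventually_all]
    intro i
    filter_upwards [(hG i).eventually_pointVal hx] with y hy t
    simp [hy t]
  have hbd := pointDer_congr X (a := b) (b := d) hx (by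
    filter_upwards [hξ', hG', hb.eventually_pointVal hx, heq] with y a1 a2 a3 a4 t
    rw [a3 t, ← a4, hgy y, hd]
    simp only [map_add, map_sum, map_smul, pointVal_mul, pointVal_one, a1, a2, heq.eq_of_nhds,
      smul_eq_mul, mul_one, zero_mul, Real.exp_zero]
    congr 1) t
  have b1 : ∀ i, pointVal (pt e t x) (ξ i + (-x i) • 1) = 0 := fun i => by
    simp [map_add, map_smul, pointVal_one, hξ'.self_of_nhds i t]
  rw [hbd, hd]
  simp only [map_add, map_smul, map_sum, pointDer_mul, pointDer_one, ← pointVal_apply,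
    smul_eq_mul, mul_zero, zero_add, add_zero]
  refine Finset.sum_congr rfl fun i _ => ?_
  have b2 := b1 i
  simp only [map_add, map_smul, smul_eq_mul] at b2
  rw [b2, hG'.self_of_nhds i t, hpd]
  ring

/-- The value of the bracket at a point, as a functional of the second argument. -/
def brk (B : AlgBracket (Densities n M)) (q : Thomas n M) (a : Densities n M) :
    Densities n M →ₗ[ℝ] ℝ := pointDer (B.der a) q

lemma brk_apply (B : AlgBracket (Densities n M)) (q : Thomas n M) (a b : Densities n M) :
    brk B q a b = toSmooth (B.der a b) q := rfl

lemma brk_symm (B : AlgBracket (Densities n M)) (q : Thomas n M) (a b : Densities n M) :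
    brk B q a b = brk B q b a := congrArg (fun c => toSmooth c q) (B.symm a b)

lemma brk_mul (B : AlgBracket (Densities n M)) (q : Thomas n M) (a b c : Densities n M) :
    brk B q a (b * c) = pointVal q b * brk B q a c + pointVal q c * brk B q a b :=
  pointDer_mul _ q b c

lemma brk_congr_right (B : AlgBracket (Densities n M)) (a : Densities n M) {b b' : Densities n M}
    {e : Chart n M} {x : E n} (hx : x ∈ e.1.target)
    (h : ∀ᶠ y in 𝓝 x, ∀ t, pointVal (pt e t y) b = pointVal (pt e t y) b') (t : ℝ) :
    brk B (pt e t x) a b = brk B (pt e t x) a b' := pointDer_congr (B.der a) hx h t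

lemma brk_function (B : AlgBracket (Densities n M)) (a : Densities n M) {e : Chart n M}
    {x : E n} (hx : x ∈ e.1.target) {ξ : Fin n → Densities n M}
    (hξ : ∀ i, LocallyEq (ξ i) e x (fun y => y i) 0) {b : Densities n M} {φ : E n → ℝ}
    (hφ : ContDiffOn ℝ ∞ φ e.1.target) (hb : LocallyEq b e x φ 0) (t : ℝ) :
    brk B (pt e t x) a b = ∑ i, pd i φ x * brk B (pt e t x) a (ξ i) :=
  pointDer_function (B.der a) hx hξ hφ hb t

/-- The power rule at the level of functions. -/
lemma PowerRule.brk_eq {B : AlgBracket (Densities n M)} (hpow : PowerRule B) {e : Chart n M}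
    {x : E n} (hx : x ∈ e.1.target) {s : ℝ} {r u : Densities n M} (a : Densities n M)
    (hr : LocallyEq r e x (fun _ => 1) 1) (hu : LocallyEq u e x (fun _ => 1) s) (t : ℝ) :
    brk B (pt e t x) a u = s * Real.exp ((s - 1) * t) * brk B (pt e t x) a r := by
  classical
  have h := hpow e x hx s r u a hr hu
  rw [brk_symm B _ a u, brk_symm B _ a r, brk_apply, brk_apply]
  generalize B.der u a = c at h
  generalize B.der r a = d at h
  -- A finite set of weights large enough for one bracket which, shifted by s - 1, also covers the
  -- weights of the other.
  set S : Finset ℝ := d.1.coeff.support ∪ c.1.coeff.support.image (fun μ => μ - s + 1) with hS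
  have hinj : Function.Injective (fun ν : ℝ => ν + s - 1) := fun a b hab => by
    simpa using hab
  have h1 : c.1.coeff.support ⊆ S.image (fun ν => ν + s - 1) := fun μ hμ => by
    refine Finset.mem_image.2 ⟨μ - s + 1, Finset.mem_union_right _
      (Finset.mem_image_of_mem _ hμ), by ring⟩
  rw [toSmooth_pt _ hx t h1, toSmooth_pt _ hx t (Finset.subset_union_left : _ ⊆ S),
    Finset.sum_image hinj.injOn, Finset.mul_sum]
  refine Finset.sum_congr rfl fun ν _ => ?_
  rw [h ν, show (ν + s - 1) * t = (s - 1) * t + ν * t by ring, Real.exp_add]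
  ring

/-- The value of the bracket on a local density. -/
lemma brk_homogeneous {B : AlgBracket (Densities n M)} (hpow : PowerRule B)
    (a : Densities n M) {e : Chart n M} {x : E n} (hx : x ∈ e.1.target)
    {ξ : Fin n → Densities n M} (hξ : ∀ i, LocallyEq (ξ i) e x (fun y => y i) 0)
    {ρ : Densities n M} (hρ : LocallyEq ρ e x (fun _ => 1) 1) {b : Densities n M} {φ : E n → ℝ}
    {μ : ℝ} (hφ : ContDiffOn ℝ ∞ φ e.1.target) (hb : LocallyEq b e x φ μ) (t : ℝ) :
    brk B (pt e t x) a b =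
      ∑ i, pd i φ x * Real.exp (μ * t) * brk B (pt e t x) a (ξ i) +
        μ * φ x * Real.exp (μ * t) * (Real.exp (-t) * brk B (pt e t x) a ρ) := by
  -- Locally φ|Dx|^μ is the product of a function and a power of |Dx|, handled by Hadamard's lemma
  -- and by the power rule respectively.
  obtain ⟨c, -, hc⟩ := exists_locallyEq e hx hφ (0 : ℝ)
  obtain ⟨u, -, hu⟩ := exists_locallyEq e hx (g := fun _ => 1) contDiffOn_const μ
  have h1 := brk_congr_right B a (b := b) (b' := c * u) hx (by
    filter_upwards [hb.eventually_pointVal hx, hc.eventually_pointVal hx,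
      hu.eventually_pointVal hx] with y a1 a2 a3 t
    rw [pointVal_mul, a1, a2, a3]
    simp) t
  rw [h1, brk_mul, hpow.brk_eq hx a hρ hu, (hc.eventually_pointVal hx).self_of_nhds t,
    (hu.eventually_pointVal hx).self_of_nhds t, brk_function B a hx hξ hφ hc,
    show (μ - 1) * t = μ * t + -t by ring, Real.exp_add, Finset.mul_sum, add_comm]
  congr 1
  · exact Finset.sum_congr rfl fun i _ => by ring
  · simp
    ring

/-- The first-order formula for the bracket in adapted coordinates. -/
lemma brk_formula {B : AlgBracket (Densities n M)} (hpow : PowerRule B)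
    (a : Densities n M) {e : Chart n M} {x : E n} (hx : x ∈ e.1.target)
    {ξ : Fin n → Densities n M} (hξ : ∀ i, LocallyEq (ξ i) e x (fun y => y i) 0)
    {ρ : Densities n M} (hρ : LocallyEq ρ e x (fun _ => 1) 1) (b : Densities n M) (t : ℝ) :
    brk B (pt e t x) a b =
      ∑ i, pd i.succ (fnIn e b) (ext0 t x) * brk B (pt e t x) a (ξ i) +
        pd 0 (fnIn e b) (ext0 t x) * (Real.exp (-t) * brk B (pt e t x) a ρ) := by
  set s := b.1.coeff.support with hs
  -- By locality `b` may be replaced by the finite sum of representatives of its homogeneous parts.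
  choose c hcw hc using fun μ => exists_locallyEq e hx (contDiffOn_dcoeff b μ e) μ
  have hz : tl (ext0 t x) ∈ e.1.target := by rwa [tl_ext0]
  have h1 := brk_congr_right B a (b := b) (b' := ∑ μ ∈ s, c μ) hx (by
    have hev : ∀ᶠ y in 𝓝 x, ∀ μ ∈ s, ∀ t,
        pointVal (pt e t y) (c μ) = dcoeff b μ e y * Real.exp (μ * t) := by
      rw [Filter.eventually_all_finset]
      exact fun μ _ => (hc μ).eventually_pointVal hx
    filter_upwards [hev, e.1.open_target.mem_nhds hx] with y hy hyt t
    rw [map_sum, pointVal_apply, toSmooth_pt b hyt t subset_rfl]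
    exact (Finset.sum_congr rfl fun μ hμ => hy μ hμ t).symm) t
  rw [h1, map_sum, pd_zero_fnIn b hz subset_rfl]
  simp only [pd_succ_fnIn b hz subset_rfl, Finset.sum_mul]
  rw [Finset.sum_comm, ← Finset.sum_add_distrib]
  refine Finset.sum_congr rfl fun μ _ => ?_
  rw [brk_homogeneous hpow a hx hξ hρ (contDiffOn_dcoeff b μ e) (hc μ) t]
  simp only [liftExp_ext0]
  congr 1
  ring

lemma toSmooth_of_homogeneous {a : Densities n M} {μ : ℝ} (ha : HomogeneousOfWeight a μ)
    {e : Chart n M} {x : E n} (hx : x ∈ e.1.target) (t : ℝ) :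
    toSmooth a (pt e t x) = dcoeff a μ e x * Real.exp (μ * t) := by
  rw [toSmooth_pt a hx t (s := {μ}) (fun ν hν => ?_), Finset.sum_singleton]
  by_contra h
  exact Finsupp.mem_support_iff.1 hν (ha ν (by simpa using h))

/-- Locality in the second argument, and through symmetry in the first. Hence the components of the
bracket do not depend on the global representatives of xⁱ and |Dx|. -/
lemma brk_congr (B : AlgBracket (Densities n M)) {a a' b b' : Densities n M} {e : Chart n M}
    {x : E n} (hx : x ∈ e.1.target) {φ ψ : E n → ℝ} {μ ν : ℝ} (ha : LocallyEq a e x φ μ)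
    (ha' : LocallyEq a' e x φ μ) (hb : LocallyEq b e x ψ ν) (hb' : LocallyEq b' e x ψ ν) (t : ℝ) :
    brk B (pt e t x) a b = brk B (pt e t x) a' b' := by
  have h1 := brk_congr_right B a hx (b := b) (b' := b') (by
    filter_upwards [hb.eventually_pointVal hx, hb'.eventually_pointVal hx] with y h h' t
    rw [h, h']) t
  have h2 := brk_congr_right B b' hx (b := a) (b' := a') (by
    filter_upwards [ha.eventually_pointVal hx, ha'.eventually_pointVal hx] with y h h' t
    rw [h, h']) t
  rw [h1, brk_symm, h2, brk_symm]

lemma eqAt_der_iff (B : AlgBracket (Densities n M)) {a b : Densities n M} {e : Chart n M} {x : E n}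
    (hx : x ∈ e.1.target) {c μ : ℝ} :
    EqAt (B.der a b) e x c μ ↔ ∀ t, brk B (pt e t x) a b = c * Real.exp (μ * t) := eqAt_iff hx

/-- Brackets of local densities have smooth coefficients. -/
lemma exists_component {B : AlgBracket (Densities n M)} {w : ℝ} (hB : HasWeight B w)
    (e : Chart n M) {φ ψ : E n → ℝ} (hφ : ContDiffOn ℝ ∞ φ e.1.target)
    (hψ : ContDiffOn ℝ ∞ ψ e.1.target) (μ ν : ℝ) :
    ∃ K : E n → ℝ, ContDiffOn ℝ ∞ K e.1.target ∧ ∀ x ∈ e.1.target, ∀ a b,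
      LocallyEq a e x φ μ → LocallyEq b e x ψ ν → EqAt (B.der a b) e x (K x) (μ + ν + w) := by
  -- Representatives are chosen separately at every point. Those chosen at `x` also represent the
  -- local sections at nearby points, so near `x` the function `K` is a coefficient of one fixed
  -- density and therefore smooth.
  choose a haw ha using fun x : e.1.target => exists_locallyEq e x.2 hφ μ
  choose b hbw hb using fun x : e.1.target => exists_locallyEq e x.2 hψ ν
  obtain ⟨c, hc⟩ : ∃ c : e.1.target → Densities n M, ∀ x, c x = B.der (a x) (b x) := ⟨_, fun _ => rfl⟩
  have hw : ∀ x, HomogeneousOfWeight (c x) (μ + ν + w) := fun x => by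
    rw [hc]
    exact hB _ _ _ _ (haw x) (hbw x)
  let K₀ : e.1.target → ℝ := fun x => dcoeff (c x) (μ + ν + w) e x
  let K : E n → ℝ := Function.extend Subtype.val K₀ 0
  have hK : ∀ x : e.1.target, K x = dcoeff (c x) (μ + ν + w) e x := fun x =>
    Subtype.val_injective.extend_apply _ _ x
  have hbc : ∀ x (q : Thomas n M), brk B q (a x) (b x) = toSmooth (c x) q := fun x q => by
    rw [hc]
    rfl
  have hval : ∀ x ∈ e.1.target, ∀ a b, LocallyEq a e x φ μ → LocallyEq b e x ψ ν →
      ∀ t, brk B (pt e t x) a b = K x * Real.exp ((μ + ν + w) * t) := fun x hx a' b' ha' hb' t => by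
    rw [brk_congr B hx ha' (ha ⟨x, hx⟩) hb' (hb ⟨x, hx⟩) t, hK ⟨x, hx⟩, hbc,
      toSmooth_of_homogeneous (hw _) hx]
  refine ⟨K, fun x hx => ?_, fun x hx a b ha hb => (eqAt_der_iff B hx).2 (hval x hx a b ha hb)⟩
  have h1 : ContDiffAt ℝ ∞ (dcoeff (c ⟨x, hx⟩) (μ + ν + w) e) x :=
    (contDiffOn_dcoeff _ _ e).contDiffAt (e.1.open_target.mem_nhds hx)
  refine (h1.congr_of_eventuallyEq ?_).contDiffWithinAt
  filter_upwards [(ha ⟨x, hx⟩).eventually_nhds, (hb ⟨x, hx⟩).eventually_nhds,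
    e.1.open_target.mem_nhds hx] with y hay hby hy
  have := hval y hy _ _ hay hby 0
  rw [hbc, toSmooth_of_homogeneous (hw _) hy] at this
  simpa using this.symm

/-- The bracket has smooth components in every chart. -/
theorem exists_components {B : AlgBracket (Densities n M)} {w : ℝ} (hB : HasWeight B w)
    (e : Chart n M) : ∃ (S : Fin n → Fin n → E n → ℝ) (γ : Fin n → E n → ℝ) (θ : E n → ℝ),
      HasComponents B w e S γ θ ∧ (∀ i j, ContDiffOn ℝ ∞ (S i j) e.1.target) ∧
        (∀ i, ContDiffOn ℝ ∞ (γ i) e.1.target) ∧ ContDiffOn ℝ ∞ θ e.1.target := by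
  have hc : ∀ i : Fin n, ContDiffOn ℝ ∞ (fun y : E n => y i) e.1.target := fun i =>
    (EuclideanSpace.proj (𝕜 := ℝ) i).contDiff.contDiffOn
  have h1 : ContDiffOn ℝ ∞ (fun _ : E n => (1 : ℝ)) e.1.target := contDiffOn_const
  choose S hS hS' using fun i j => exists_component hB e (hc i) (hc j) 0 0
  choose γ hγ hγ' using fun i => exists_component hB e (hc i) h1 0 1
  obtain ⟨θ, hθ, hθ'⟩ := exists_component hB e h1 h1 1 1
  refine ⟨S, γ, θ, fun x hx => ⟨fun i j a b ha hb => ?_, fun i a b ha hb => ?_, fun a b ha hb => ?_⟩,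
    hS, hγ, hθ⟩
  · have := hS' i j x hx a b ha hb
    rwa [show (0 : ℝ) + 0 + w = w by ring] at this
  · have := hγ' i x hx a b ha hb
    rwa [show (0 : ℝ) + 1 + w = w + 1 by ring] at this
  · have := hθ' x hx a b ha hb
    rwa [show (1 : ℝ) + 1 + w = w + 2 by ring] at this

/-- The matrix of the components of the induced tensor field in adapted coordinates. -/
def compMatrix (w : ℝ) (S : Fin n → Fin n → E n → ℝ) (γ : Fin n → E n → ℝ) (θ : E n → ℝ)
    (A C : Fin (n + 1)) : E (n + 1) → ℝ :=
  liftExp (Fin.cases (Fin.cases θ γ C) (fun i => Fin.cases (γ i) (S i) C) A) w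

/-- The local densities `|Dx|, x¹, …, xⁿ`. -/
def localGen (ρ : Densities n M) (ξ : Fin n → Densities n M) (A : Fin (n + 1)) : Densities n M :=
  Fin.cases ρ ξ A

/-- The factor `e^{-x⁰}` or `1` which makes the differential of a local generator that of a
coordinate. -/
def genFactor (t : ℝ) (A : Fin (n + 1)) : ℝ := Fin.cases (Real.exp (-t)) (fun _ => 1) A

lemma exists_localGen {e : Chart n M} {x : E n} (hx : x ∈ e.1.target) :
    ∃ (ρ : Densities n M) (ξ : Fin n → Densities n M), LocallyEq ρ e x (fun _ => 1) 1 ∧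
      ∀ i, LocallyEq (ξ i) e x (fun y => y i) 0 := by
  choose ξ _ hξ using fun i : Fin n => exists_locallyEq e hx (g := fun y => y i)
    (EuclideanSpace.proj (𝕜 := ℝ) i).contDiff.contDiffOn 0
  obtain ⟨ρ, -, hρ⟩ := exists_locallyEq e hx (g := fun _ => 1) contDiffOn_const 1
  exact ⟨ρ, ξ, hρ, hξ⟩

lemma HasComponents.brk_localGen {B : AlgBracket (Densities n M)} {w : ℝ} {e : Chart n M}
    {S : Fin n → Fin n → E n → ℝ} {γ : Fin n → E n → ℝ} {θ : E n → ℝ}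
    (h : HasComponents B w e S γ θ) {x : E n} (hx : x ∈ e.1.target)
    {ξ : Fin n → Densities n M} (hξ : ∀ i, LocallyEq (ξ i) e x (fun y => y i) 0)
    {ρ : Densities n M} (hρ : LocallyEq ρ e x (fun _ => 1) 1) (t : ℝ) (A C : Fin (n + 1)) :
    genFactor t A * genFactor t C * brk B (pt e t x) (localGen ρ ξ A) (localGen ρ ξ C) =
      compMatrix w S γ θ A C (ext0 t x) := by
  obtain ⟨h1, h2, h3⟩ := h x hx
  have hS : ∀ i j, brk B (pt e t x) (ξ i) (ξ j) = S i j x * Real.exp (w * t) := fun i j =>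
    (eqAt_der_iff B hx).1 (h1 i j _ _ (hξ i) (hξ j)) t
  have hγ : ∀ i, Real.exp (-t) * brk B (pt e t x) (ξ i) ρ = γ i x * Real.exp (w * t) :=
    fun i => by
      rw [(eqAt_der_iff B hx).1 (h2 i _ _ (hξ i) hρ), show w * t = -t + (w + 1) * t by ring,
        Real.exp_add]
      ring
  have hθ : Real.exp (-t) * Real.exp (-t) * brk B (pt e t x) ρ ρ = θ x * Real.exp (w * t) := by
    rw [(eqAt_der_iff B hx).1 (h3 _ _ hρ hρ), show w * t = -t + -t + (w + 2) * t by ring,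
      Real.exp_add, Real.exp_add]
    ring
  refine Fin.cases ?_ (fun i => ?_) A <;> refine Fin.cases ?_ (fun j => ?_) C <;>
    simp only [compMatrix, liftExp_ext0, Fin.cases_zero, Fin.cases_succ, genFactor,
      localGen, one_mul, mul_one]
  · exact hθ
  · rw [brk_symm, hγ]
  · rw [hγ]
  · exact hS i j

/-- The bracket in adapted coordinates. -/
theorem bracket_formula {B : AlgBracket (Densities n M)} (hpow : PowerRule B) {w : ℝ}
    {e : Chart n M} {S : Fin n → Fin n → E n → ℝ} {γ : Fin n → E n → ℝ} {θ : E n → ℝ}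
    (h : HasComponents B w e S γ θ) (a b : Densities n M) {x : E n} (hx : x ∈ e.1.target) (t : ℝ) :
    brk B (pt e t x) a b = ∑ A, ∑ C, compMatrix w S γ θ A C (ext0 t x) *
      pd A (fnIn e a) (ext0 t x) * pd C (fnIn e b) (ext0 t x) := by
  obtain ⟨ρ, ξ, hρ, hξ⟩ := exists_localGen hx
  -- The first-order formula in the second argument; symmetry then expands the first argument by the
  -- same formula.
  have key : ∀ a b, brk B (pt e t x) a b = ∑ C, pd C (fnIn e b) (ext0 t x) *
      (genFactor t C * brk B (pt e t x) a (localGen ρ ξ C)) := fun a b => by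
    rw [brk_formula hpow a hx hξ hρ b t, Fin.sum_univ_succ, add_comm]
    simp [genFactor, localGen]
  have key' : ∀ b C, brk B (pt e t x) b (localGen ρ ξ C) = ∑ A, pd A (fnIn e b) (ext0 t x) *
      (genFactor t A * brk B (pt e t x) (localGen ρ ξ A) (localGen ρ ξ C)) := fun b C => by
    rw [brk_symm, key]
    exact Finset.sum_congr rfl fun A _ => by rw [brk_symm]
  rw [key, Finset.sum_comm]
  refine Finset.sum_congr rfl fun C _ => ?_
  rw [key', Finset.mul_sum, Finset.mul_sum]
  refine Finset.sum_congr rfl fun A _ => ?_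
  rw [← h.brk_localGen hx hξ hρ]
  ring

end Formula

/-! ### Symmetric tensor fields from pointwise bilinear forms -/

section FormFields

variable {m : ℕ} {N : Type*} [TopologicalSpace N] [ChartedSpace (E m) N]

/-- Bilinear forms on the dual of coordinate space. -/
abbrev CoForm (m : ℕ) : Type := (E m →L[ℝ] ℝ) →ₗ[ℝ] (E m →L[ℝ] ℝ) →ₗ[ℝ] ℝ

/-- The form with components `K` in the frame given by `A`. -/
def coForm (K : Fin m → Fin m → ℝ) (A : E m →L[ℝ] E m) : CoForm m :=
  LinearMap.mk₂ ℝ (fun α β => ∑ i, ∑ j, K i j * α (A (sgl i)) * β (A (sgl j)))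
    (fun α α' β => by
      simp only [add_apply, mul_add, add_mul, Finset.sum_add_distrib])
    (fun c α β => by
      simp only [smul_apply, smul_eq_mul, Finset.mul_sum]
      exact Finset.sum_congr rfl fun i _ => Finset.sum_congr rfl fun j _ => by ring)
    (fun α β β' => by
      simp only [add_apply, mul_add, Finset.sum_add_distrib])
    (fun c α β => by
      simp only [smul_apply, smul_eq_mul, Finset.mul_sum]
      exact Finset.sum_congr rfl fun i _ => Finset.sum_congr rfl fun j _ => by ring)

lemma coForm_apply (K : Fin m → Fin m → ℝ) (A : E m →L[ℝ] E m) (α β : E m →L[ℝ] ℝ) :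
    coForm K A α β = ∑ i, ∑ j, K i j * α (A (sgl i)) * β (A (sgl j)) := rfl

lemma CoForm.apply_comp (Φ : CoForm m) (T : E m →L[ℝ] E m) (α β : E m →L[ℝ] ℝ) :
    Φ (α.comp T) (β.comp T) = ∑ i, ∑ j, Φ ((EuclideanSpace.proj i : E m →L[ℝ] ℝ).comp T)
      ((EuclideanSpace.proj j : E m →L[ℝ] ℝ).comp T) * α (sgl i) * β (sgl j) := by
  conv_lhs => rw [covector_eq_sum α, covector_eq_sum β]
  simp only [ContinuousLinearMap.finsetSum_comp, ContinuousLinearMap.smul_comp, map_sum, map_smul,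
    LinearMap.sum_apply, LinearMap.smul_apply, smul_eq_mul]
  rw [Finset.sum_comm]
  refine Finset.sum_congr rfl fun i _ => ?_
  rw [Finset.mul_sum]
  exact Finset.sum_congr rfl fun j _ => by ring

/-- The components in the chart `e` of a field of bilinear forms on the cotangent spaces. -/
def formComp (Φ : N → CoForm m) (e : Chart m N) (i j : Fin m) (x : E m) : ℝ :=
  Φ (e.1.symm x) ((EuclideanSpace.proj i).comp (chartTo e (e.1.symm x)))
    ((EuclideanSpace.proj j).comp (chartTo e (e.1.symm x)))

variable [IsManifold 𝓘(ℝ, E m) ∞ N]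

lemma formComp_trans (Φ : N → CoForm m) {e e' : Chart m N} {x : E m} (hx : x ∈ overlap e e')
    (i j : Fin m) : formComp Φ e' i j (coordTrans e e' x) =
      ∑ k, ∑ l, formComp Φ e k l x * fderiv ℝ (coordTrans e e') x (sgl k) i *
        fderiv ℝ (coordTrans e e') x (sgl l) j := by
  have h : chartTo e' (e.1.symm x) =
      (fderiv ℝ (coordTrans e e') x).comp (chartTo e (e.1.symm x)) := by
    ext1 v
    exact (fderiv_coordTrans_chartTo hx v).symm
  have h1 := (Φ (e.1.symm x)).apply_comp (chartTo e (e.1.symm x))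
    ((EuclideanSpace.proj i).comp (fderiv ℝ (coordTrans e e') x))
    ((EuclideanSpace.proj j).comp (fderiv ℝ (coordTrans e e') x))
  rw [formComp, symm_coordTrans hx, h]
  exact h1

/-- Every covector at the point is the pullback by the chart of a covector on coordinate space, so
the differentials of the coordinates span. -/
lemma formComp_ext {Φ Ψ : N → CoForm m} {e : Chart m N} {x : E m} (hx : x ∈ e.1.target)
    (h : ∀ i j, formComp Φ e i j x = formComp Ψ e i j x) : Φ (e.1.symm x) = Ψ (e.1.symm x) := by
  have h1 : ∀ α : E m →L[ℝ] ℝ, α = (α.comp (chartFrom e x)).comp (chartTo e (e.1.symm x)) :=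
    fun α => by
      ext1 v
      simp [chartFrom_chartTo' hx]
  refine LinearMap.ext fun α => LinearMap.ext fun β => ?_
  rw [h1 α, h1 β, CoForm.apply_comp, CoForm.apply_comp]
  exact Finset.sum_congr rfl fun i _ => Finset.sum_congr rfl fun j _ =>
    congrArg (· * _ * _) (h i j)

/-- A field of bilinear forms with smooth symmetric components in the charts of an atlas is a
tensor field. -/
lemma exists_symTensor (Φ : N → CoForm m) (h : ∀ p, ∃ e : Chart m N, p ∈ e.1.source ∧
      (∀ i j, ContDiffOn ℝ ∞ (formComp Φ e i j) e.1.target) ∧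
      ∀ i j, ∀ x ∈ e.1.target, formComp Φ e i j x = formComp Φ e j i x) :
    ∃ S : SymTensor m N, S.formE = Φ := by
  refine ⟨⟨Φ, fun p α β => ?_, fun e' i j y hy => ?_⟩, rfl⟩
  · obtain ⟨e, hp, -, h2⟩ := h p
    have h3 := formComp_ext (Φ := Φ) (Ψ := fun p => (Φ p).flip) (e.1.map_source hp)
      (fun i j => h2 i j _ (e.1.map_source hp))
    rw [e.1.left_inv hp] at h3
    exact congr($h3 α β)
  · obtain ⟨e, hp, h1, -⟩ := h (e'.1.symm y)
    have hy' : y ∈ overlap e' e := mem_overlap.2 ⟨hy, hp⟩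
    have ho := isOpen_overlap e' e
    have hm : MapsTo (coordTrans e' e) (overlap e' e) (overlap e e') := fun z hz => trans_mem hz
    have hf : ∀ k i, ContDiffOn ℝ ∞ (fun z => fderiv ℝ (coordTrans e e') z (sgl k) i)
        (overlap e e') := fun k i =>
      (EuclideanSpace.proj (𝕜 := ℝ) i).contDiff.comp_contDiffOn
        (((contDiffOn_trans e e').fderiv_of_isOpen (isOpen_overlap e e') (m := ∞)
          (by simp)).clm_apply contDiffOn_const)
    have h3 : ContDiffOn ℝ ∞ (fun z => ∑ k, ∑ l, formComp Φ e k l z *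
        fderiv ℝ (coordTrans e e') z (sgl k) i * fderiv ℝ (coordTrans e e') z (sgl l) j)
        (overlap e e') := ContDiffOn.sum fun k _ => ContDiffOn.sum fun l _ =>
      (((h1 k l).mono fun z hz => (mem_overlap.1 hz).1).mul (hf k i)).mul (hf l j)
    refine (((h3.comp (contDiffOn_trans e' e) hm).congr fun z hz => ?_).contDiffAt
      (ho.mem_nhds hy')).contDiffWithinAt
    have h4 := formComp_trans Φ (hm hz) i j
    rw [coordTrans_coordTrans hz] at h4
    exact h4

lemma SymTensor.ext_formE {S S' : SymTensor m N} (h : S.formE = S'.formE) : S = S' := by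
  cases S
  cases S'
  congr

end FormFields

/-! ### The tensor field on M̃ induced by the bracket -/

section InducedTensor

variable {n : ℕ} {M : Type*} [TopologicalSpace M] [T2Space M] [ChartedSpace (E n) M]
  [IsManifold 𝓘(ℝ, E n) ∞ M]

/-- The differential at a point of the function of a density. -/
def dfn (a : Densities n M) (q : Thomas n M) : E (n + 1) →L[ℝ] ℝ :=
  mfderiv 𝓘(ℝ, E (n + 1)) 𝓘(ℝ, ℝ) (toSmooth a) q

lemma dfn_pt (a : Densities n M) {e : Chart n M} {x : E n} (hx : x ∈ e.1.target) (t : ℝ) :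
    dfn a (pt e t x) =
      (fderiv ℝ (fnIn e a) (ext0 t x)).comp (chartTo (adapted e) (pt e t x)) := by
  have hz : ext0 t x ∈ (adapted e).1.target := ext0_mem_target.2 hx
  exact mfderiv_eq_fderiv_comp_chartTo hz (differentiableAt_of_contDiffOn (adapted e).1.open_target
    (contDiffOn_comp_symm (adapted e) (toSmooth a)) hz)

lemma eventually_ext0 {p : E n → Prop} {x : E n} (h : ∀ᶠ y in 𝓝 x, p y) (t : ℝ) :
    ∀ᶠ z in 𝓝 (ext0 t x), p (tl z) := by
  have h1 : Tendsto (tl (n := n)) (𝓝 (ext0 t x)) (𝓝 x) := by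
    have := (tl (n := n)).continuous.tendsto (ext0 t x)
    rwa [tl_ext0] at this
  exact h1.eventually h

lemma hasFDerivAt_fnIn_local {a : Densities n M} {e : Chart n M} {x : E n} (hx : x ∈ e.1.target)
    {φ : E n → ℝ} {μ : ℝ} (h : LocallyEq a e x φ μ) (t : ℝ) :
    fderiv ℝ (fnIn e a) (ext0 t x) = fderiv ℝ (liftExp φ μ) (ext0 t x) := by
  refine Filter.EventuallyEq.fderiv_eq ?_
  filter_upwards [eventually_ext0 (h.eventually_pointVal hx) t] with z hz
  rw [fnIn_eq]
  exact hz _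

/-- The function of |Dx| is e^{x⁰}, whose differential is e^{x⁰}dx⁰. Thus differentials of densities
span every cotangent space of M̃, which yields both uniqueness and the components of the tensor
field. -/
lemma genFactor_smul_fderiv {e : Chart n M} {x : E n} (hx : x ∈ e.1.target)
    {ξ : Fin n → Densities n M} (hξ : ∀ i, LocallyEq (ξ i) e x (fun y => y i) 0)
    {ρ : Densities n M} (hρ : LocallyEq ρ e x (fun _ => 1) 1) (t : ℝ) (A : Fin (n + 1)) :
    genFactor t A • fderiv ℝ (fnIn e (localGen ρ ξ A)) (ext0 t x) = EuclideanSpace.proj A := by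
  refine Fin.cases ?_ (fun i => ?_) A
  · change Real.exp (-t) • fderiv ℝ (fnIn e ρ) (ext0 t x) = _
    rw [hasFDerivAt_fnIn_local hx hρ t, (hasFDerivAt_liftExp (differentiableAt_const 1) 1).fderiv]
    ext1 v
    simp [← mul_assoc, ← Real.exp_add, hd_apply]
  · change (1 : ℝ) • fderiv ℝ (fnIn e (ξ i)) (ext0 t x) = _
    rw [hasFDerivAt_fnIn_local hx (hξ i) t, (hasFDerivAt_liftExp
      (h := fun y : E n => y i) (EuclideanSpace.proj (𝕜 := ℝ) i).differentiableAt 0).fderiv]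
    ext1 v
    change (1 : ℝ) * (tl (ext0 t x) i * (Real.exp (0 * hd (ext0 t x)) * (0 * hd v)) +
      Real.exp (0 * hd (ext0 t x)) * (fderiv ℝ (EuclideanSpace.proj (𝕜 := ℝ) i)
        (tl (ext0 t x)) (tl v))) = v i.succ
    rw [(EuclideanSpace.proj (𝕜 := ℝ) i).fderiv]
    simp [tl_apply]

/-- A field of forms which gives the bracket of densities. -/
def InducesBracket (B : AlgBracket (Densities n M)) (Φ : Thomas n M → CoForm (n + 1)) : Prop :=
  ∀ a b q, Φ q (dfn a q) (dfn b q) = brk B q a b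

lemma isInducedTensor_iff {B : AlgBracket (Densities n M)} {S : SymTensor (n + 1) (Thomas n M)} :
    IsInducedTensor B S ↔ InducesBracket B S.formE := Iff.rfl

lemma InducesBracket.formComp_eq {B : AlgBracket (Densities n M)} {Φ : Thomas n M → CoForm (n + 1)}
    (hΦ : InducesBracket B Φ) {w : ℝ} {e : Chart n M} {S : Fin n → Fin n → E n → ℝ}
    {γ : Fin n → E n → ℝ} {θ : E n → ℝ} (h : HasComponents B w e S γ θ) {x : E n}
    (hx : x ∈ e.1.target) (t : ℝ) (A C : Fin (n + 1)) :
    formComp Φ (adapted e) A C (ext0 t x) = compMatrix w S γ θ A C (ext0 t x) := by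
  obtain ⟨ρ, ξ, hρ, hξ⟩ := exists_localGen hx
  have h1 : ∀ A, (EuclideanSpace.proj A : E (n + 1) →L[ℝ] ℝ).comp
      (chartTo (adapted e) (pt e t x)) = genFactor t A • dfn (localGen ρ ξ A) (pt e t x) :=
    fun A => by
      rw [← genFactor_smul_fderiv hx hξ hρ t A, dfn_pt _ hx, ContinuousLinearMap.smul_comp]
  rw [← h.brk_localGen hx hξ hρ t A C, ← hΦ]
  change Φ (pt e t x) ((EuclideanSpace.proj A : E (n + 1) →L[ℝ] ℝ).comp
    (chartTo (adapted e) (pt e t x))) ((EuclideanSpace.proj C : E (n + 1) →L[ℝ] ℝ).comp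
    (chartTo (adapted e) (pt e t x))) = _
  rw [h1, h1, map_smul, map_smul, LinearMap.smul_apply, smul_eq_mul, smul_eq_mul]
  ring

/-- At each point the form is written down in one adapted chart from the components of the bracket.
The choice of chart needs no regularity: smoothness is recovered afterwards from
`InducesBracket.formComp_eq`. -/
lemma exists_inducesBracket {B : AlgBracket (Densities n M)} {w : ℝ} (hB : HasWeight B w)
    (hpow : PowerRule B) : ∃ Φ : Thomas n M → CoForm (n + 1), InducesBracket B Φ := by
  choose S γ θ h using fun e : Chart n M => exists_components hB e
  let Φ : Chart n M → Thomas n M → CoForm (n + 1) := fun e q =>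
    coForm (fun A C => compMatrix w (S e) (γ e) (θ e) A C (thomasChart e q))
      (chartFrom (adapted e) (thomasChart e q))
  have key : ∀ e a b q, q.proj ∈ e.1.source → Φ e q (dfn a q) (dfn b q) = brk B q a b :=
    fun e a b q hq => by
      obtain ⟨t, x, hx, rfl⟩ := exists_pt hq
      have hz : thomasChart e (pt e t x) = ext0 t x :=
        (thomasChart e).right_inv (ext0_mem_target.2 hx)
      have hv : ∀ v, chartTo (adapted e) (pt e t x) (chartFrom (adapted e) (ext0 t x) v) = v :=
        fun v => chartTo_chartFrom (e := adapted e) (x := ext0 t x) (ext0_mem_target.2 hx) v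
      rw [coForm_apply, hz, bracket_formula hpow (h e).1 a b hx t, dfn_pt a hx, dfn_pt b hx]
      simp only [ContinuousLinearMap.comp_apply, hv]
      rfl
  exact ⟨fun q => Φ (chartOf q.proj) q, fun a b q => key _ a b q (mem_chart_source (E n) q.proj)⟩

lemma contDiffOn_compMatrix {e : Chart n M} {w : ℝ} {S : Fin n → Fin n → E n → ℝ}
    {γ : Fin n → E n → ℝ} {θ : E n → ℝ} (hS : ∀ i j, ContDiffOn ℝ ∞ (S i j) e.1.target)
    (hγ : ∀ i, ContDiffOn ℝ ∞ (γ i) e.1.target) (hθ : ContDiffOn ℝ ∞ θ e.1.target)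
    (A C : Fin (n + 1)) :
    ContDiffOn ℝ ∞ (compMatrix w S γ θ A C) (adapted e).1.target := by
  refine (contDiffOn_liftExp (s := e.1.target) ?_ w).mono fun z hz => mem_thomas_target.1 hz
  refine Fin.cases ?_ (fun i => ?_) A <;> refine Fin.cases ?_ (fun j => ?_) C
  exacts [hθ, hγ j, hγ i, hS i j]

lemma InducesBracket.unique {B : AlgBracket (Densities n M)} {w : ℝ} (hB : HasWeight B w)
    {Φ Ψ : Thomas n M → CoForm (n + 1)} (hΦ : InducesBracket B Φ) (hΨ : InducesBracket B Ψ) :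
    Φ = Ψ := by
  funext q
  obtain ⟨e, t, x, hx, rfl⟩ := exists_chart_pt q
  obtain ⟨S, γ, θ, h, -⟩ := exists_components hB e
  exact formComp_ext (e := adapted e) (ext0_mem_target.2 hx) fun A C => by
    rw [hΦ.formComp_eq h hx, hΨ.formComp_eq h hx]

/-- Any form inducing the bracket has the prescribed components in every adapted chart. This gives
smoothness and symmetry of the form already found, and equality with any other. -/
theorem existsUnique_inducedTensor {B : AlgBracket (Densities n M)} {w : ℝ} (hB : HasWeight B w)
    (hpow : PowerRule B) : ∃! S : SymTensor (n + 1) (Thomas n M), IsInducedTensor B S := by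
  obtain ⟨Φ, hΦ⟩ := exists_inducesBracket hB hpow
  obtain ⟨S, hS⟩ := exists_symTensor Φ fun q => by
    obtain ⟨e, t, x, hx, rfl⟩ := exists_chart_pt q
    obtain ⟨S, γ, θ, h, hS, hγ, hθ⟩ := exists_components hB e
    have hc : ∀ A C, ∀ z ∈ (adapted e).1.target,
        formComp Φ (adapted e) A C z = compMatrix w S γ θ A C z := fun A C z hz => by
      rw [← ext0_hd_tl z]
      exact hΦ.formComp_eq h (mem_thomas_target.1 hz) _ A C
    refine ⟨adapted e, (adapted e).1.map_target (ext0_mem_target.2 hx), fun A C =>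
      (contDiffOn_compMatrix hS hγ hθ A C).congr (hc A C), fun A C z hz => ?_⟩
    obtain ⟨ρ, ξ, hρ, hξ⟩ := exists_localGen (mem_thomas_target.1 hz)
    rw [hc A C z hz, hc C A z hz, ← ext0_hd_tl z,
      ← h.brk_localGen (mem_thomas_target.1 hz) hξ hρ, brk_symm,
      ← h.brk_localGen (mem_thomas_target.1 hz) hξ hρ]
    ring
  refine ⟨S, isInducedTensor_iff.2 (hS ▸ hΦ), fun S' hS' => SymTensor.ext_formE ?_⟩
  rw [hS]
  exact (isInducedTensor_iff.1 hS').unique hB hΦ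

lemma IsInducedTensor.comp_eq {B : AlgBracket (Densities n M)} {T : SymTensor (n + 1) (Thomas n M)}
    (hT : IsInducedTensor B T) {w : ℝ} {e : Chart n M} {S : Fin n → Fin n → E n → ℝ}
    {γ : Fin n → E n → ℝ} {θ : E n → ℝ} (h : HasComponents B w e S γ θ) {x : E n}
    (hx : x ∈ e.1.target) (t : ℝ) (A C : Fin (n + 1)) :
    T.comp (adapted e) A C (ext0 t x) = compMatrix w S γ θ A C (ext0 t x) :=
  (isInducedTensor_iff.1 hT).formComp_eq h hx t A C

/-- The components of the induced tensor field in adapted coordinates. -/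
theorem IsInducedTensor.components {B : AlgBracket (Densities n M)}
    {T : SymTensor (n + 1) (Thomas n M)} (hT : IsInducedTensor B T) {w : ℝ} {e : Chart n M}
    {S : Fin n → Fin n → E n → ℝ} {γ : Fin n → E n → ℝ} {θ : E n → ℝ}
    (h : HasComponents B w e S γ θ) {x : E n} (hx : x ∈ e.1.target) (t : ℝ) :
    (∀ i j : Fin n, T.comp (adapted e) i.succ j.succ (ext0 t x) = Real.exp (w * t) * S i j x) ∧
      (∀ i : Fin n, T.comp (adapted e) 0 i.succ (ext0 t x) = Real.exp (w * t) * γ i x ∧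
        T.comp (adapted e) i.succ 0 (ext0 t x) = Real.exp (w * t) * γ i x) ∧
      T.comp (adapted e) 0 0 (ext0 t x) = Real.exp (w * t) * θ x := by
  simp only [hT.comp_eq h hx, compMatrix, liftExp_ext0, Fin.cases_zero, Fin.cases_succ,
    mul_comm (Real.exp (w * t)), and_self, implies_true]

end InducedTensor

/-! ### The projective Laplacian of M̃ in adapted coordinates -/

section ThomasLaplacian

variable {n : ℕ} {M : Type*} [TopologicalSpace M] [T2Space M] [ChartedSpace (E n) M]
  [IsManifold 𝓘(ℝ, E n) ∞ M]

lemma IsThomasConnection.coeff_eq {D : Connection n M} {D' : Connection (n + 1) (Thomas n M)}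
    (h : IsThomasConnection D D') {e : Chart n M} {x : E n} (hx : x ∈ e.1.target) (t : ℝ)
    (k i j : Fin (n + 1)) : D'.coeff (adapted e) k i j (ext0 t x) = thomasCoeff D e k i j x := by
  rw [← D'.gam_sgl_apply, isThomasConnection_iff_gam.1 h e _ (ext0_mem_target.2 hx), thomasGam,
    bil_sgl, tl_ext0]

lemma Connection.sum_projCoeff (D : Connection n M) {e : Chart n M} {x : E n}
    (hx : x ∈ e.1.target) (i : Fin n) : ∑ k, D.projCoeff e k i k x = 0 := by
  have h := D.tr_pgam hx (sgl i)
  rw [tr_apply] at h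
  simpa only [D.pgam_sgl_apply] using h

lemma Connection.projCoeff_symm (D : Connection n M) {e : Chart n M} {x : E n}
    (hx : x ∈ e.1.target) (k i j : Fin n) : D.projCoeff e k i j x = D.projCoeff e k j i x := by
  rw [← D.pgam_sgl_apply, D.pgam_symm hx, D.pgam_sgl_apply]

/-- The projective coefficients of the Thomas connection. -/
lemma IsThomasConnection.projCoeff_eq {D : Connection n M}
    {D' : Connection (n + 1) (Thomas n M)} (h : IsThomasConnection D D') {e : Chart n M} {x : E n}
    (hx : x ∈ e.1.target) (t : ℝ) :
    D'.projCoeff (adapted e) 0 0 0 (ext0 t x) = n / (((n : ℝ) + 1) * ((n : ℝ) + 2)) ∧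
    (∀ j : Fin n, D'.projCoeff (adapted e) 0 0 j.succ (ext0 t x) = 0) ∧
    (∀ j : Fin n, D'.projCoeff (adapted e) 0 j.succ 0 (ext0 t x) = 0) ∧
    (∀ i j : Fin n, D'.projCoeff (adapted e) 0 i.succ j.succ (ext0 t x) =
      ((n : ℝ) + 1) / ((n : ℝ) - 1) * D.projRicci e i j x) ∧
    (∀ k : Fin n, D'.projCoeff (adapted e) k.succ 0 0 (ext0 t x) = 0) ∧
    (∀ k j : Fin n, D'.projCoeff (adapted e) k.succ 0 j.succ (ext0 t x) =
      if k = j then -1 / (((n : ℝ) + 1) * ((n : ℝ) + 2)) else 0) ∧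
    (∀ k j : Fin n, D'.projCoeff (adapted e) k.succ j.succ 0 (ext0 t x) =
      if k = j then -1 / (((n : ℝ) + 1) * ((n : ℝ) + 2)) else 0) ∧
    ∀ k i j : Fin n, D'.projCoeff (adapted e) k.succ i.succ j.succ (ext0 t x) =
      D.projCoeff e k i j x := by
  have hn1 : (n : ℝ) + 1 ≠ 0 := by positivity
  have hn2 : (n : ℝ) + 2 ≠ 0 := by positivity
  have hn3 : (n : ℝ) + 1 + 1 ≠ 0 := by positivity
  -- The contractions with lower index 0 are n + 1 copies of -1/(n+1); those with a positive index
  -- vanish because Π is trace-free. Since M̃ has dimension n + 1 the trace correction carries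
  -- 1/(n+2), which alters only the coefficients -1/(n+1).
  have h1 : ∑ s, D'.coeff (adapted e) s s 0 (ext0 t x) = -1 := by
    simp only [h.coeff_eq hx, Fin.sum_univ_succ, thomasCoeff, Fin.cases_zero, Fin.cases_succ,
      if_true, Finset.sum_const, Finset.card_univ, Fintype.card_fin, nsmul_eq_mul]
    field_simp
    ring
  have h2 : ∑ s, D'.coeff (adapted e) s 0 s (ext0 t x) = -1 := by
    simp only [h.coeff_eq hx, Fin.sum_univ_succ, thomasCoeff, Fin.cases_zero, Fin.cases_succ,
      if_true, Finset.sum_const, Finset.card_univ, Fintype.card_fin, nsmul_eq_mul]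
    field_simp
    ring
  have h3 : ∀ j : Fin n, ∑ s, D'.coeff (adapted e) s s j.succ (ext0 t x) = 0 := fun j => by
    simp only [h.coeff_eq hx, Fin.sum_univ_succ, thomasCoeff, Fin.cases_zero, Fin.cases_succ,
      D.projCoeff_symm hx _ _ j, D.sum_projCoeff hx, add_zero]
  have h4 : ∀ j : Fin n, ∑ s, D'.coeff (adapted e) s j.succ s (ext0 t x) = 0 := fun j => by
    simp only [h.coeff_eq hx, Fin.sum_univ_succ, thomasCoeff, Fin.cases_zero, Fin.cases_succ,
      D.sum_projCoeff hx, add_zero]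
  have hs : ∀ k : Fin n, (0 : Fin (n + 1)) ≠ k.succ := fun k => (Fin.succ_ne_zero k).symm
  simp only [Connection.projCoeff.eq_1 D', h1, h2, h3, h4]
  simp only [h.coeff_eq hx, thomasCoeff, Fin.cases_zero,
    Fin.cases_succ, if_true, Fin.succ_ne_zero, hs, if_false, Fin.succ_inj, Nat.cast_add,
    Nat.cast_one, ite_self, add_zero, zero_add, mul_zero, sub_zero, implies_true, true_and, and_true]
  refine ⟨?_, fun k j => ?_, fun k j => ?_⟩
  · field_simp
    ring
  all_goals
    split_ifs
    · field_simp
      ring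
    · simp

/-- The coefficient of `∂_i` in the Laplacian on densities. -/
def lapVec (D : Connection n M) (e : Chart n M) (w : ℝ) (S : Fin n → Fin n → E n → ℝ)
    (γ : Fin n → E n → ℝ) (i : Fin n) (x : E n) : ℝ :=
  2 / ((n : ℝ) + 4) * ∑ j, pd j (S i j) x +
    2 * (w + n * w + 1) / (((n : ℝ) + 1) * ((n : ℝ) + 4)) * γ i x -
    ((n : ℝ) + 2) / ((n : ℝ) + 4) * ∑ j, ∑ k, S j k x * D.projCoeff e i j k x

/-- The coefficient of `∂_0` in the Laplacian on densities. -/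
def lapWeight (D : Connection n M) (e : Chart n M) (w : ℝ) (S : Fin n → Fin n → E n → ℝ)
    (γ : Fin n → E n → ℝ) (θ : E n → ℝ) (x : E n) : ℝ :=
  2 / ((n : ℝ) + 4) * ∑ k, pd k (γ k) x +
    (2 * w + 2 * w * n - n) / (((n : ℝ) + 1) * ((n : ℝ) + 4)) * θ x -
    ((n : ℝ) + 1) * ((n : ℝ) + 2) / (((n : ℝ) - 1) * ((n : ℝ) + 4)) *
      ∑ i, ∑ j, S i j x * D.projRicci e i j x

/-- The Laplacian on densities in adapted coordinates. -/
theorem lapIn_thomas {D : Connection n M} {D' : Connection (n + 1) (Thomas n M)}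
    (h : IsThomasConnection D D') {T : SymTensor (n + 1) (Thomas n M)} {w : ℝ} {e : Chart n M}
    {S : Fin n → Fin n → E n → ℝ} {γ : Fin n → E n → ℝ} {θ : E n → ℝ}
    (hS : ∀ i j, ContDiffOn ℝ ∞ (S i j) e.1.target) (hγ : ∀ i, ContDiffOn ℝ ∞ (γ i) e.1.target)
    (hθ : ContDiffOn ℝ ∞ θ e.1.target)
    (hT : ∀ A C, ∀ z ∈ (adapted e).1.target, T.comp (adapted e) A C z = compMatrix w S γ θ A C z)
    {F : E (n + 1) → ℝ} (hF : ContDiffOn ℝ ∞ F (adapted e).1.target) {x : E n}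
    (hx : x ∈ e.1.target) (t : ℝ) :
    lapIn D' T (adapted e) F (ext0 t x) = Real.exp (w * t) *
      (∑ i, ∑ j, S i j x * pd i.succ (pd j.succ F) (ext0 t x) +
        2 * ∑ i, γ i x * pd i.succ (pd 0 F) (ext0 t x) + θ x * pd 0 (pd 0 F) (ext0 t x) +
        ∑ i, lapVec D e w S γ i x * pd i.succ F (ext0 t x) +
        lapWeight D e w S γ θ x * pd 0 F (ext0 t x)) := by
  have hz : ext0 t x ∈ (adapted e).1.target := ext0_mem_target.2 hx
  have ho := (adapted e).1.open_target
  have hd : ∀ {f : E n → ℝ}, ContDiffOn ℝ ∞ f e.1.target → DifferentiableAt ℝ f (tl (ext0 t x)) :=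
    fun hf => differentiableAt_of_contDiffOn e.1.open_target hf (by rwa [tl_ext0])
  have hpd : ∀ A C, pd C (T.comp (adapted e) A C) (ext0 t x) =
      pd C (compMatrix w S γ θ A C) (ext0 t x) := fun A C => pd_congr ho (hT A C) hz C
  have d00 : pd 0 (compMatrix w S γ θ 0 0) (ext0 t x) = w * (θ x * Real.exp (w * t)) :=
    (pd_zero_liftExp (hd hθ) w).trans (by rw [liftExp_ext0])
  have d0s : ∀ i : Fin n, pd i.succ (compMatrix w S γ θ 0 i.succ) (ext0 t x) =
      pd i (γ i) x * Real.exp (w * t) := fun i =>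
    (pd_succ_liftExp (hd (hγ i)) w i).trans (by rw [liftExp_ext0])
  have ds0 : ∀ i : Fin n, pd 0 (compMatrix w S γ θ i.succ 0) (ext0 t x) =
      w * (γ i x * Real.exp (w * t)) := fun i =>
    (pd_zero_liftExp (hd (hγ i)) w).trans (by rw [liftExp_ext0])
  have dss : ∀ i j : Fin n, pd j.succ (compMatrix w S γ θ i.succ j.succ) (ext0 t x) =
      pd j (S i j) x * Real.exp (w * t) := fun i j =>
    (pd_succ_liftExp (hd (hS i j)) w j).trans (by rw [liftExp_ext0])
  obtain ⟨p1, p2, p3, p4, p5, p6, p7, p8⟩ := h.projCoeff_eq hx t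
  have hc : ∀ i : Fin n, pd 0 (pd i.succ F) (ext0 t x) = pd i.succ (pd 0 F) (ext0 t x) := fun i =>
    pd_comm ho hF hz 0 i.succ
  have hn1 : (n : ℝ) + 1 ≠ 0 := by positivity
  have hn2 : (n : ℝ) + 2 ≠ 0 := by positivity
  have hn4 : (n : ℝ) + 4 ≠ 0 := by positivity
  have k00 : compMatrix w S γ θ 0 0 (ext0 t x) = θ x * Real.exp (w * t) := liftExp_ext0 _ _ _ _
  have k0s : ∀ i : Fin n, compMatrix w S γ θ 0 i.succ (ext0 t x) = γ i x * Real.exp (w * t) :=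
    fun i => liftExp_ext0 _ _ _ _
  have ks0 : ∀ i : Fin n, compMatrix w S γ θ i.succ 0 (ext0 t x) = γ i x * Real.exp (w * t) :=
    fun i => liftExp_ext0 _ _ _ _
  have kss : ∀ i j : Fin n, compMatrix w S γ θ i.succ j.succ (ext0 t x) =
      S i j x * Real.exp (w * t) := fun i j => liftExp_ext0 _ _ _ _
  set ε := Real.exp (w * t) with hε
  -- The dimension of M̃ is n + 1, whence n + 4 and n + 2. In the coefficients of γ and θ the terms
  -- with `w` come from differentiating e^{wx⁰} along x⁰; the others come from the projective
  -- coefficients -1/((n+1)(n+2)), which occur twice, and n/((n+1)(n+2)).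
  have m1 : ((n + 1 : ℕ) : ℝ) + 3 = n + 4 := by push_cast; ring
  have m2 : ((n + 1 : ℕ) : ℝ) + 1 = n + 2 := by push_cast; ring
  have v0 : 2 / (((n + 1 : ℕ) : ℝ) + 3) * ∑ C, pd C (T.comp (adapted e) 0 C) (ext0 t x) -
      (((n + 1 : ℕ) : ℝ) + 1) / (((n + 1 : ℕ) : ℝ) + 3) * ∑ A, ∑ C,
        T.comp (adapted e) A C (ext0 t x) * D'.projCoeff (adapted e) 0 A C (ext0 t x) =
      ε * lapWeight D e w S γ θ x := by
    simp only [hpd, hT _ _ _ hz, Fin.sum_univ_succ, d00, d0s, k00, kss, p1, p2, p3, p4, mul_zero,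
      Finset.sum_const_zero, add_zero, zero_add, m1, m2, lapWeight]
    have e1 : ∑ i, ∑ j, S i j x * ε * (((n : ℝ) + 1) / ((n : ℝ) - 1) * D.projRicci e i j x) =
        ε * (((n : ℝ) + 1) / ((n : ℝ) - 1)) * ∑ i, ∑ j, S i j x * D.projRicci e i j x := by
      simp only [Finset.mul_sum]
      exact Finset.sum_congr rfl fun i _ => Finset.sum_congr rfl fun j _ => by ring
    rw [e1, ← Finset.sum_mul, mul_comm ((n : ℝ) - 1) ((n : ℝ) + 4), ← div_div]
    generalize ∑ i, ∑ j, S i j x * D.projRicci e i j x = R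
    generalize ∑ i, pd i (γ i) x = G
    simp only [div_eq_mul_inv, mul_inv]
    have i1 : ((n : ℝ) + 1) * ((n : ℝ) + 1)⁻¹ = 1 := mul_inv_cancel₀ hn1
    have i2 : ((n : ℝ) + 2) * ((n : ℝ) + 2)⁻¹ = 1 := mul_inv_cancel₀ hn2
    linear_combination (-2 * w * θ x * ε * ((n : ℝ) + 4)⁻¹) * i1 -
      (((n : ℝ) + 4)⁻¹ * θ x * ε * n * ((n : ℝ) + 1)⁻¹) * i2
  have vs : ∀ i : Fin n, 2 / (((n + 1 : ℕ) : ℝ) + 3) *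
      ∑ C, pd C (T.comp (adapted e) i.succ C) (ext0 t x) -
      (((n + 1 : ℕ) : ℝ) + 1) / (((n + 1 : ℕ) : ℝ) + 3) * ∑ A, ∑ C,
        T.comp (adapted e) A C (ext0 t x) * D'.projCoeff (adapted e) i.succ A C (ext0 t x) =
      ε * lapVec D e w S γ i x := fun i => by
    simp only [hpd, hT _ _ _ hz, Fin.sum_univ_succ, ds0, dss, k0s, ks0, kss, p5, p6, p7, p8,
      mul_zero, zero_add, m1, m2, lapVec, mul_ite, Finset.sum_add_distrib, Finset.sum_ite_eq,
      Finset.mem_univ, if_true]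
    have e1 : ∑ j, ∑ k, S j k x * ε * D.projCoeff e i j k x =
        ε * ∑ j, ∑ k, S j k x * D.projCoeff e i j k x := by
      simp only [Finset.mul_sum]
      exact Finset.sum_congr rfl fun i _ => Finset.sum_congr rfl fun j _ => by ring
    rw [e1, ← Finset.sum_mul]
    field_simp
    ring
  rw [lapIn]
  have s1 : ∑ A, ∑ C, T.comp (adapted e) A C (ext0 t x) * pd A (pd C F) (ext0 t x) =
      ε * (∑ i, ∑ j, S i j x * pd i.succ (pd j.succ F) (ext0 t x) +
        2 * ∑ i, γ i x * pd i.succ (pd 0 F) (ext0 t x) + θ x * pd 0 (pd 0 F) (ext0 t x)) := by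
    simp only [hT _ _ _ hz, Fin.sum_univ_succ, k00, k0s, ks0, kss, hc, Finset.sum_add_distrib,
      mul_add, Finset.mul_sum]
    have e1 : ∀ i j : Fin n, S i j x * ε * pd i.succ (pd j.succ F) (ext0 t x) =
        ε * (S i j x * pd i.succ (pd j.succ F) (ext0 t x)) := fun i j => by ring
    have e2 : ∀ i : Fin n, γ i x * ε * pd i.succ (pd 0 F) (ext0 t x) =
        ε * (γ i x * pd i.succ (pd 0 F) (ext0 t x)) := fun i => by ring
    simp only [e1, e2, mul_left_comm ε 2, ← Finset.mul_sum]
    ring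
  rw [s1, Fin.sum_univ_succ, v0]
  simp only [vs, mul_assoc, ← Finset.mul_sum]
  ring

end ThomasLaplacian

/-! ### Generators of brackets are operators of order at most two -/

section Algebra

variable {A : Type*} [CommRing A] [Algebra ℝ A]

/-- A form free of subtraction: it can be verified on functions with the rules for sums and products
alone. -/
lemma generates_iff_add {T : A →ₗ[ℝ] A} {B : AlgBracket A} : Generates T B ↔
    ∀ a b, B.der a b + a * T b + T a * b = T (a * b) + a * b * T 1 := by
  refine forall₂_congr fun a b => ⟨fun h => ?_, fun h => ?_⟩ <;> linear_combination h

/-- The generator of a biderivation is a differential operator of order at most two. -/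
theorem Generates.orderLE {T : A →ₗ[ℝ] A} {B : AlgBracket A}
    (h : Generates ((1 / 2 : ℝ) • T) B) : OrderLE 2 T := by
  have h1 : ∀ a b, T (a * b) = (2 : ℝ) • B.der a b + a * T b + T a * b - a * b * T 1 :=
    fun a b => by
      have h2 := congrArg ((2 : ℝ) • ·) (h a b)
      simp only [LinearMap.smul_apply, mul_smul_comm, smul_mul_assoc, smul_add, smul_sub,
        smul_smul] at h2
      norm_num at h2
      rw [h2]
      ring
  -- The commutator of T with a is the derivation 2{a, ·} plus a multiplication, so its commutator
  -- with c is multiplication by 2{a, c}.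
  have h2 : ∀ a b, (T ∘ₗ LinearMap.mulLeft ℝ a - LinearMap.mulLeft ℝ a ∘ₗ T) b =
      (2 : ℝ) • B.der a b + T a * b - a * b * T 1 := fun a b => by
    simp only [LinearMap.sub_apply, LinearMap.comp_apply, LinearMap.mulLeft_apply, h1]
    ring
  intro a c b d
  simp only [LinearMap.sub_apply _ (LinearMap.mulLeft ℝ c ∘ₗ _), LinearMap.comp_apply _ (LinearMap.mulLeft ℝ c),
    LinearMap.comp_apply (LinearMap.mulLeft ℝ c), LinearMap.mulLeft_apply ℝ c, h2,
    Derivation.leibniz, smul_eq_mul, smul_add, mul_smul_comm, mul_add, mul_sub]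
  simp only [← mul_smul_comm]
  ring

end Algebra

/-! ### Recognising densities among functions on M̃ -/

section Expansion

variable {n : ℕ} {M : Type*} [TopologicalSpace M] [ChartedSpace (E n) M]
  [IsManifold 𝓘(ℝ, E n) ∞ M]

/-- A density of given weight as an element of `𝔙(M)`. -/
def IsDensity.toDensities {μ : ℝ} {φ : Coeff n M} (h : IsDensity μ φ) : Densities n M :=
  ⟨AddMonoidAlgebra.single μ φ, isDensity_single h⟩

lemma IsDensity.toSmooth_toDensities {μ : ℝ} {φ : Coeff n M} (h : IsDensity μ φ) {e : Chart n M}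
    {x : E n} (hx : x ∈ e.1.target) (t : ℝ) :
    toSmooth h.toDensities (pt e t x) = φ e ⟨x, hx⟩ * Real.exp (μ * t) := by
  have h1 : h.toDensities.1.coeff.support ⊆ {μ} := by
    change (AddMonoidAlgebra.single μ φ).coeff.support ⊆ _
    rw [AddMonoidAlgebra.coeff_single]
    exact Finsupp.support_single_subset
  rw [toSmooth_pt _ hx t h1, Finset.sum_singleton, dcoeff]
  change crep ((AddMonoidAlgebra.single μ φ).coeff μ) e x * _ = _
  rw [AddMonoidAlgebra.coeff_single, Finsupp.single_eq_same, crep_of_mem _ hx]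

lemma exists_toSmooth_sum (s : Finset ℝ) (f : ℝ → Densities n M) :
    ∃ b : Densities n M, ∀ q, toSmooth b q = ∑ μ ∈ s, toSmooth (f μ) q := by
  classical
  induction s using Finset.induction_on with
  | empty =>
    refine ⟨(0 : ℝ) • 1, fun q => ?_⟩
    rw [toSmooth_smul, zero_smul, Finset.sum_empty]
    rfl
  | insert μ s hμ ih =>
    obtain ⟨b, hb⟩ := ih
    refine ⟨f μ + b, fun q => ?_⟩
    rw [Finset.sum_insert hμ, toSmooth_add, ← hb]
    rfl

/-- A function on `M̃` which is a combination of exponentials along the fibres comes from a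
density. -/
theorem exists_density_of_expansion (g : Thomas n M → ℝ) (s : Finset ℝ)
    (c : Chart n M → ℝ → E n → ℝ) (hc : ∀ e, ∀ μ ∈ s, ContDiffOn ℝ ∞ (c e μ) e.1.target)
    (hg : ∀ e : Chart n M, ∀ x ∈ e.1.target, ∀ t,
      g (pt e t x) = ∑ μ ∈ s, c e μ x * Real.exp (μ * t)) :
    ∃ b : Densities n M, ∀ q, toSmooth b q = g q := by
  let φ : ℝ → Coeff n M := fun μ e x => c e μ x
  have hrep : ∀ μ e, ∀ x ∈ e.1.target, crep (φ μ) e x = c e μ x := fun μ e x hx =>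
    crep_of_mem _ hx
  have hφ : ∀ μ ∈ s, IsDensity μ (φ μ) := fun μ hμ => by
    refine ⟨fun e => (hc e μ hμ).congr (hrep μ e), fun e e' x hx => ?_⟩
    rw [hrep μ e x (mem_overlap.1 hx).1, hrep μ e' _ (mem_overlap.1 (trans_mem hx)).1]
    -- The same point has fibre coordinates t and t + log J in the two charts. Equating both
    -- expansions for all t and separating exponents gives the factor J^μ of the density law.
    have h1 : ∀ t : ℝ, ∑ μ ∈ s,
        (c e μ x - jac e e' x ^ μ * c e' μ (coordTrans e e' x)) * Real.exp (μ * t) = 0 := fun t => by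
      simp only [sub_mul, Finset.sum_sub_distrib]
      rw [← hg e x (mem_overlap.1 hx).1, ← pt_trans hx,
        hg e' _ (mem_overlap.1 (trans_mem hx)).1, sub_eq_zero]
      refine Finset.sum_congr rfl fun ν _ => ?_
      rw [mul_add, Real.exp_add, Real.rpow_def_of_pos (jac_pos hx), logJac, mul_comm ν (Real.log _)]
      ring
    exact sub_eq_zero.1 (exp_sum_eq_zero h1 μ hμ)
  classical
  obtain ⟨b, hb⟩ := exists_toSmooth_sum s fun μ =>
    if hμ : μ ∈ s then (hφ μ hμ).toDensities else 1
  refine ⟨b, fun q => ?_⟩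
  obtain ⟨e, t, x, hx, rfl⟩ := exists_chart_pt q
  rw [hb, hg e x hx]
  refine Finset.sum_congr rfl fun μ hμ => ?_
  rw [dif_pos hμ, IsDensity.toSmooth_toDensities _ hx]

end Expansion

/-! ### The Laplacian on the coefficients of densities -/

section DensityLaplacian

variable {n : ℕ} {M : Type*} [TopologicalSpace M] [T2Space M] [ChartedSpace (E n) M]
  [IsManifold 𝓘(ℝ, E n) ∞ M]

/-- The components of a bracket are smooth. -/
lemma IsInducedTensor.contDiffOn_components {B : AlgBracket (Densities n M)}
    {T : SymTensor (n + 1) (Thomas n M)} (hT : IsInducedTensor B T) {w : ℝ} {e : Chart n M}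
    {S : Fin n → Fin n → E n → ℝ} {γ : Fin n → E n → ℝ} {θ : E n → ℝ}
    (h : HasComponents B w e S γ θ) : (∀ i j, ContDiffOn ℝ ∞ (S i j) e.1.target) ∧
      (∀ i, ContDiffOn ℝ ∞ (γ i) e.1.target) ∧ ContDiffOn ℝ ∞ θ e.1.target := by
  -- On the slice x⁰ = 0 the factor e^{wx⁰} is 1, so whatever functions serve as components inherit
  -- smoothness from the tensor field.
  have h1 : ContDiff ℝ ∞ fun x : E n => ext0 0 x :=
    (consL n).contDiff.comp (contDiff_id.prodMk contDiff_const)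
  have h2 : ∀ A C, ContDiffOn ℝ ∞ (fun x => compMatrix w S γ θ A C (ext0 0 x)) e.1.target :=
    fun A C => ((T.contDiffOn_comp (adapted e) A C).comp h1.contDiffOn
      fun x hx => ext0_mem_target.2 hx).congr fun x hx => (hT.comp_eq h hx 0 A C).symm
  have h3 : ∀ f : E n → ℝ, ∀ x, liftExp f w (ext0 0 x) = f x := fun f x => by
    simp [liftExp_ext0]
  simp only [compMatrix, h3] at h2
  exact ⟨fun i j => h2 i.succ j.succ, fun i => h2 0 i.succ, h2 0 0⟩

/-- The action of the Laplacian on the coefficient of a density of weight `μ`. -/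
def lapCoeff (D : Connection n M) (e : Chart n M) (w : ℝ) (S : Fin n → Fin n → E n → ℝ)
    (γ : Fin n → E n → ℝ) (θ : E n → ℝ) (μ : ℝ) (φ : E n → ℝ) (x : E n) : ℝ :=
  ∑ i, ∑ j, S i j x * pd i (pd j φ) x + 2 * ∑ i, γ i x * (μ * pd i φ x) + θ x * (μ * (μ * φ x)) +
    ∑ i, lapVec D e w S γ i x * pd i φ x + lapWeight D e w S γ θ x * (μ * φ x)

lemma contDiffOn_lapCoeff (D : Connection n M) (e : Chart n M) {w : ℝ}
    {S : Fin n → Fin n → E n → ℝ} {γ : Fin n → E n → ℝ} {θ : E n → ℝ}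
    (hS : ∀ i j, ContDiffOn ℝ ∞ (S i j) e.1.target) (hγ : ∀ i, ContDiffOn ℝ ∞ (γ i) e.1.target)
    (hθ : ContDiffOn ℝ ∞ θ e.1.target) (μ : ℝ) {φ : E n → ℝ} (hφ : ContDiffOn ℝ ∞ φ e.1.target) :
    ContDiffOn ℝ ∞ (lapCoeff D e w S γ θ μ φ) e.1.target := by
  have ho := e.1.open_target
  have c : ∀ r : ℝ, ContDiffOn ℝ ∞ (fun _ : E n => r) e.1.target := fun r => contDiffOn_const
  have hv : ∀ i, ContDiffOn ℝ ∞ (lapVec D e w S γ i) e.1.target := fun i =>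
    (((c _).mul (ContDiffOn.sum fun j _ => contDiffOn_pd (hS i j) ho j)).add
      ((c _).mul (hγ i))).sub ((c _).mul (ContDiffOn.sum fun j _ => ContDiffOn.sum fun k _ =>
        (hS j k).mul (D.contDiffOn_projCoeff e i j k)))
  have hw : ContDiffOn ℝ ∞ (lapWeight D e w S γ θ) e.1.target :=
    (((c _).mul (ContDiffOn.sum fun k _ => contDiffOn_pd (hγ k) ho k)).add
      ((c _).mul hθ)).sub ((c _).mul (ContDiffOn.sum fun i _ => ContDiffOn.sum fun j _ =>
        (hS i j).mul (D.contDiffOn_projRicci e i j)))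
  have hp : ∀ i, ContDiffOn ℝ ∞ (pd i φ) e.1.target := fun i => contDiffOn_pd hφ ho i
  exact ((((ContDiffOn.sum fun i _ => ContDiffOn.sum fun j _ =>
    (hS i j).mul (contDiffOn_pd (hp j) ho i)).add ((c _).mul (ContDiffOn.sum fun i _ =>
    (hγ i).mul ((c _).mul (hp i))))).add (hθ.mul ((c _).mul ((c _).mul hφ)))).add
    (ContDiffOn.sum fun i _ => (hv i).mul (hp i))).add (hw.mul ((c _).mul hφ))

lemma pd_succ_succ_fnIn {e : Chart n M} (a : Densities n M) {z : E (n + 1)}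
    (hz : tl z ∈ e.1.target) {s : Finset ℝ} (hs : a.1.coeff.support ⊆ s) (i j : Fin n) :
    pd i.succ (pd j.succ (fnIn e a)) z = ∑ μ ∈ s, liftExp (pd i (pd j (dcoeff a μ e))) μ z := by
  have h := fun μ => contDiffOn_pd (contDiffOn_dcoeff a μ e) e.1.open_target j
  rw [pd_congr (isOpen_tl_target e) (fun y hy => pd_succ_fnIn a hy hs j) hz,
    pd_sum s (isOpen_tl_target e) (fun μ _ => contDiffOn_liftExp (h μ) μ) hz]
  exact Finset.sum_congr rfl fun μ _ => pd_succ_liftExp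
    (differentiableAt_of_contDiffOn e.1.open_target (h μ) hz) μ i

lemma pd_succ_zero_fnIn {e : Chart n M} (a : Densities n M) {z : E (n + 1)}
    (hz : tl z ∈ e.1.target) {s : Finset ℝ} (hs : a.1.coeff.support ⊆ s) (i : Fin n) :
    pd i.succ (pd 0 (fnIn e a)) z = ∑ μ ∈ s, μ * liftExp (pd i (dcoeff a μ e)) μ z := by
  have h := fun μ => contDiffOn_dcoeff a μ e
  rw [pd_congr (isOpen_tl_target e) (fun y hy => pd_zero_fnIn a hy hs) hz,
    pd_sum s (isOpen_tl_target e)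
      (fun μ _ => contDiffOn_const.mul (contDiffOn_liftExp (h μ) μ)) hz]
  refine Finset.sum_congr rfl fun μ _ => ?_
  rw [pd_const_mul, pd_succ_liftExp (differentiableAt_of_contDiffOn e.1.open_target (h μ) hz)]

lemma pd_zero_zero_fnIn {e : Chart n M} (a : Densities n M) {z : E (n + 1)}
    (hz : tl z ∈ e.1.target) {s : Finset ℝ} (hs : a.1.coeff.support ⊆ s) :
    pd 0 (pd 0 (fnIn e a)) z = ∑ μ ∈ s, μ * (μ * liftExp (dcoeff a μ e) μ z) := by
  have h := fun μ => contDiffOn_dcoeff a μ e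
  rw [pd_congr (isOpen_tl_target e) (fun y hy => pd_zero_fnIn a hy hs) hz,
    pd_sum s (isOpen_tl_target e)
      (fun μ _ => contDiffOn_const.mul (contDiffOn_liftExp (h μ) μ)) hz]
  refine Finset.sum_congr rfl fun μ _ => ?_
  rw [pd_const_mul, pd_zero_liftExp (differentiableAt_of_contDiffOn e.1.open_target (h μ) hz)]

/-- The Laplacian acts on densities through their coefficients. -/
lemma lap_fnIn (D : Connection n M) {e : Chart n M} (w : ℝ) (S : Fin n → Fin n → E n → ℝ)
    (γ : Fin n → E n → ℝ) (θ : E n → ℝ) (a : Densities n M) {x : E n} (hx : x ∈ e.1.target) (t : ℝ) :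
    Real.exp (w * t) *
      (∑ i, ∑ j, S i j x * pd i.succ (pd j.succ (fnIn e a)) (ext0 t x) +
        2 * ∑ i, γ i x * pd i.succ (pd 0 (fnIn e a)) (ext0 t x) +
        θ x * pd 0 (pd 0 (fnIn e a)) (ext0 t x) +
        ∑ i, lapVec D e w S γ i x * pd i.succ (fnIn e a) (ext0 t x) +
        lapWeight D e w S γ θ x * pd 0 (fnIn e a) (ext0 t x)) =
      ∑ μ ∈ a.1.coeff.support,
        lapCoeff D e w S γ θ μ (dcoeff a μ e) x * Real.exp ((μ + w) * t) := by
  have hz : tl (ext0 t x) ∈ e.1.target := by rwa [tl_ext0]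
  rw [pd_zero_fnIn a hz subset_rfl, pd_zero_zero_fnIn a hz subset_rfl]
  simp only [pd_succ_fnIn a hz subset_rfl, pd_succ_zero_fnIn a hz subset_rfl,
    pd_succ_succ_fnIn a hz subset_rfl, liftExp_ext0]
  generalize a.1.coeff.support = s
  have e1 : ∑ i, ∑ j, S i j x * ∑ μ ∈ s, pd i (pd j (dcoeff a μ e)) x * Real.exp (μ * t) =
      ∑ μ ∈ s, ∑ i, ∑ j, S i j x * (pd i (pd j (dcoeff a μ e)) x * Real.exp (μ * t)) := by
    simp only [Finset.mul_sum]
    exact (Finset.sum_congr rfl fun i _ => Finset.sum_comm).trans Finset.sum_comm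
  have e2 : ∀ (u : Fin n → ℝ) (v : ℝ → Fin n → ℝ),
      ∑ i, u i * ∑ μ ∈ s, v μ i = ∑ μ ∈ s, ∑ i, u i * v μ i := fun u v => by
    simp only [Finset.mul_sum]
    exact Finset.sum_comm
  have e3 : ∀ (p q r u v : ℝ → ℝ) (ε c d : ℝ), ε * (∑ μ ∈ s, p μ + 2 * ∑ μ ∈ s, q μ +
      c * ∑ μ ∈ s, r μ + ∑ μ ∈ s, u μ + d * ∑ μ ∈ s, v μ) =
      ∑ μ ∈ s, ε * (p μ + 2 * q μ + c * r μ + u μ + d * v μ) := fun p q r u v ε c d => by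
    simp only [Finset.mul_sum, ← Finset.sum_add_distrib]
  rw [e1, e2, e2, e3]
  refine Finset.sum_congr rfl fun μ _ => ?_
  rw [add_mul, Real.exp_add, lapCoeff]
  simp only [← mul_assoc, ← Finset.sum_mul]
  ring

end DensityLaplacian

/-! ### The canonical operator on densities -/

section Canonical

variable {n : ℕ} {M : Type*} [TopologicalSpace M] [T2Space M] [ChartedSpace (E n) M]
  [IsManifold 𝓘(ℝ, E n) ∞ M]

/-- The Laplacian on `M̃` in adapted coordinates. -/
theorem IsProjectiveLaplacian.apply_pt {P : ProjectiveClass n M} {B : AlgBracket (Densities n M)}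
    {P' : ProjectiveClass (n + 1) (Thomas n M)} (hP : IsInducedClass P P')
    {T : SymTensor (n + 1) (Thomas n M)} (hT : IsInducedTensor B T)
    {L : C^∞⟮𝓘(ℝ, E (n + 1)), Thomas n M; ℝ⟯ →ₗ[ℝ] C^∞⟮𝓘(ℝ, E (n + 1)), Thomas n M; ℝ⟯}
    (hL : IsProjectiveLaplacian P' T L) {D : Connection n M} (hD : D.Mem P) {w : ℝ} {e : Chart n M}
    {S : Fin n → Fin n → E n → ℝ} {γ : Fin n → E n → ℝ} {θ : E n → ℝ}
    (h : HasComponents B w e S γ θ) (a : Densities n M) {x : E n} (hx : x ∈ e.1.target) (t : ℝ) :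
    L (toSmooth a) (pt e t x) = Real.exp (w * t) *
      (∑ i, ∑ j, S i j x * pd i.succ (pd j.succ (fnIn e a)) (ext0 t x) +
        2 * ∑ i, γ i x * pd i.succ (pd 0 (fnIn e a)) (ext0 t x) +
        θ x * pd 0 (pd 0 (fnIn e a)) (ext0 t x) +
        ∑ i, lapVec D e w S γ i x * pd i.succ (fnIn e a) (ext0 t x) +
        lapWeight D e w S γ θ x * pd 0 (fnIn e a) (ext0 t x)) := by
  obtain ⟨D', hD', hTh⟩ := hP
  obtain ⟨hS, hγ, hθ⟩ := hT.contDiffOn_components h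
  refine (hL D' hD' (adapted e) (toSmooth a) _ (ext0_mem_target.2 hx)).trans ?_
  refine lapIn_thomas (hTh D hD) hS hγ hθ (fun A C z hz => ?_)
    (contDiffOn_comp_symm (adapted e) (toSmooth a)) hx t
  rw [← ext0_hd_tl z]
  exact hT.comp_eq h (mem_thomas_target.1 hz) _ A C

/-- The Laplacian of an induced tensor field maps densities to densities. -/
theorem IsProjectiveLaplacian.exists_restriction {P : ProjectiveClass n M}
    {B : AlgBracket (Densities n M)} {w : ℝ} (hB : HasWeight B w)
    {P' : ProjectiveClass (n + 1) (Thomas n M)} (hP : IsInducedClass P P')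
    {T : SymTensor (n + 1) (Thomas n M)} (hT : IsInducedTensor B T)
    {L : C^∞⟮𝓘(ℝ, E (n + 1)), Thomas n M; ℝ⟯ →ₗ[ℝ] C^∞⟮𝓘(ℝ, E (n + 1)), Thomas n M; ℝ⟯}
    (hL : IsProjectiveLaplacian P' T L) :
    ∃ R : Densities n M →ₗ[ℝ] Densities n M, ∀ a, L (toSmooth a) = toSmooth (R a) := by
  classical
  obtain ⟨D, hD⟩ := Quotient.exists_rep P
  choose S γ θ h hS hγ hθ using fun e : Chart n M => exists_components hB e
  have h1 : ∀ a, ∃ b : Densities n M, ∀ q, toSmooth b q = L (toSmooth a) q := fun a => by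
    -- The operator raises every weight by `w`, so the coefficient of weight μ of the result comes
    -- from that of weight μ - w of `a`.
    refine exists_density_of_expansion (fun q => L (toSmooth a) q)
      (a.1.coeff.support.image (· + w))
      (fun e μ => lapCoeff D e w (S e) (γ e) (θ e) (μ - w) (dcoeff a (μ - w) e))
      (fun e μ _ => contDiffOn_lapCoeff D e (hS e) (hγ e) (hθ e) _ (contDiffOn_dcoeff a _ e))
      fun e x hx t => ?_
    rw [hL.apply_pt hP hT hD (h e) a hx, lap_fnIn D w _ _ _ a hx,
      Finset.sum_image (add_left_injective w).injOn]
    simp only [add_sub_cancel_right]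
  choose R hR using h1
  have h2 : ∀ a, toSmooth (R a) = L (toSmooth a) := fun a => ContMDiffMap.ext (hR a)
  refine ⟨{ toFun := R, map_add' := fun a b => ?_, map_smul' := fun c a => ?_ }, fun a => (h2 a).symm⟩
  · apply toSmooth_injective
    rw [toSmooth_add, h2, h2, h2, toSmooth_add, map_add]
  · apply toSmooth_injective
    rw [RingHom.id_apply, toSmooth_smul, h2, h2, toSmooth_smul, map_smul]

/-- The Laplacian on densities generates the bracket. -/
theorem IsDensityLaplacian.generates {P : ProjectiveClass n M} {B : AlgBracket (Densities n M)}
    {R : Densities n M →ₗ[ℝ] Densities n M} (h : IsDensityLaplacian P B R) :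
    Generates (A := Densities n M) ((1 / 2 : ℝ) • R) B := by
  obtain ⟨P', T, L, hP, hT, hL, hR⟩ := h
  rw [generates_iff_add]
  intro a b
  apply toSmooth_injective
  refine ContMDiffMap.ext fun q => ?_
  have h1 := hL.leibniz (toSmooth a) (toSmooth b) q
  rw [← toSmooth_mul, ← toSmooth_one, hR, hR, hR, hR] at h1
  have h2 := hT a b q
  generalize B.der a b = c at h2 ⊢
  have h3 : ∀ u v : Densities n M, toSmooth (u + v) q = toSmooth u q + toSmooth v q := fun u v => by
    rw [toSmooth_add]
    rfl
  have h4 : ∀ u v : Densities n M, toSmooth (u * v) q = toSmooth u q * toSmooth v q := fun u v => by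
    rw [toSmooth_mul]
    rfl
  have h5 : ∀ u : Densities n M,
      toSmooth (((1 / 2 : ℝ) • R) u) q = (1 / 2) * toSmooth (R u) q := fun u => by
    rw [LinearMap.smul_apply, toSmooth_smul]
    rfl
  rw [h2] at h1
  simp only [h3, h4, h5] at h1 ⊢
  linear_combination -(1 / 2) * h1

/-- The induced class, the induced tensor field and the projective Laplacian are each unique, and a
density is determined by its function on M̃. -/
lemma IsDensityLaplacian.unique (hn : 1 < n) {P : ProjectiveClass n M}
    {B : AlgBracket (Densities n M)} {w : ℝ} (hB : HasWeight B w) (hpow : PowerRule B)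
    {R R' : Densities n M →ₗ[ℝ] Densities n M} (h : IsDensityLaplacian P B R)
    (h' : IsDensityLaplacian P B R') : R' = R := by
  obtain ⟨P₁, T₁, L₁, hP₁, hT₁, hL₁, hR₁⟩ := h
  obtain ⟨P₂, T₂, L₂, hP₂, hT₂, hL₂, hR₂⟩ := h'
  obtain rfl := (existsUnique_inducedClass hn P).unique hP₁ hP₂
  obtain rfl := (existsUnique_inducedTensor hB hpow).unique hT₁ hT₂
  obtain rfl := hL₁.unique hL₂
  exact LinearMap.ext fun a => toSmooth_injective ((hR₂ a).symm.trans (hR₁ a))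

end Canonical

end ProjDens

end

/-! ### The main theorem -/

theorem mainTheorem4 {n : ℕ} (hn : 1 < n) {M : Type*} [TopologicalSpace M] [T2Space M]
    [ChartedSpace (E n) M] [IsManifold 𝓘(ℝ, E n) ∞ M]
    (P : ProjectiveClass n M) (w : ℝ) (B : AlgBracket (Densities n M))
    (hB : HasWeight B w) (hpow : PowerRule B) :
    -- the bracket has components in every chart, and they are smooth
    (∀ e : Chart n M, ∃ (S : Fin n → Fin n → E n → ℝ) (γ : Fin n → E n → ℝ) (θ : E n → ℝ),
      HasComponents B w e S γ θ ∧ (∀ i j, ContDiffOn ℝ ∞ (S i j) e.1.target) ∧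
        (∀ i, ContDiffOn ℝ ∞ (γ i) e.1.target) ∧ ContDiffOn ℝ ∞ θ e.1.target) ∧
    -- there is exactly one projective class, and one tensor field, induced on the Thomas manifold
    (∃! P' : ProjectiveClass (n + 1) (Thomas n M), IsInducedClass P P') ∧
    (∃! S' : SymTensor (n + 1) (Thomas n M), IsInducedTensor B S') ∧
    -- the components of the induced tensor field in adapted coordinates
    (∀ S' : SymTensor (n + 1) (Thomas n M), IsInducedTensor B S' →
      ∀ (e : Chart n M) (S : Fin n → Fin n → E n → ℝ) (γ : Fin n → E n → ℝ) (θ : E n → ℝ),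
        HasComponents B w e S γ θ → ∀ x ∈ e.1.target, ∀ t : ℝ,
          (∀ i j : Fin n, S'.comp (adapted e) i.succ j.succ (ext0 t x) =
            Real.exp (w * t) * S i j x) ∧
          (∀ i : Fin n, S'.comp (adapted e) 0 i.succ (ext0 t x) = Real.exp (w * t) * γ i x ∧
            S'.comp (adapted e) i.succ 0 (ext0 t x) = Real.exp (w * t) * γ i x) ∧
          S'.comp (adapted e) 0 0 (ext0 t x) = Real.exp (w * t) * θ x) ∧
    -- the canonical operator
    ∃ T : Densities n M →ₗ[ℝ] Densities n M,
      IsDensityLaplacian P B T ∧ (∀ T', IsDensityLaplacian P B T' → T' = T) ∧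
      OrderLE (A := Densities n M) 2 T ∧ Generates (A := Densities n M) ((1 / 2 : ℝ) • T) B ∧
      -- its expression in adapted coordinates
      ∀ D : Connection n M, D.Mem P →
      ∀ (e : Chart n M) (S : Fin n → Fin n → E n → ℝ) (γ : Fin n → E n → ℝ) (θ : E n → ℝ),
        HasComponents B w e S γ θ →
      ∀ (a : Densities n M), ∀ x ∈ e.1.target, ∀ t : ℝ,
        let F : E (n + 1) → ℝ := fun z => toSmooth a ((adapted e).1.symm z)
        let z : E (n + 1) := ext0 t x
        toSmooth (T a) ((adapted e).1.symm z) = Real.exp (w * t) *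
          (∑ i, ∑ j, S i j x * pd i.succ (pd j.succ F) z +
            2 * ∑ i, γ i x * pd i.succ (pd 0 F) z +
            θ x * pd 0 (pd 0 F) z +
            ∑ i, (2 / ((n : ℝ) + 4) * ∑ j, pd j (S i j) x +
              2 * (w + n * w + 1) / (((n : ℝ) + 1) * ((n : ℝ) + 4)) * γ i x -
              ((n : ℝ) + 2) / ((n : ℝ) + 4) * ∑ j, ∑ k, S j k x * D.projCoeff e i j k x) *
              pd i.succ F z +
            (2 / ((n : ℝ) + 4) * ∑ k, pd k (γ k) x +
              (2 * w + 2 * w * n - n) / (((n : ℝ) + 1) * ((n : ℝ) + 4)) * θ x -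
              ((n : ℝ) + 1) * ((n : ℝ) + 2) / (((n : ℝ) - 1) * ((n : ℝ) + 4)) *
                ∑ i, ∑ j, S i j x * D.projRicci e i j x) *
              pd 0 F z) := by
  obtain ⟨P', hP'⟩ := (existsUnique_inducedClass hn P).exists
  obtain ⟨S', hS'⟩ := (existsUnique_inducedTensor hB hpow).exists
  obtain ⟨L, hL⟩ := exists_projectiveLaplacian P' S'
  obtain ⟨T, hT⟩ := hL.exists_restriction hB hP' hS'
  have hlap : IsDensityLaplacian P B T := ⟨P', S', L, hP', hS', hL, hT⟩
  refine ⟨exists_components hB, existsUnique_inducedClass hn P,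
    existsUnique_inducedTensor hB hpow, fun S' hS' e S γ θ h x hx t => hS'.components h hx t,
    T, hlap, fun T' hT' => hlap.unique hn hB hpow hT', hlap.generates.orderLE, hlap.generates,
    fun D hD e S γ θ h a x hx t => ?_⟩
  have h1 := hL.apply_pt hP' hS' hD h a hx t
  rw [hT] at h1
  exact h1
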